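/- Let $M$ be a smooth manifold and let $(E,g)$ be a sub-Riemannian structure on $M$: $E\subseteq TM$ is a smooth subbundle and $g=\langle\cdot,\cdot\rangle$ is a smooth metric tensor on $E$. Let $E^{-k}_x\subseteq T_xM$ be the span of the values at $x$ of all iterated brackets $[X_1,[X_2,\dots[X_{j-1},X_j]\dots]]$ of length $j\le k$ of (local) smooth sections of $E$. Assume that $E$ has growth vector $(2,3,5)$, i.e. $E=E^{-1}$, $E^{-2}$ and $E^{-3}=TM$ are subbundles of ranks $2$, $3$ and $5$. An $E$-grading over an open set $U\subseteq M$ is a decomposition $TM|_U=(TM)_{-1}\oplus(TM)_{-2}\oplus(TM)_{-3}$ into smooth subbundles such that $E^{-k}=\bigoplus_{j\le k}(TM)_{-j}$ for $k=1,2,3$. The bundle $E$ is orientable over a neighborhood of each point. If $E|_U$ is oriented, let $J:E|_U\to E|_U$ be the endomorphism such that $(u,Ju)$ is a positively oriented orthonormal basis for every unit vector $u\in E|_U$. There is a unique smooth $E$-valued one-form $\varphi:TM\to E$ on $M$ such that $\ker\varphi=E^{-2}$ and $$\varphi([X,[X,JX]])=\|X\|_g^2\,JX$$ for every local section $X$ of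 $E$ and every choice of local orientation. On an oriented open set $U$ define the two-form $\Psi(v,w)=\langle J\varphi(v),\varphi(w)\rangle$. For every $E$-grading over an oriented open set $U$ there is a unique smooth one-form $\theta$ on $U$ such that $\ker\theta=(TM)_{-3}\oplus(TM)_{-1}$ and $d\theta(u,v)=\langle u,Jv\rangle$ for all $u,v\in E$. Then over every oriented open set $U$ there is a unique $E$-grading $TM|_U=(TM)'_{-1}\oplus(TM)'_{-2}\oplus(TM)'_{-3}$ such that (i) $d\Psi(u,w_1,w_2)=0$ for all $u\in E$ and $w_1,w_2\in(TM)'_{-3}$; (ii) $d\theta(u,w)=0$ for all $u\in E$ and $w\in(TM)'_{-2}\oplus(TM)'_{-3}$, where $\theta$ is the one-form of this grading. Moreover, this grading is canonical and global: there is a unique $E$-grading $I'$ of $TM$ over all of $M$ which satisfies (i) and (ii) over every open set $U\subseteq M$ and for every orientation of $E|_U$. -/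

import Mathlib

open scoped Manifold ContDiff Topology

noncomputable section

namespace SubRiem

variable {n : ℕ} {M : Type*} [TopologicalSpace M] [ChartedSpace (EuclideanSpace ℝ (Fin n)) M]
  [IsManifold (𝓡 n) ∞ M]

/-- The vector field `X` is smooth on the set `U`. -/
def SmoothFieldOn (U : Set M) (X : Π x : M, TangentSpace (𝓡 n) x) : Prop :=
  ContMDiffOn (𝓡 n) (𝓡 n).tangent ∞ (fun x => (⟨x, X x⟩ : TangentBundle (𝓡 n) M)) U

/-- Over the open set `U`, the family of subspaces `F` is a smooth subbundle of `TM` of rank `r`: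
locally it is spanned by `r` linearly independent smooth vector fields. -/
def IsSubbundleOn (U : Set M) (F : Π x : M, Submodule ℝ (TangentSpace (𝓡 n) x)) (r : ℕ) : Prop :=
  ∀ x ∈ U, ∃ W : Set M, IsOpen W ∧ x ∈ W ∧ W ⊆ U ∧
    ∃ X : Fin r → Π y : M, TangentSpace (𝓡 n) y, (∀ i, SmoothFieldOn W (X i)) ∧
      ∀ y ∈ W, LinearIndependent ℝ (fun i => X i y) ∧
        Submodule.span ℝ (Set.range fun i => X i y) = F y

/-- The differential form `α` is smooth on the open set `U`: it takes smooth vector fields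
on open subsets of `U` to smooth functions. -/
def SmoothFormOn {k : ℕ} (U : Set M) (α : Π x : M, TangentSpace (𝓡 n) x [⋀^Fin k]→L[ℝ] ℝ) : Prop :=
  ∀ W ⊆ U, IsOpen W → ∀ X : Fin k → Π x : M, TangentSpace (𝓡 n) x,
    (∀ i, SmoothFieldOn W (X i)) →
      ContMDiffOn (𝓡 n) 𝓘(ℝ, ℝ) ∞ (fun x => α x (fun i => X i x)) W

/-- The exterior derivative of a differential form on `M` at the point `x`, computed in the
preferred chart at `x`: pull the form back to the model space by the inverse of the chart, take
the exterior derivative there, and pull the result back by the chart. Normalization: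
`dα(X, Y) = X α(Y) - Y α(X) - α([X, Y])` for one-forms. -/
def mextDeriv {k : ℕ} (α : Π x : M, TangentSpace (𝓡 n) x [⋀^Fin k]→L[ℝ] ℝ) (x : M) :
    TangentSpace (𝓡 n) x [⋀^Fin (k + 1)]→L[ℝ] ℝ :=
  (extDeriv (fun y : EuclideanSpace ℝ (Fin n) =>
      (α ((extChartAt (𝓡 n) x).symm y)).compContinuousLinearMap
        (mfderiv 𝓘(ℝ, EuclideanSpace ℝ (Fin n)) (𝓡 n) (extChartAt (𝓡 n) x).symm y :
          EuclideanSpace ℝ (Fin n) →L[ℝ] TangentSpace (𝓡 n) ((extChartAt (𝓡 n) x).symm y)))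
    (extChartAt (𝓡 n) x x)).compContinuousLinearMap
      (mfderiv (𝓡 n) 𝓘(ℝ, EuclideanSpace ℝ (Fin n)) (extChartAt (𝓡 n) x) x :
        TangentSpace (𝓡 n) x →L[ℝ] EuclideanSpace ℝ (Fin n))

variable (n M) in
/-- A sub-Riemannian structure `(E, g)` on `M`: a smooth subbundle `E` of `TM` and a smooth
metric tensor `g` on `E`. -/
structure Structure where
  /-- the horizontal bundle -/
  E : Π x : M, Submodule ℝ (TangentSpace (𝓡 n) x)
  isSubbundle : ∃ r : ℕ, IsSubbundleOn Set.univ E r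
  /-- the metric tensor -/
  g : Π x : M, E x →ₗ[ℝ] E x →ₗ[ℝ] ℝ
  symm : ∀ x u v, g x u v = g x v u
  pos : ∀ x u, u ≠ 0 → 0 < g x u u
  smooth : ∀ U : Set M, IsOpen U → ∀ X Y : Π x : M, E x,
    SmoothFieldOn U (fun x => (X x : TangentSpace (𝓡 n) x)) →
    SmoothFieldOn U (fun x => (Y x : TangentSpace (𝓡 n) x)) →
      ContMDiffOn (𝓡 n) 𝓘(ℝ, ℝ) ∞ (fun x => g x (X x) (Y x)) U

namespace Structure

variable (S : Structure n M)

/-- `X` is a smooth section of `E` over `U`. -/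
def IsSection (U : Set M) (X : Π x : M, S.E x) : Prop :=
  SmoothFieldOn U (fun x => (X x : TangentSpace (𝓡 n) x))

/-- `S.IsIterBracket U j Z`: over `U`, `Z` is an iterated bracket
`[X₁, [X₂, ⋯ [X_{j-1}, X_j] ⋯ ]]` of length `j` of smooth sections of `E` over `U`. -/
inductive IsIterBracket (U : Set M) : ℕ → (Π x : M, TangentSpace (𝓡 n) x) → Prop
  | base (X : Π x : M, S.E x) (hX : S.IsSection U X) :
      IsIterBracket U 1 (fun x => (X x : TangentSpace (𝓡 n) x))
  | step (X : Π x : M, S.E x) (hX : S.IsSection U X) (j : ℕ) (Z : Π x : M, TangentSpace (𝓡 n) x)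
      (hZ : IsIterBracket U j Z) :
      IsIterBracket U (j + 1)
        (VectorField.mlieBracket (𝓡 n) (fun x => (X x : TangentSpace (𝓡 n) x)) Z)

/-- The subspace `E^{-k}_x`: the span of the values at `x` of all iterated brackets of length at
most `k` of sections of `E` defined near `x`. -/
def flag (k : ℕ) (x : M) : Submodule ℝ (TangentSpace (𝓡 n) x) :=
  Submodule.span ℝ {v | ∃ U : Set M, IsOpen U ∧ x ∈ U ∧ ∃ j ≤ k,
    ∃ Z : Π y : M, TangentSpace (𝓡 n) y, S.IsIterBracket U j Z ∧ v = Z x}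

/-- `E` is bracket-generating and equiregular of step `s`, with growth vector
`(r 0, …, r (s - 1))`. -/
def HasGrowthVector {s : ℕ} (r : Fin s → ℕ) : Prop :=
  (∀ i : Fin s, IsSubbundleOn Set.univ (S.flag (i + 1)) (r i)) ∧
  (∀ x, S.flag s x = ⊤) ∧ ∀ k < s, ¬ ∀ x, S.flag k x = ⊤

/-- Over the open set `U`, `TM = ⊕ₖ (TM)_{-k}` (`1 ≤ k ≤ s`) is an `E`-grading. Here
`V i = (TM)_{-(i+1)}` for `i = 0, …, s - 1`. -/
structure IsGradingOn {s : ℕ} (U : Set M)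
    (V : Fin s → Π x : M, Submodule ℝ (TangentSpace (𝓡 n) x)) : Prop where
  isSubbundle : ∀ i, ∃ r : ℕ, IsSubbundleOn U (V i) r
  isInternal : ∀ x ∈ U, DirectSum.IsInternal (fun i => V i x)
  flag_eq : ∀ x ∈ U, ∀ k ≤ s, S.flag k x = ⨆ i : {i : Fin s // (i : ℕ) < k}, V i x

/-- For `E` of rank two, an orientation of `E` over `U`, given by its rotation `J`, so that
for each unit vector `u` the positively oriented orthonormal basis starting with `u` is
`(u, J u)`. -/
structure IsRotationOn (U : Set M) (J : Π x : M, S.E x →ₗ[ℝ] S.E x) : Prop where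
  smooth : ∀ W ⊆ U, IsOpen W → ∀ X : Π x : M, S.E x, S.IsSection W X →
    S.IsSection W (fun x => J x (X x))
  orthonormal : ∀ x ∈ U, ∀ u : S.E x, S.g x u u = 1 →
    S.g x u (J x u) = 0 ∧ S.g x (J x u) (J x u) = 1

/-- The defining properties of the `E`-valued one-form `φ`: it is smooth, `ker φ = E^{-2}`, and
`φ([X, [X, J X]]) = ‖X‖² J X` for local sections `X` of `E`, and either local orientation. -/
structure IsPhi (φ : Π x : M, TangentSpace (𝓡 n) x →ₗ[ℝ] S.E x) : Prop where
  smooth : ∀ U : Set M, IsOpen U → ∀ X : Π x : M, TangentSpace (𝓡 n) x, SmoothFieldOn U X →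
    S.IsSection U (fun x => φ x (X x))
  ker_eq : ∀ x, LinearMap.ker (φ x) = S.flag 2 x
  bracket : ∀ U : Set M, IsOpen U → ∀ J : Π x : M, S.E x →ₗ[ℝ] S.E x, S.IsRotationOn U J →
    ∀ X : Π x : M, S.E x, S.IsSection U X → ∀ x ∈ U,
      φ x (VectorField.mlieBracket (𝓡 n) (fun y => (X y : TangentSpace (𝓡 n) y))
        (VectorField.mlieBracket (𝓡 n) (fun y => (X y : TangentSpace (𝓡 n) y))
          (fun y => (J y (X y) : TangentSpace (𝓡 n) y))) x) = S.g x (X x) (X x) • J x (X x)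

variable {S} in
/-- A rotation is skew-symmetric. -/
theorem IsRotationOn.self_eq_zero {U : Set M} {J : Π x : M, S.E x →ₗ[ℝ] S.E x}
    (hJ : S.IsRotationOn U J) {x : M} (hx : x ∈ U) (u : S.E x) : S.g x (J x u) u = 0 := by
  by_cases hu : u = 0
  · simp [hu]
  have hp := S.pos x u hu
  have hs : 0 < Real.sqrt (S.g x u u) := Real.sqrt_pos.2 hp
  have h := (hJ.orthonormal x hx ((Real.sqrt (S.g x u u))⁻¹ • u) (by
    simp only [map_smul, LinearMap.smul_apply, smul_eq_mul]
    field_simp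
    rw [Real.sq_sqrt hp.le])).1
  rw [S.symm]
  simpa [hs.ne'] using h

/-- The two-form `Ψ(v, w) = ⟨J φ(v), φ(w)⟩` on the set `U` where `J` is given
(extended by zero outside of `U`). -/
def Psi {U : Set M} {J : Π x : M, S.E x →ₗ[ℝ] S.E x} (hJ : S.IsRotationOn U J)
    (φ : Π x : M, TangentSpace (𝓡 n) x →ₗ[ℝ] S.E x) (x : M) :
    TangentSpace (𝓡 n) x [⋀^Fin 2]→L[ℝ] ℝ :=
  open Classical in
  if hx : x ∈ U then
    { toFun := fun v => S.g x (J x (φ x (v 0))) (φ x (v 1))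
      map_update_add' := by
        intro _ m i v w
        fin_cases i <;> simp [Function.update]
      map_update_smul' := by
        intro _ m i c v
        fin_cases i <;> simp [Function.update]
      cont := by
        have : FiniteDimensional ℝ (TangentSpace (𝓡 n) x) :=
          inferInstanceAs (FiniteDimensional ℝ (EuclideanSpace ℝ (Fin n)))
        let B : EuclideanSpace ℝ (Fin n) →ₗ[ℝ] EuclideanSpace ℝ (Fin n) →ₗ[ℝ] ℝ :=
          (S.g x).compl₁₂ (J x ∘ₗ φ x) (φ x)
        let L : EuclideanSpace ℝ (Fin n) →L[ℝ] EuclideanSpace ℝ (Fin n) →L[ℝ] ℝ :=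
          LinearMap.toContinuousLinearMap (LinearMap.toContinuousLinearMap.toLinearMap ∘ₗ B)
        have h : Continuous fun v : Fin 2 → EuclideanSpace ℝ (Fin n) => L (v 0) (v 1) := by
          fun_prop
        exact h
      map_eq_zero_of_eq' := by
        intro v i j hv hij
        have h01 : v 0 = v 1 := by
          fin_cases i <;> fin_cases j <;> simp_all
        show S.g x (J x (φ x (v 0))) (φ x (v 1)) = 0
        rw [h01]
        exact hJ.self_eq_zero hx _ }
  else 0

/-- Over `U`, `θ` is the smooth one-form with `ker θ = (TM)_{-3} ⊕ (TM)_{-1}` and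
`dθ(u, v) = ⟨u, J v⟩` for `u, v ∈ E`. -/
structure IsThetaOn (U : Set M) (J : Π x : M, S.E x →ₗ[ℝ] S.E x)
    (V : Fin 3 → Π x : M, Submodule ℝ (TangentSpace (𝓡 n) x))
    (θ : Π x : M, TangentSpace (𝓡 n) x [⋀^Fin 1]→L[ℝ] ℝ) : Prop where
  smooth : SmoothFormOn U θ
  ker_eq : ∀ x ∈ U, ∀ w : TangentSpace (𝓡 n) x, θ x ![w] = 0 ↔ w ∈ V 2 x ⊔ V 0 x
  normalized : ∀ x ∈ U, ∀ u v : S.E x,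
    mextDeriv θ x ![(u : TangentSpace (𝓡 n) x), (v : TangentSpace (𝓡 n) x)] = S.g x u (J x v)

/-- Over `U`, the grading `V` satisfies: `dΨ(u, w₁, w₂) = 0` for `u ∈ E`,
`w₁, w₂ ∈ (TM)_{-3}`. -/
def CondI {U : Set M} {J : Π x : M, S.E x →ₗ[ℝ] S.E x} (hJ : S.IsRotationOn U J)
    (φ : Π x : M, TangentSpace (𝓡 n) x →ₗ[ℝ] S.E x)
    (V : Fin 3 → Π x : M, Submodule ℝ (TangentSpace (𝓡 n) x)) : Prop :=
  ∀ x ∈ U, ∀ u ∈ S.E x, ∀ w₁ ∈ V 2 x, ∀ w₂ ∈ V 2 x, mextDeriv (S.Psi hJ φ) x ![u, w₁, w₂] = 0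

/-- Over `U`, the grading `V` satisfies: `dθ(u, w) = 0` for `u ∈ E`,
`w ∈ (TM)_{-2} ⊕ (TM)_{-3}`. -/
def CondII (U : Set M) (V : Fin 3 → Π x : M, Submodule ℝ (TangentSpace (𝓡 n) x))
    (θ : Π x : M, TangentSpace (𝓡 n) x [⋀^Fin 1]→L[ℝ] ℝ) : Prop :=
  ∀ x ∈ U, ∀ u ∈ S.E x, ∀ w ∈ V 1 x ⊔ V 2 x, mextDeriv θ x ![u, w] = 0

end Structure

end SubRiem

end

set_option linter.unusedSectionVars false

noncomputable section

namespace SubRiem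

open VectorField Set Filter

/-! ### Smooth vector fields -/

section

/-! Everything reduces to a computation in one kind of local frame. From a positively oriented
orthonormal frame X₀, X₁ = J X₀ of E form X₂ = [X₀, X₁], X₃ = [X₀, X₂], X₄ = [X₁, X₂]. A bracket of
fields lying in the span of given fields is, modulo that span, tensorial, so the growth vector
(2,3,5) forces the Xᵢ to be a frame of TM adapted to the flag (`IsOrthonormalOn.isAdapted`). Let ξ⁰,
…, ξ⁴ be the dual coframe. The defining identity of φ with X = X₀ and X = X₁ gives φ = ξ³ X₁ − ξ⁴ X₀
(`IsPhiOn.eq_phi`), and this formula does satisfy the identity for all X (`IsAdapted.isPhiOn`).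
Hence Ψ = ξ³ ∧ ξ⁴ (`IsAdapted.isWedge_Psi`). For every grading θ restricts to ξ² on E⁻²
(`IsThetaOn.apply_flag_two`).

Modulo E, the summand (TM)₋₃ is spanned by X₃ + a X₂ and X₄ + b X₂. Put tᵢ = dΨ(Xᵢ, X₃, X₄). On this
pair of vectors, dΨ(X₀, ·, ·) takes the value t₀ − a and dΨ(X₁, ·, ·) the value t₁ − b
(`IsAdapted.IsWedge.trilin_eq`). So (i) says precisely a = t₀, b = t₁, or equivalently θ = ξ² − t₀
ξ³ − t₁ ξ⁴ (`IsThetaOn.apply_eq`). Since dθ is nondegenerate on E, the dθ-orthogonal H of E is a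
complement of E. Condition (ii) puts the other two summands into H, which leaves only (TM)₋₂ = H ∩
E⁻² and (TM)₋₃ = H ∩ ker θ (`IsGradingOn.le_of_theta`). Conversely, shifting X₂, X₃ + t₀ X₂, X₄ + t₁
X₂ along E into H produces such a grading (`IsAdapted.exists_isCanonicalOn`).

Reversing the orientation changes the signs of J, Ψ and θ and leaves both conditions intact
(`IsCanonicalOn.of_eq_smul`). All the objects φ, θ and the grading are locally unique, so the local
ones glue (`exists_of_locally_unique`). -/

/-- A map into the continuous alternating forms on a finite-dimensional space is differentiable
as soon as all its evaluations are. -/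
theorem differentiableAt_of_forall_apply {E F : Type*} [NormedAddCommGroup E] [NormedSpace ℝ E]
    [NormedAddCommGroup F] [NormedSpace ℝ F] [FiniteDimensional ℝ F] {k : ℕ}
    {f : E → F [⋀^Fin k]→L[ℝ] ℝ} {p : E}
    (h : ∀ v : Fin k → F, DifferentiableAt ℝ (fun y => f y v) p) : DifferentiableAt ℝ f p := by
  let b := Module.finBasis ℝ F
  let ev : (F [⋀^Fin k]→L[ℝ] ℝ) →ₗ[ℝ] ((Fin k → Fin (Module.finrank ℝ F)) → ℝ) :=
    { toFun := fun w s => w (fun i => b (s i))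
      map_add' := fun _ _ => rfl
      map_smul' := fun _ _ => rfl }
  have hinj : Function.Injective ev := by
    intro w₁ w₂ h12
    have : w₁.toMultilinearMap = w₂.toMultilinearMap :=
      Module.Basis.ext_multilinear (fun _ => b) fun s => congrFun h12 s
    ext v
    exact congrArg (fun m : MultilinearMap ℝ (fun _ : Fin k => F) ℝ => m v) this
  have : FiniteDimensional ℝ (F [⋀^Fin k]→L[ℝ] ℝ) := FiniteDimensional.of_injective ev hinj
  obtain ⟨g, hg⟩ := ev.exists_leftInverse_of_injective (LinearMap.ker_eq_bot.2 hinj)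
  have hfg : f = fun y => LinearMap.toContinuousLinearMap g (ev (f y)) := by
    funext y
    exact (LinearMap.congr_fun hg (f y)).symm
  rw [hfg]
  refine (LinearMap.toContinuousLinearMap g).differentiableAt.comp p ?_
  exact differentiableAt_pi.2 fun s => h _

variable {n : ℕ} {M : Type*} [TopologicalSpace M] [ChartedSpace (EuclideanSpace ℝ (Fin n)) M]
  [IsManifold (𝓡 n) ∞ M]

theorem isManifold_one : IsManifold (𝓡 n) 1 M := IsManifold.of_le (n := ∞) (by simp)

theorem isManifold_two : IsManifold (𝓡 n) 2 M := 
  IsManifold.of_le (n := ∞) (WithTop.coe_le_coe.2 (le_top : (2 : ℕ∞) ≤ ⊤))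

section Fields

variable {U W : Set M} {X Y : Π x : M, TangentSpace (𝓡 n) x} {x : M}

theorem SmoothFieldOn.mono (hX : SmoothFieldOn U X) (h : W ⊆ U) : SmoothFieldOn W X :=
  ContMDiffOn.mono hX h

theorem SmoothFieldOn.contMDiffAt (hX : SmoothFieldOn U X) (hU : IsOpen U) (hx : x ∈ U) :
    ContMDiffAt (𝓡 n) (𝓡 n).tangent ∞ (fun x => (⟨x, X x⟩ : TangentBundle (𝓡 n) M)) x :=
  ContMDiffOn.contMDiffAt hX (hU.mem_nhds hx)

theorem SmoothFieldOn.congr (hX : SmoothFieldOn U X) (h : ∀ x ∈ U, Y x = X x) :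
    SmoothFieldOn U Y :=
  ContMDiffOn.congr hX fun x hx => by rw [h x hx]

theorem SmoothFieldOn.add (hX : SmoothFieldOn U X) (hY : SmoothFieldOn U Y) :
    SmoothFieldOn U (fun x => X x + Y x) :=
  have := isManifold_one (n := n) (M := M)
  ContMDiffOn.add_section hX hY

theorem SmoothFieldOn.smul {f : M → ℝ} (hf : ContMDiffOn (𝓡 n) 𝓘(ℝ, ℝ) ∞ f U)
    (hX : SmoothFieldOn U X) : SmoothFieldOn U (fun x => f x • X x) :=
  have := isManifold_one (n := n) (M := M)
  ContMDiffOn.smul_section hf hX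

theorem SmoothFieldOn.sum {ι : Type*} (s : Finset ι) {X : ι → Π x : M, TangentSpace (𝓡 n) x}
    (hX : ∀ i ∈ s, SmoothFieldOn U (X i)) : SmoothFieldOn U (fun x => ∑ i ∈ s, X i x) :=
  have := isManifold_one (n := n) (M := M)
  ContMDiffOn.sum_section hX

theorem SmoothFieldOn.mlieBracket (hU : IsOpen U) (hX : SmoothFieldOn U X)
    (hY : SmoothFieldOn U Y) : SmoothFieldOn U (mlieBracket (𝓡 n) X Y) := by
  have := isManifold_two (n := n) (M := M)
  have : IsManifold (𝓡 n) (minSmoothness ℝ 2) M := by simpa using this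
  -- The bracket costs one derivative, but `∞ + 1` reduces to `∞`.
  have : IsManifold (𝓡 n) (((⊤ : ℕ∞) : ℕ∞ω) + 1) M := by
    have h : IsManifold (𝓡 n) ∞ M := inferInstance
    exact h
  intro x hx
  exact ((hX.contMDiffAt hU hx).mlieBracket_vectorField (m := (⊤ : ℕ∞)) (n := (⊤ : ℕ∞))
    (hY.contMDiffAt hU hx) (by simp)).contMDiffWithinAt

/-- The derivative of a smooth function along a smooth vector field is smooth. -/
theorem SmoothFieldOn.mvfderiv_apply (hU : IsOpen U) (hX : SmoothFieldOn U X) {f : M → ℝ}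
    (hf : ContMDiffOn (𝓡 n) 𝓘(ℝ, ℝ) ∞ f U) :
    ContMDiffOn (𝓡 n) 𝓘(ℝ, ℝ) ∞ (fun x => mvfderiv (𝓡 n) f x (X x)) U := by
  have := isManifold_one (n := n) (M := M)
  -- The function X f is the fibre component of the tangent map of f composed with the section X.
  have h := ContMDiffOn.contMDiffOn_tangentMapWithin (m := ∞) hf (by simp) hU.uniqueMDiffOn
  have h2 := h.comp hX (fun x hx => hx)
  have h3 := (contMDiff_snd_tangentBundle_modelSpace (n := ∞) ℝ 𝓘(ℝ, ℝ)).comp_contMDiffOn h2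
  refine h3.congr fun x hx => ?_
  show mvfderiv (𝓡 n) f x (X x) = (mfderivWithin (𝓡 n) 𝓘(ℝ, ℝ) f U x) (X x)
  rw [mfderivWithin_of_isOpen hU hx]
  rfl

end Fields

end

/-! ### The exterior derivative in a chart and its invariant formula -/

section

variable {n : ℕ} {M : Type*} [TopologicalSpace M] [ChartedSpace (EuclideanSpace ℝ (Fin n)) M]
  [IsManifold (𝓡 n) ∞ M]

/-- The vector field which is constant, equal to `v`, in the preferred chart at `x`. -/
def chartField (x : M) (v : EuclideanSpace ℝ (Fin n)) : Π y : M, TangentSpace (𝓡 n) y :=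
  mpullback (𝓡 n) 𝓘(ℝ, EuclideanSpace ℝ (Fin n)) (extChartAt (𝓡 n) x) (fun _ => v)

theorem chartField_apply (x : M) (v : EuclideanSpace ℝ (Fin n)) (y : M) :
    chartField x v y = (mfderiv (𝓡 n) 𝓘(ℝ, EuclideanSpace ℝ (Fin n)) (extChartAt (𝓡 n) x) y).inverse
      v := rfl

theorem smoothFieldOn_chartField (x : M) (v : EuclideanSpace ℝ (Fin n)) :
    SmoothFieldOn (extChartAt (𝓡 n) x).source (chartField x v) := by
  have := isManifold_one (n := n) (M := M)
  intro y hy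
  have hc : ContMDiffAt (𝓡 n) 𝓘(ℝ, EuclideanSpace ℝ (Fin n)) ∞ (extChartAt (𝓡 n) x) y :=
    contMDiffAt_extChartAt' (by simpa using hy)
  have hv : ContMDiffAt 𝓘(ℝ, EuclideanSpace ℝ (Fin n)) 𝓘(ℝ, EuclideanSpace ℝ (Fin n)).tangent ∞
      (fun z => (⟨z, v⟩ : TangentBundle 𝓘(ℝ, EuclideanSpace ℝ (Fin n)) (EuclideanSpace ℝ (Fin n))))
      (extChartAt (𝓡 n) x y) :=
    contMDiffAt_vectorSpace_iff_contDiffAt.2 (contDiffAt_const (c := v))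
  exact (ContMDiffAt.mpullback_vectorField_preimage hv hc
    (isInvertible_mfderiv_extChartAt hy) (by simp)).contMDiffWithinAt

/-- The representative of a differential form in the preferred chart at `x`. -/
def formInChart {k : ℕ} (α : Π x : M, TangentSpace (𝓡 n) x [⋀^Fin k]→L[ℝ] ℝ) (x : M)
    (y : EuclideanSpace ℝ (Fin n)) : EuclideanSpace ℝ (Fin n) [⋀^Fin k]→L[ℝ] ℝ :=
  (α ((extChartAt (𝓡 n) x).symm y)).compContinuousLinearMap
    (mfderiv 𝓘(ℝ, EuclideanSpace ℝ (Fin n)) (𝓡 n) (extChartAt (𝓡 n) x).symm y :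
      EuclideanSpace ℝ (Fin n) →L[ℝ] TangentSpace (𝓡 n) ((extChartAt (𝓡 n) x).symm y))

theorem mextDeriv_apply {k : ℕ} (α : Π x : M, TangentSpace (𝓡 n) x [⋀^Fin k]→L[ℝ] ℝ) (x : M)
    (v : Fin (k + 1) → TangentSpace (𝓡 n) x) :
    mextDeriv α x v = extDeriv (formInChart α x) (extChartAt (𝓡 n) x x) (fun i =>
      mfderiv (𝓡 n) 𝓘(ℝ, EuclideanSpace ℝ (Fin n)) (extChartAt (𝓡 n) x) x (v i)) := rfl

/-- The derivatives of the chart and of its inverse cancel. The base point `symm (chart z)` equals z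
only propositionally, so the two values of α are compared after identifying tangent spaces with the
model space. -/
theorem formInChart_apply_mfderiv {k : ℕ} (α : Π x : M, TangentSpace (𝓡 n) x [⋀^Fin k]→L[ℝ] ℝ)
    (x : M) {z : M} (hz : z ∈ (extChartAt (𝓡 n) x).source) (u : Fin k → TangentSpace (𝓡 n) z) :
    formInChart α x (extChartAt (𝓡 n) x z)
      (fun i => mfderiv (𝓡 n) 𝓘(ℝ, EuclideanSpace ℝ (Fin n)) (extChartAt (𝓡 n) x) z (u i)) =
      α z u := by
  have := isManifold_one (n := n) (M := M)
  have key : ∀ z', z' = z → ∀ w w' : Fin k → EuclideanSpace ℝ (Fin n), w = w' →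
      (α z' : EuclideanSpace ℝ (Fin n) [⋀^Fin k]→L[ℝ] ℝ) w =
        (α z : EuclideanSpace ℝ (Fin n) [⋀^Fin k]→L[ℝ] ℝ) w' := by
    rintro _ rfl _ _ rfl; rfl
  refine key _ ((extChartAt (𝓡 n) x).left_inv hz) _ _ ?_
  funext i
  have h := mfderivWithin_extChartAt_symm_comp_mfderiv_extChartAt' (I := 𝓡 n) hz
  rw [ModelWithCorners.range_eq_univ, mfderivWithin_univ] at h
  exact DFunLike.congr_fun h (u i)

theorem formInChart_apply {k : ℕ} (α : Π x : M, TangentSpace (𝓡 n) x [⋀^Fin k]→L[ℝ] ℝ)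
    (x : M) {y : EuclideanSpace ℝ (Fin n)} (hy : y ∈ (extChartAt (𝓡 n) x).target)
    (v : Fin k → EuclideanSpace ℝ (Fin n)) :
    formInChart α x y v = α ((extChartAt (𝓡 n) x).symm y)
      (fun i => chartField x (v i) ((extChartAt (𝓡 n) x).symm y)) := by
  have := isManifold_one (n := n) (M := M)
  have hz := (extChartAt (𝓡 n) x).map_target hy
  rw [← formInChart_apply_mfderiv α x hz, (extChartAt (𝓡 n) x).right_inv hy]
  congr 1
  funext i
  obtain ⟨e, he⟩ := isInvertible_mfderiv_extChartAt (I := 𝓡 n) hz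
  rw [chartField_apply, ← he, ContinuousLinearMap.inverse_equiv]
  exact (e.apply_symm_apply _).symm

theorem eventually_mem_extChartAt_target (x : M) :
    ∀ᶠ y in 𝓝 (extChartAt (𝓡 n) x x), y ∈ (extChartAt (𝓡 n) x).target :=
  extChartAt_target_mem_nhds x

theorem differentiableAt_comp_extChartAt_symm {f : M → ℝ} {x : M}
    (hf : MDifferentiableAt (𝓡 n) 𝓘(ℝ, ℝ) f x) :
    DifferentiableAt ℝ (fun y => f ((extChartAt (𝓡 n) x).symm y)) (extChartAt (𝓡 n) x x) := by
  have h := (mdifferentiableWithinAt_univ.2 hf).differentiableWithinAt_comp_extChartAt_symm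
  rw [ModelWithCorners.range_eq_univ, preimage_univ, univ_inter, differentiableWithinAt_univ] at h
  exact h

theorem fderiv_comp_extChartAt_symm {f : M → ℝ} {x : M}
    (hf : MDifferentiableAt (𝓡 n) 𝓘(ℝ, ℝ) f x) (v : TangentSpace (𝓡 n) x) :
    fderiv ℝ (fun y => f ((extChartAt (𝓡 n) x).symm y)) (extChartAt (𝓡 n) x x)
      (mfderiv (𝓡 n) 𝓘(ℝ, EuclideanSpace ℝ (Fin n)) (extChartAt (𝓡 n) x) x v) =
      mvfderiv (𝓡 n) f x v := by
  have := isManifold_one (n := n) (M := M)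
  have h1 := (differentiableAt_comp_extChartAt_symm hf).mdifferentiableAt
  have h2 : MDifferentiableAt (𝓡 n) 𝓘(ℝ, EuclideanSpace ℝ (Fin n)) (extChartAt (𝓡 n) x) x :=
    mdifferentiableAt_extChartAt (mem_chart_source _ x)
  have h3 := mfderiv_comp x h1 h2
  have h4 : (fun y => f ((extChartAt (𝓡 n) x).symm y)) ∘ (extChartAt (𝓡 n) x) =ᶠ[𝓝 x] f := by
    filter_upwards [extChartAt_source_mem_nhds (I := 𝓡 n) x] with y hy
    exact congrArg f ((extChartAt (𝓡 n) x).left_inv hy)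
  rw [h4.mfderiv_eq, mfderiv_eq_fderiv] at h3
  exact (DFunLike.congr_fun h3 v).symm

theorem SmoothFormOn.mono {k : ℕ} {U W : Set M}
    {α : Π x : M, TangentSpace (𝓡 n) x [⋀^Fin k]→L[ℝ] ℝ} (hα : SmoothFormOn U α) (h : W ⊆ U) :
    SmoothFormOn W α :=
  fun W' hW' => hα W' (hW'.trans h)

theorem SmoothFormOn.differentiableAt_formInChart {k : ℕ} {U : Set M} (hU : IsOpen U)
    {α : Π x : M, TangentSpace (𝓡 n) x [⋀^Fin k]→L[ℝ] ℝ} (hα : SmoothFormOn U α) {x : M}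
    (hx : x ∈ U) : DifferentiableAt ℝ (formInChart α x) (extChartAt (𝓡 n) x x) := by
  -- A constant vector in the chart represents a `chartField`, and `SmoothFormOn` can be tested on
  -- these fields.
  refine differentiableAt_of_forall_apply fun v => ?_
  have hW : IsOpen (U ∩ (extChartAt (𝓡 n) x).source) := hU.inter (isOpen_extChartAt_source x)
  have hf := hα (U ∩ (extChartAt (𝓡 n) x).source) inter_subset_left hW
    (fun i => chartField x (v i)) fun i => (smoothFieldOn_chartField x (v i)).mono inter_subset_right
  have hf' := (hf.contMDiffAt (hW.mem_nhds ⟨hx, mem_extChartAt_source x⟩)).mdifferentiableAt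
    (by simp)
  refine (differentiableAt_comp_extChartAt_symm hf').congr_of_eventuallyEq ?_
  filter_upwards [eventually_mem_extChartAt_target (n := n) x] with y hy
  exact formInChart_apply α x hy v

/-- A vector field read in the preferred chart at `x`. -/
def fieldInChart (X : Π x : M, TangentSpace (𝓡 n) x) (x : M) :
    EuclideanSpace ℝ (Fin n) → EuclideanSpace ℝ (Fin n) :=
  mpullbackWithin 𝓘(ℝ, EuclideanSpace ℝ (Fin n)) (𝓡 n) (extChartAt (𝓡 n) x).symm X (range (𝓡 n))

theorem fieldInChart_apply (X : Π x : M, TangentSpace (𝓡 n) x) (x : M) {z : M}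
    (hz : z ∈ (extChartAt (𝓡 n) x).source) :
    fieldInChart X x (extChartAt (𝓡 n) x z) =
      mfderiv (𝓡 n) 𝓘(ℝ, EuclideanSpace ℝ (Fin n)) (extChartAt (𝓡 n) x) z (X z) := by
  have := isManifold_one (n := n) (M := M)
  have key : ∀ z', z' = z → (X z' : EuclideanSpace ℝ (Fin n)) = X z := by rintro _ rfl; rfl
  have h := mfderivWithin_extChartAt_symm_comp_mfderiv_extChartAt' (I := 𝓡 n) hz
  obtain ⟨e, he⟩ := isInvertible_mfderivWithin_extChartAt_symm (I := 𝓡 n)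
    ((extChartAt (𝓡 n) x).map_source hz)
  rw [fieldInChart, mpullbackWithin_apply, ← he, ContinuousLinearMap.inverse_equiv]
  refine e.injective ((e.apply_symm_apply _).trans ?_)
  rw [← he] at h
  exact (key _ ((extChartAt (𝓡 n) x).left_inv hz)).trans (DFunLike.congr_fun h (X z)).symm

/-- The manifold bracket is by construction the flat bracket of the chart representatives pulled
back to M; the derivative of the chart undoes the pull-back. -/
theorem mfderiv_extChartAt_mlieBracket (X Y : Π x : M, TangentSpace (𝓡 n) x) (x : M) :
    mfderiv (𝓡 n) 𝓘(ℝ, EuclideanSpace ℝ (Fin n)) (extChartAt (𝓡 n) x) x (mlieBracket (𝓡 n) X Y x) =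
      lieBracket ℝ (fieldInChart X x) (fieldInChart Y x) (extChartAt (𝓡 n) x x) := by
  have := isManifold_one (n := n) (M := M)
  have hr : (extChartAt (𝓡 n) x).symm ⁻¹' univ ∩ range (𝓡 n) = univ := by
    rw [preimage_univ, univ_inter, ModelWithCorners.range_eq_univ]
  rw [← lieBracketWithin_univ, ← hr, ← mlieBracketWithin_univ, mlieBracketWithin_apply]
  obtain ⟨e, he⟩ := isInvertible_mfderiv_extChartAt (I := 𝓡 n) (mem_extChartAt_source (I := 𝓡 n) x)
  rw [← he, ContinuousLinearMap.inverse_equiv]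
  exact e.apply_symm_apply _

theorem SmoothFieldOn.differentiableAt_fieldInChart {U : Set M} (hU : IsOpen U)
    {X : Π x : M, TangentSpace (𝓡 n) x} (hX : SmoothFieldOn U X) {x : M} (hx : x ∈ U) :
    DifferentiableAt ℝ (fieldInChart X x) (extChartAt (𝓡 n) x x) := by
  have := isManifold_two (n := n) (M := M)
  have h := (mdifferentiableWithinAt_univ.2 ((hX.contMDiffAt hU hx).mdifferentiableAt
    (by simp))).differentiableWithinAt_mpullbackWithin_vectorField
  rw [preimage_univ, univ_inter] at h
  exact h.differentiableAt (by simp)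

/-- The invariant formula for the exterior derivative in terms of Lie brackets. -/
theorem mextDeriv_apply_vectorField {k : ℕ} {U : Set M} (hU : IsOpen U)
    {α : Π x : M, TangentSpace (𝓡 n) x [⋀^Fin (k + 1)]→L[ℝ] ℝ} (hα : SmoothFormOn U α)
    {V : Fin (k + 2) → Π x : M, TangentSpace (𝓡 n) x} (hV : ∀ i, SmoothFieldOn U (V i)) {x : M}
    (hx : x ∈ U) :
    mextDeriv α x (V · x) =
      (∑ i : Fin (k + 2), (-1) ^ i.val •
        mvfderiv (𝓡 n) (fun y ↦ α y (i.removeNth (V · y))) x (V i x)) -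
        ∑ i : Fin (k + 1), ∑ j ≥ i, (-1) ^ (i + j : ℕ) •
          α x (Matrix.vecCons (mlieBracket (𝓡 n) (V i.castSucc) (V j.succ) x)
              (j.removeNth <| i.castSucc.removeNth (V · x))) := by
  have hxs := mem_extChartAt_source (I := 𝓡 n) x
  -- This is the flat formula for the chart representatives; what remains is to carry each of its
  -- terms back to M.
  have h := extDeriv_apply_vectorField (hα.differentiableAt_formInChart hU hx)
    (V := fun i => fieldInChart (V i) x) fun i => (hV i).differentiableAt_fieldInChart hU hx
  rw [mextDeriv_apply]
  simp only [← fun i => fieldInChart_apply (V i) x hxs]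
  rw [h]
  congr 1
  · refine Finset.sum_congr rfl fun i _ => ?_
    congr 1
    have hf := hα U subset_rfl hU (fun j => V (i.succAbove j)) fun j => hV _
    have hf' := (hf.contMDiffAt (hU.mem_nhds hx)).mdifferentiableAt (by simp)
    rw [fieldInChart_apply (V i) x hxs]
    refine Eq.trans ?_ (fderiv_comp_extChartAt_symm hf' (V i x))
    congr 1
    refine Filter.EventuallyEq.fderiv_eq ?_
    filter_upwards [eventually_mem_extChartAt_target (n := n) x] with y hy
    obtain ⟨z, hz, rfl⟩ : ∃ z ∈ (extChartAt (𝓡 n) x).source, extChartAt (𝓡 n) x z = y :=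
      ⟨_, (extChartAt (𝓡 n) x).map_target hy, (extChartAt (𝓡 n) x).right_inv hy⟩
    refine Eq.trans ?_ (congrArg (fun z => α z fun j => V (i.succAbove j) z)
      ((extChartAt (𝓡 n) x).left_inv hz).symm)
    refine Eq.trans ?_ (formInChart_apply_mfderiv α x hz _)
    congr 1
    funext j
    exact fieldInChart_apply _ x hz
  · refine Finset.sum_congr rfl fun i _ => Finset.sum_congr rfl fun j _ => ?_
    congr 1
    rw [← formInChart_apply_mfderiv α x hxs]
    congr 1
    funext l
    refine Fin.cases ?_ (fun l => ?_) l
    · exact (mfderiv_extChartAt_mlieBracket _ _ x).symm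
    · exact fieldInChart_apply _ x hxs

end

/-! ### Exterior derivatives of one- and two-forms, locality, smoothness -/

section

variable {n : ℕ} {M : Type*} [TopologicalSpace M] [ChartedSpace (EuclideanSpace ℝ (Fin n)) M]
  [IsManifold (𝓡 n) ∞ M]

theorem mextDeriv_oneForm {U : Set M} (hU : IsOpen U)
    {α : Π x : M, TangentSpace (𝓡 n) x [⋀^Fin 1]→L[ℝ] ℝ} (hα : SmoothFormOn U α)
    {X Y : Π x : M, TangentSpace (𝓡 n) x} (hX : SmoothFieldOn U X) (hY : SmoothFieldOn U Y) {x : M}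
    (hx : x ∈ U) :
    mextDeriv α x ![X x, Y x] = mvfderiv (𝓡 n) (fun y => α y ![Y y]) x (X x) -
      mvfderiv (𝓡 n) (fun y => α y ![X y]) x (Y x) - α x ![mlieBracket (𝓡 n) X Y x] := by
  have h := mextDeriv_apply_vectorField hU hα (V := ![X, Y])
    (by intro i; fin_cases i; exacts [hX, hY]) hx
  have e0 : (fun i => (![X, Y] : Fin 2 → Π x : M, TangentSpace (𝓡 n) x) i x) = ![X x, Y x] := by
    funext i; fin_cases i <;> rfl
  have e1 : ∀ y, (0 : Fin 2).removeNth (fun i => (![X, Y] : Fin 2 → Π x : M, TangentSpace (𝓡 n) x) i y)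
      = ![Y y] := by
    intro y; funext i; fin_cases i; rfl
  have e2 : ∀ y, (1 : Fin 2).removeNth (fun i => (![X, Y] : Fin 2 → Π x : M, TangentSpace (𝓡 n) x) i y)
      = ![X y] := by
    intro y; funext i; fin_cases i; rfl
  have e3 : ∀ f : Fin 1 → ℝ, ∑ j ≥ (0 : Fin 1), f j = f 0 := by
    intro f; rw [show Finset.Ici (0 : Fin 1) = {0} from rfl, Finset.sum_singleton]
  rw [← e0, h, Fin.sum_univ_two, Fin.sum_univ_one, e3]
  simp only [e1, e2]
  have e4 : ∀ (a : TangentSpace (𝓡 n) x) (b : Fin 0 → TangentSpace (𝓡 n) x),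
      Matrix.vecCons a b = ![a] := by
    intro a b; funext i; fin_cases i; rfl
  rw [e4]
  change ((-1 : ℤ) ^ 0 • mvfderiv (𝓡 n) (fun y => α y ![Y y]) x (X x) +
    (-1 : ℤ) ^ 1 • mvfderiv (𝓡 n) (fun y => α y ![X y]) x (Y x)) -
    (-1 : ℤ) ^ (0 + 0) • α x ![mlieBracket (𝓡 n) X Y x] = _
  simp only [pow_zero, pow_one, one_smul, neg_smul, add_zero, sub_eq_add_neg]

theorem mextDeriv_twoForm {U : Set M} (hU : IsOpen U)
    {α : Π x : M, TangentSpace (𝓡 n) x [⋀^Fin 2]→L[ℝ] ℝ} (hα : SmoothFormOn U α)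
    {X Y Z : Π x : M, TangentSpace (𝓡 n) x} (hX : SmoothFieldOn U X) (hY : SmoothFieldOn U Y)
    (hZ : SmoothFieldOn U Z) {x : M} (hx : x ∈ U) :
    mextDeriv α x ![X x, Y x, Z x] = mvfderiv (𝓡 n) (fun y => α y ![Y y, Z y]) x (X x) -
      mvfderiv (𝓡 n) (fun y => α y ![X y, Z y]) x (Y x) +
      mvfderiv (𝓡 n) (fun y => α y ![X y, Y y]) x (Z x)
      - α x ![mlieBracket (𝓡 n) X Y x, Z x] + α x ![mlieBracket (𝓡 n) X Z x, Y x]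
      - α x ![mlieBracket (𝓡 n) Y Z x, X x] := by
  have h := mextDeriv_apply_vectorField hU hα (V := ![X, Y, Z])
    (by intro i; fin_cases i; exacts [hX, hY, hZ]) hx
  have e0 : (fun i => (![X, Y, Z] : Fin 3 → Π x : M, TangentSpace (𝓡 n) x) i x) =
      ![X x, Y x, Z x] := by
    funext i; fin_cases i <;> rfl
  have e1 : ∀ y, (0 : Fin 3).removeNth
      (fun i => (![X, Y, Z] : Fin 3 → Π x : M, TangentSpace (𝓡 n) x) i y) = ![Y y, Z y] := by
    intro y; funext i; fin_cases i <;> rfl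
  have e2 : ∀ y, (1 : Fin 3).removeNth
      (fun i => (![X, Y, Z] : Fin 3 → Π x : M, TangentSpace (𝓡 n) x) i y) = ![X y, Z y] := by
    intro y; funext i; fin_cases i <;> rfl
  have e2' : ∀ y, (2 : Fin 3).removeNth
      (fun i => (![X, Y, Z] : Fin 3 → Π x : M, TangentSpace (𝓡 n) x) i y) = ![X y, Y y] := by
    intro y; funext i; fin_cases i <;> rfl
  have e3 : ∀ f : Fin 2 → ℝ, ∑ j ≥ (0 : Fin 2), f j = f 0 + f 1 := by
    intro f; rw [show Finset.Ici (0 : Fin 2) = Finset.univ from rfl, Fin.sum_univ_two]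
  have e3' : ∀ f : Fin 2 → ℝ, ∑ j ≥ (1 : Fin 2), f j = f 1 := by
    intro f; rw [show Finset.Ici (1 : Fin 2) = {1} from rfl, Finset.sum_singleton]
  have e4 : ∀ (a : TangentSpace (𝓡 n) x), Matrix.vecCons a ((0 : Fin 2).removeNth
      ((0 : Fin 2).castSucc.removeNth
        (fun i => (![X, Y, Z] : Fin 3 → Π x : M, TangentSpace (𝓡 n) x) i x))) = ![a, Z x] := by
    intro a; funext i; fin_cases i <;> rfl
  have e5 : ∀ (a : TangentSpace (𝓡 n) x), Matrix.vecCons a ((1 : Fin 2).removeNth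
      ((0 : Fin 2).castSucc.removeNth
        (fun i => (![X, Y, Z] : Fin 3 → Π x : M, TangentSpace (𝓡 n) x) i x))) = ![a, Y x] := by
    intro a; funext i; fin_cases i <;> rfl
  have e6 : ∀ (a : TangentSpace (𝓡 n) x), Matrix.vecCons a ((1 : Fin 2).removeNth
      ((1 : Fin 2).castSucc.removeNth
        (fun i => (![X, Y, Z] : Fin 3 → Π x : M, TangentSpace (𝓡 n) x) i x))) = ![a, X x] := by
    intro a; funext i; fin_cases i <;> rfl
  rw [← e0, h, Fin.sum_univ_three, Fin.sum_univ_two, e3, e3', e4, e5, e6]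
  simp only [e1, e2, e2']
  change ((-1 : ℤ) ^ 0 • mvfderiv (𝓡 n) (fun y => α y ![Y y, Z y]) x (X x) +
    (-1 : ℤ) ^ 1 • mvfderiv (𝓡 n) (fun y => α y ![X y, Z y]) x (Y x) +
    (-1 : ℤ) ^ 2 • mvfderiv (𝓡 n) (fun y => α y ![X y, Y y]) x (Z x)) -
    ((-1 : ℤ) ^ (0 + 0) • α x ![mlieBracket (𝓡 n) X Y x, Z x] +
     (-1 : ℤ) ^ (0 + 1) • α x ![mlieBracket (𝓡 n) X Z x, Y x] +
     (-1 : ℤ) ^ (1 + 1) • α x ![mlieBracket (𝓡 n) Y Z x, X x]) = _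
  have h2 : (-1 : ℤ) ^ 2 = 1 := rfl
  simp only [pow_zero, pow_one, one_smul, neg_smul, add_zero, zero_add, one_add_one_eq_two, h2]
  ring

/-- Only the germ of the chart representative enters. This is what transfers condition (ii) between
one-forms θ that agree on an open set. -/
theorem mextDeriv_congr {k : ℕ} {α β : Π x : M, TangentSpace (𝓡 n) x [⋀^Fin k]→L[ℝ] ℝ} {x : M}
    (h : ∀ᶠ y in 𝓝 x, α y = β y) : mextDeriv α x = mextDeriv β x := by
  ext v
  rw [mextDeriv_apply, mextDeriv_apply]
  congr 1
  refine Filter.EventuallyEq.extDeriv_eq ?_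
  have hc := continuousAt_extChartAt_symm (I := 𝓡 n) x
  rw [ContinuousAt, extChartAt_to_inv] at hc
  filter_upwards [hc.eventually h] with y hy
  rw [formInChart, formInChart, hy]

theorem mextDeriv_const_smul {k : ℕ} (c : ℝ) (α : Π x : M, TangentSpace (𝓡 n) x [⋀^Fin k]→L[ℝ] ℝ)
    (x : M) (v : Fin (k + 1) → TangentSpace (𝓡 n) x) :
    mextDeriv (fun y => c • α y) x v = c * mextDeriv α x v := by
  rw [mextDeriv_apply, mextDeriv_apply]
  have : formInChart (fun y => c • α y) x = c • formInChart α x := rfl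
  rw [this, extDeriv_smul]
  rfl

theorem SmoothFormOn.contMDiffOn_vecCons {k : ℕ} {U : Set M} (hU : IsOpen U)
    {α : Π x : M, TangentSpace (𝓡 n) x [⋀^Fin (k + 1)]→L[ℝ] ℝ} (hα : SmoothFormOn U α)
    {Z : Π x : M, TangentSpace (𝓡 n) x} {V : Fin k → Π x : M, TangentSpace (𝓡 n) x}
    (hZ : SmoothFieldOn U Z) (hV : ∀ i, SmoothFieldOn U (V i)) :
    ContMDiffOn (𝓡 n) 𝓘(ℝ, ℝ) ∞ (fun x => α x (Matrix.vecCons (Z x) (fun i => V i x))) U := by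
  refine (hα U subset_rfl hU (Matrix.vecCons Z V) ?_).congr ?_
  · intro i
    refine Fin.cases hZ (fun i => hV i) i
  · intro x _
    congr 1
    funext i
    refine Fin.cases rfl (fun i => rfl) i

theorem contMDiffOn_zsmul (m : ℤ) {U : Set M} {f : M → ℝ}
    (hf : ContMDiffOn (𝓡 n) 𝓘(ℝ, ℝ) ∞ f U) :
    ContMDiffOn (𝓡 n) 𝓘(ℝ, ℝ) ∞ (fun x => m • f x) U := by
  simp only [zsmul_eq_mul]
  exact contMDiffOn_const.mul hf

/-- The exterior derivative of a smooth form of positive degree is smooth. -/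
theorem SmoothFormOn.mextDeriv {k : ℕ} {U : Set M}
    {α : Π x : M, TangentSpace (𝓡 n) x [⋀^Fin (k + 1)]→L[ℝ] ℝ} (hα : SmoothFormOn U α) :
    SmoothFormOn U (mextDeriv α) := by
  intro W hWU hW V hV
  have hα' := hα.mono hWU
  refine ContMDiffOn.congr (f := fun x => (∑ i : Fin (k + 2), (-1) ^ i.val •
        mvfderiv (𝓡 n) (fun y ↦ α y (i.removeNth (V · y))) x (V i x)) -
        ∑ i : Fin (k + 1), ∑ j ≥ i, (-1) ^ (i + j : ℕ) •
          α x (Matrix.vecCons (mlieBracket (𝓡 n) (V i.castSucc) (V j.succ) x)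
              (j.removeNth <| i.castSucc.removeNth (V · x)))) ?_
    fun x hx => mextDeriv_apply_vectorField hW hα' hV hx
  refine ContMDiffOn.sub ?_ ?_
  · refine contMDiffOn_finsetSum fun i _ => ?_
    refine contMDiffOn_zsmul _ ?_
    exact (hV i).mvfderiv_apply hW (hα' W subset_rfl hW (fun j => V (i.succAbove j)) fun j => hV _)
  · refine contMDiffOn_finsetSum fun i _ => contMDiffOn_finsetSum fun j _ => ?_
    refine contMDiffOn_zsmul _ ?_
    exact hα'.contMDiffOn_vecCons hW (SmoothFieldOn.mlieBracket hW (hV _) (hV _))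
      (V := fun l => V (i.castSucc.succAbove (j.succAbove l))) fun l => hV _

/-- On fields in the kernel of a one-form, the bracket is tensorial modulo that kernel. -/
theorem SmoothFormOn.apply_mlieBracket {U : Set M} (hU : IsOpen U)
    {α : Π x : M, TangentSpace (𝓡 n) x [⋀^Fin 1]→L[ℝ] ℝ} (hα : SmoothFormOn U α)
    {X Y : Π x : M, TangentSpace (𝓡 n) x} (hX : SmoothFieldOn U X) (hY : SmoothFieldOn U Y) {x : M}
    (hx : x ∈ U) (hX0 : ∀ y ∈ U, α y ![X y] = 0) (hY0 : ∀ y ∈ U, α y ![Y y] = 0) :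
    α x ![mlieBracket (𝓡 n) X Y x] = - SubRiem.mextDeriv α x ![X x, Y x] := by
  rw [mextDeriv_oneForm hU hα hX hY hx]
  have h0 : ∀ Z : Π x : M, TangentSpace (𝓡 n) x, (∀ y ∈ U, α y ![Z y] = 0) →
      mvfderiv (𝓡 n) (fun y => α y ![Z y]) x = 0 := by
    intro Z hZ
    have : (fun y => α y ![Z y]) =ᶠ[𝓝 x] fun _ => (0 : ℝ) := by
      filter_upwards [hU.mem_nhds hx] with y hy using hZ y hy
    rw [mvfderiv, this.mfderiv_eq, mfderiv_const]
    rfl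
  rw [h0 X hX0, h0 Y hY0]
  simp

/-! ### Smooth local frames -/

section Frames

open Bundle Module

variable {ι : Type*} [Fintype ι] {W : Set M} {X : ι → Π x : M, TangentSpace (𝓡 n) x}

/-- The coefficients of a smooth vector field in a smooth local frame are smooth. -/
theorem contMDiffOn_coeff (hs : IsLocalFrameOn (𝓡 n) (EuclideanSpace ℝ (Fin n)) ∞ X W)
    (hW : IsOpen W) {W' : Set M} (hW' : IsOpen W') (hWW : W' ⊆ W)
    {Y : Π x : M, TangentSpace (𝓡 n) x} (hY : SmoothFieldOn W' Y) (i : ι) :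
    ContMDiffOn (𝓡 n) 𝓘(ℝ, ℝ) ∞ (fun x => hs.coeff i x (Y x)) W' := by
  have := isManifold_one (n := n) (M := M)
  intro x hx
  refine ContMDiffAt.contMDiffWithinAt ?_
  let e := trivializationAt (EuclideanSpace ℝ (Fin n)) (TangentSpace (𝓡 n) : M → Type _) x
  have hxe : x ∈ e.baseSet := mem_baseSet_trivializationAt _ _ x
  -- `G` turns a tuple of vectors into the linear map with these columns. In a trivialization the
  -- coefficients of a field are the inverse of this map applied to the field, and inversion is
  -- smooth near an invertible map.
  let G : (ι → EuclideanSpace ℝ (Fin n)) → ((ι → ℝ) →L[ℝ] EuclideanSpace ℝ (Fin n)) := fun s =>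
    ∑ i, (ContinuousLinearMap.proj (R := ℝ) (φ := fun _ : ι => ℝ) i).smulRight (s i)
  have hG : ContDiff ℝ ∞ G := by
    refine ContDiff.sum fun i _ => ?_
    exact ContDiff.smulRight contDiff_const (contDiff_apply _ _ i)
  let s' : M → ι → EuclideanSpace ℝ (Fin n) := fun y i => (e ⟨y, X i y⟩).2
  let t' : M → EuclideanSpace ℝ (Fin n) := fun y => (e ⟨y, Y y⟩).2
  have hs' : ContMDiffAt (𝓡 n) 𝓘(ℝ, ι → EuclideanSpace ℝ (Fin n)) ∞ s' x :=
    contMDiffAt_pi_space.2 fun i =>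
      (e.contMDiffAt_section_iff hxe).1 (hs.contMDiffAt hW (hWW hx) i)
  have ht' : ContMDiffAt (𝓡 n) 𝓘(ℝ, EuclideanSpace ℝ (Fin n)) ∞ t' x :=
    (e.contMDiffAt_section_iff hxe).1 (hY.contMDiffAt hW' hx)
  have key : ∀ y (hy : y ∈ W) (hye : y ∈ e.baseSet),
      ∃ L : (ι → ℝ) ≃L[ℝ] EuclideanSpace ℝ (Fin n), G (s' y) = L ∧
        ∀ v : TangentSpace (𝓡 n) y, L.symm (e ⟨y, v⟩).2 = fun i => hs.coeff i y v := by
    intro y hy hye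
    let b := (hs.toBasisAt hy).map (e.linearEquivAt ℝ y hye)
    refine ⟨b.equivFun.symm.toContinuousLinearEquiv, ?_, fun v => ?_⟩
    · ext c
      simp [G, b, s', Basis.equivFun_symm_apply]
    · funext i
      show b.equivFun (e ⟨y, v⟩).2 i = _
      have : (e ⟨y, v⟩).2 = e.linearEquivAt ℝ y hye v := by simp
      rw [this, Basis.equivFun_apply, Basis.map_repr, LinearEquiv.trans_apply,
        LinearEquiv.symm_apply_apply]
      simp [IsLocalFrameOn.coeff, hy]
  obtain ⟨L, hL, -⟩ := key x (hWW hx) hxe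
  have hinv : ContDiffAt ℝ ∞ (ContinuousLinearMap.inverse :
      ((ι → ℝ) →L[ℝ] EuclideanSpace ℝ (Fin n)) → _) (G (s' x)) := by
    rw [hL]; exact contDiffAt_map_inverse L
  have h1 : ContMDiffAt (𝓡 n) 𝓘(ℝ, EuclideanSpace ℝ (Fin n) →L[ℝ] (ι → ℝ)) ∞
      (fun y => (G (s' y)).inverse) x :=
    (hinv.comp (s' x) hG.contDiffAt).contMDiffAt.comp x hs'
  have h2 := h1.clm_apply ht'
  refine (contMDiffAt_pi_space.1 h2 i).congr_of_eventuallyEq ?_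
  filter_upwards [hW.mem_nhds (hWW hx), e.open_baseSet.mem_nhds hxe] with y hy hye
  obtain ⟨L, hL, hL'⟩ := key y hy hye
  rw [hL, ContinuousLinearMap.inverse_equiv]
  exact (congrFun (hL' (Y y)) i).symm

/-- Smooth vector fields which are linearly independent at a point are so nearby. -/
theorem eventually_linearIndependent {U : Set M} (hU : IsOpen U) (hX : ∀ i, SmoothFieldOn U (X i))
    {x : M} (hx : x ∈ U) (hli : LinearIndependent ℝ (fun i => X i x)) :
    ∀ᶠ y in 𝓝 x, LinearIndependent ℝ (fun i => X i y) := by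
  have := isManifold_one (n := n) (M := M)
  let e := trivializationAt (EuclideanSpace ℝ (Fin n)) (TangentSpace (𝓡 n) : M → Type _) x
  have hxe : x ∈ e.baseSet := mem_baseSet_trivializationAt _ _ x
  let s' : M → ι → EuclideanSpace ℝ (Fin n) := fun y i => (e ⟨y, X i y⟩).2
  have hs' : ContinuousAt s' x := continuousAt_pi.2 fun i =>
      ((e.contMDiffAt_section_iff hxe).1 ((hX i).contMDiffAt hU hx)).continuousAt
  have hiff : ∀ y (hye : y ∈ e.baseSet),
      LinearIndependent ℝ (fun i => X i y) ↔ LinearIndependent ℝ (s' y) := by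
    intro y hye
    rw [← LinearMap.linearIndependent_iff (e.linearEquivAt ℝ y hye).toLinearMap
      (LinearEquiv.ker _)]
    have : s' y = (e.linearEquivAt ℝ y hye).toLinearMap ∘ fun i => X i y := by
      funext i; simp [s']
    rw [this]
  filter_upwards [hs'.eventually ((hiff x hxe).1 hli).eventually, e.open_baseSet.mem_nhds hxe]
    with y hy hye
  exact (hiff y hye).2 hy

instance finiteDimensional_tangentSpace (x : M) : FiniteDimensional ℝ (TangentSpace (𝓡 n) x) :=
  inferInstanceAs (FiniteDimensional ℝ (EuclideanSpace ℝ (Fin n)))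

instance t2Space_tangentSpace (x : M) : T2Space (TangentSpace (𝓡 n) x) :=
  inferInstanceAs (T2Space (EuclideanSpace ℝ (Fin n)))

theorem finrank_tangentSpace (x : M) : finrank ℝ (TangentSpace (𝓡 n) x) = n :=
  (finrank_euclideanSpace_fin (𝕜 := ℝ) (n := n))

theorem isLocalFrameOn_of_linearIndependent (hcard : Fintype.card ι = n)
    (hX : ∀ i, SmoothFieldOn W (X i)) (hli : ∀ x ∈ W, LinearIndependent ℝ (fun i => X i x)) :
    IsLocalFrameOn (𝓡 n) (EuclideanSpace ℝ (Fin n)) ∞ X W where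
  linearIndependent := fun hx => hli _ hx
  generating := fun {x} hx =>
    ((hli x hx).span_eq_top_of_card_eq_finrank' (by rw [finrank_tangentSpace, hcard])).ge
  contMDiffOn := hX

end Frames

/-- The one-form given by a family of linear functionals. -/
def oneForm (l : Π x : M, TangentSpace (𝓡 n) x →ₗ[ℝ] ℝ) (x : M) :
    TangentSpace (𝓡 n) x [⋀^Fin 1]→L[ℝ] ℝ :=
  ContinuousAlternatingMap.ofSubsingleton ℝ (TangentSpace (𝓡 n) x) ℝ (0 : Fin 1)
    (LinearMap.toContinuousLinearMap (l x))

theorem oneForm_apply (l : Π x : M, TangentSpace (𝓡 n) x →ₗ[ℝ] ℝ) (x : M)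
    (v : TangentSpace (𝓡 n) x) : oneForm l x ![v] = l x v := rfl

theorem smoothFormOn_oneForm {U : Set M} {l : Π x : M, TangentSpace (𝓡 n) x →ₗ[ℝ] ℝ}
    (h : ∀ W ⊆ U, IsOpen W → ∀ X : Π x : M, TangentSpace (𝓡 n) x, SmoothFieldOn W X →
      ContMDiffOn (𝓡 n) 𝓘(ℝ, ℝ) ∞ (fun x => l x (X x)) W) : SmoothFormOn U (oneForm l) :=
  fun W hWU hW X hX => h W hWU hW (X 0) (hX 0)

end

/-! ### Alternating forms at a point; brackets modulo a span -/

section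

section AlternatingForms

variable {T : Type*} [AddCommGroup T] [Module ℝ T] [TopologicalSpace T]

theorem twoForm_self (w : T [⋀^Fin 2]→L[ℝ] ℝ) (u : T) : w ![u, u] = 0 :=
  w.map_eq_zero_of_eq _ (i := 0) (j := 1) rfl (by decide)

/-- A two-form as a bilinear map. -/
def bilin (w : T [⋀^Fin 2]→L[ℝ] ℝ) : T →ₗ[ℝ] T →ₗ[ℝ] ℝ :=
  LinearMap.mk₂ ℝ (fun u v => w ![u, v])
    (fun u u' v => by
      exact congrArg (fun m => m ![v]) (w.toAlternatingMap.curryLeft.map_add u u'))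
    (fun c u v => by
      exact congrArg (fun m => m ![v]) (w.toAlternatingMap.curryLeft.map_smul c u))
    (fun u v v' => by
      exact congrArg (fun m => m ![])
        ((w.toAlternatingMap.curryLeft u).curryLeft.map_add v v'))
    (fun c u v => by
      exact congrArg (fun m => m ![])
        ((w.toAlternatingMap.curryLeft u).curryLeft.map_smul c v))

theorem bilin_apply (w : T [⋀^Fin 2]→L[ℝ] ℝ) (u v : T) : bilin w u v = w ![u, v] := rfl

theorem bilin_self (w : T [⋀^Fin 2]→L[ℝ] ℝ) (u : T) : bilin w u u = 0 := twoForm_self w u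

theorem bilin_swap (w : T [⋀^Fin 2]→L[ℝ] ℝ) (u v : T) : bilin w u v = - bilin w v u := by
  have h := bilin_self w (u + v)
  simp only [map_add, LinearMap.add_apply, bilin_self] at h
  linarith

/-- The contraction of a three-form with a vector, as a bilinear map. -/
def trilin (w : T [⋀^Fin 3]→L[ℝ] ℝ) (u : T) : T →ₗ[ℝ] T →ₗ[ℝ] ℝ :=
  LinearMap.mk₂ ℝ (fun v v' => w ![u, v, v'])
    (fun v₁ v₂ v' => by
      exact congrArg (fun m => m ![v'])
        ((w.toAlternatingMap.curryLeft u).curryLeft.map_add v₁ v₂))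
    (fun c v v' => by
      exact congrArg (fun m => m ![v'])
        ((w.toAlternatingMap.curryLeft u).curryLeft.map_smul c v))
    (fun v v₁ v₂ => by
      exact congrArg (fun m => m ![])
        (((w.toAlternatingMap.curryLeft u).curryLeft v).curryLeft.map_add v₁ v₂))
    (fun c v v' => by
      exact congrArg (fun m => m ![])
        (((w.toAlternatingMap.curryLeft u).curryLeft v).curryLeft.map_smul c v'))

theorem trilin_apply (w : T [⋀^Fin 3]→L[ℝ] ℝ) (u v v' : T) : trilin w u v v' = w ![u, v, v'] := rfl

theorem trilin_add (w : T [⋀^Fin 3]→L[ℝ] ℝ) (u u' v v' : T) :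
    trilin w (u + u') v v' = trilin w u v v' + trilin w u' v v' := by
  exact congrArg (fun m => m ![v, v']) (w.toAlternatingMap.curryLeft.map_add u u')

theorem trilin_smul (w : T [⋀^Fin 3]→L[ℝ] ℝ) (c : ℝ) (u v v' : T) :
    trilin w (c • u) v v' = c * trilin w u v v' := by
  exact congrArg (fun m => m ![v, v']) (w.toAlternatingMap.curryLeft.map_smul c u)

theorem trilin_self (w : T [⋀^Fin 3]→L[ℝ] ℝ) (u v : T) : trilin w u v v = 0 :=
  w.map_eq_zero_of_eq _ (i := 1) (j := 2) rfl (by decide)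

theorem trilin_swap (w : T [⋀^Fin 3]→L[ℝ] ℝ) (u v v' : T) :
    trilin w u v v' = - trilin w u v' v := by
  have h := trilin_self w u (v + v')
  simp only [map_add, LinearMap.add_apply, trilin_self] at h
  linarith

theorem oneForm_add (w : T [⋀^Fin 1]→L[ℝ] ℝ) (u v : T) : w ![u + v] = w ![u] + w ![v] := by
  exact congrArg (fun m => m ![]) (w.toAlternatingMap.curryLeft.map_add u v)

theorem oneForm_smul (w : T [⋀^Fin 1]→L[ℝ] ℝ) (c : ℝ) (u : T) : w ![c • u] = c * w ![u] := by
  exact congrArg (fun m => m ![]) (w.toAlternatingMap.curryLeft.map_smul c u)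

/-- A one-form as a linear functional. -/
def lin (w : T [⋀^Fin 1]→L[ℝ] ℝ) : T →ₗ[ℝ] ℝ where
  toFun u := w ![u]
  map_add' := oneForm_add w
  map_smul' := oneForm_smul w

theorem oneForm_ext {w w' : T [⋀^Fin 1]→L[ℝ] ℝ} (h : ∀ v, w ![v] = w' ![v]) : w = w' := by
  ext v
  have : v = ![v 0] := by funext i; fin_cases i; rfl
  rw [this]
  exact h _

end AlternatingForms

variable {n : ℕ} {M : Type*} [TopologicalSpace M] [ChartedSpace (EuclideanSpace ℝ (Fin n)) M]
  [IsManifold (𝓡 n) ∞ M]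

/-- Every tangent vector is the value of a smooth vector field. -/
theorem exists_smoothFieldOn_eq (x : M) (v : TangentSpace (𝓡 n) x) :
    ∃ X : Π y : M, TangentSpace (𝓡 n) y,
      SmoothFieldOn (extChartAt (𝓡 n) x).source X ∧ X x = v := by
  have := isManifold_one (n := n) (M := M)
  refine ⟨chartField x (mfderiv (𝓡 n) 𝓘(ℝ, EuclideanSpace ℝ (Fin n)) (extChartAt (𝓡 n) x) x v),
    smoothFieldOn_chartField x _, ?_⟩
  obtain ⟨e, he⟩ := isInvertible_mfderiv_extChartAt (I := 𝓡 n) (mem_extChartAt_source (I := 𝓡 n) x)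
  change (mfderiv (𝓡 n) 𝓘(ℝ, EuclideanSpace ℝ (Fin n)) (extChartAt (𝓡 n) x) x).inverse
    (mfderiv (𝓡 n) 𝓘(ℝ, EuclideanSpace ℝ (Fin n)) (extChartAt (𝓡 n) x) x v) = v
  rw [← he, ContinuousLinearMap.inverse_equiv]
  exact e.symm_apply_apply _

theorem coeff_frame {ι : Type*} [DecidableEq ι] {W : Set M}
    {X : ι → Π x : M, TangentSpace (𝓡 n) x}
    (hs : IsLocalFrameOn (𝓡 n) (EuclideanSpace ℝ (Fin n)) ∞ X W) {x : M} (hx : x ∈ W) (i j : ι) :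
    hs.coeff i x (X j x) = if j = i then 1 else 0 := by
  rw [hs.coeff_apply_of_mem hx (X j)]
  have : X j x = hs.toBasisAt hx j := (hs.toBasisAt_coe hx j).symm
  rw [this, Module.Basis.repr_self, Finsupp.single_apply]

theorem smoothFormOn_oneForm_coeff {ι : Type*} [Fintype ι] {W : Set M} (hW : IsOpen W)
    {X : ι → Π x : M, TangentSpace (𝓡 n) x}
    (hs : IsLocalFrameOn (𝓡 n) (EuclideanSpace ℝ (Fin n)) ∞ X W) {c : ι → M → ℝ}
    (hc : ∀ i, ContMDiffOn (𝓡 n) 𝓘(ℝ, ℝ) ∞ (c i) W) :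
    SmoothFormOn W (oneForm fun x => ∑ i, c i x • hs.coeff i x) := by
  refine smoothFormOn_oneForm fun W' hW'W hW' Y hY => ?_
  simp only [LinearMap.sum_apply, LinearMap.smul_apply, smul_eq_mul]
  refine contMDiffOn_finsetSum fun i _ => ?_
  exact ((hc i).mono hW'W).mul (contMDiffOn_coeff hs hW hW' hW'W hY i)

/-- A functional which annihilates some independent smooth fields at a point extends to a
smooth one-form which annihilates these fields nearby. -/
theorem exists_oneForm_extension {r : ℕ} {W : Set M} (hW : IsOpen W)
    {A : Fin r → Π x : M, TangentSpace (𝓡 n) x} (hA : ∀ i, SmoothFieldOn W (A i)) {x : M}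
    (hx : x ∈ W) (hli : LinearIndependent ℝ (fun i => A i x))
    (l : TangentSpace (𝓡 n) x →ₗ[ℝ] ℝ) (hl : ∀ i, l (A i x) = 0) :
    ∃ W' ⊆ W, IsOpen W' ∧ x ∈ W' ∧ ∃ α : Π y : M, TangentSpace (𝓡 n) y [⋀^Fin 1]→L[ℝ] ℝ,
      SmoothFormOn W' α ∧ (∀ y ∈ W', ∀ i, α y ![A i y] = 0) ∧ ∀ v, α x ![v] = l v := by
  classical
  -- The fields are completed to a local frame, by fields whose values at x form a basis of a
  -- complement.
  obtain ⟨C, hC⟩ := Submodule.exists_isCompl (Submodule.span ℝ (range fun i => A i x))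
  let c := Module.finBasis ℝ C
  choose B hB hBx using fun k => exists_smoothFieldOn_eq x (c k : TangentSpace (𝓡 n) x)
  let X : Fin r ⊕ Fin (Module.finrank ℝ C) → Π y : M, TangentSpace (𝓡 n) y := Sum.elim A B
  let W₁ := W ∩ (extChartAt (𝓡 n) x).source
  have hW₁ : IsOpen W₁ := hW.inter (isOpen_extChartAt_source x)
  have hxW₁ : x ∈ W₁ := ⟨hx, mem_extChartAt_source x⟩
  have hXs : ∀ i, SmoothFieldOn W₁ (X i) := by
    rintro (i | k)
    · exact (hA i).mono inter_subset_left
    · exact (hB k).mono inter_subset_right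
  have hXx : (fun i => X i x) = Sum.elim (fun i => A i x)
      (fun k => (c k : TangentSpace (𝓡 n) x)) := by
    funext i
    rcases i with i | k
    · rfl
    · exact hBx k
  have hcli : LinearIndependent ℝ fun k => (c k : TangentSpace (𝓡 n) x) :=
    c.linearIndependent.map' C.subtype (Submodule.ker_subtype C)
  have hXli : LinearIndependent ℝ (fun i => X i x) := by
    rw [hXx]
    refine hli.sum_type hcli (hC.disjoint.mono_right ?_)
    rw [Submodule.span_le]
    rintro _ ⟨k, rfl⟩
    exact (c k).2
  obtain ⟨W₂, hW₂, hW₂o, hxW₂⟩ := eventually_nhds_iff.1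
    (eventually_linearIndependent hW₁ hXs hxW₁ hXli)
  have hcard : Fintype.card (Fin r ⊕ Fin (Module.finrank ℝ C)) = n := by
    have h1 := Submodule.finrank_add_eq_of_isCompl hC
    rw [finrank_span_eq_card hli, finrank_tangentSpace] at h1
    simpa using h1
  have hs : IsLocalFrameOn (𝓡 n) (EuclideanSpace ℝ (Fin n)) ∞ X (W₁ ∩ W₂) :=
    isLocalFrameOn_of_linearIndependent hcard (fun i => (hXs i).mono inter_subset_left)
      fun y hy => hW₂ y hy.2
  have hxW : x ∈ W₁ ∩ W₂ := ⟨hxW₁, hxW₂⟩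
  -- The coefficients `l (X i x)` in the dual coframe are constants. They vanish for the `A i`, so
  -- the form annihilates these fields on the whole neighbourhood and not only at x.
  refine ⟨W₁ ∩ W₂, inter_subset_left.trans inter_subset_left, hW₁.inter hW₂o, hxW,
    oneForm fun y => ∑ i, l (X i x) • hs.coeff i y,
    smoothFormOn_oneForm_coeff (hW₁.inter hW₂o) hs fun i => contMDiffOn_const, ?_, ?_⟩
  · intro y hy i
    rw [oneForm_apply]
    simp only [LinearMap.sum_apply, LinearMap.smul_apply, smul_eq_mul]
    refine Finset.sum_eq_zero fun j _ => ?_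
    rw [show A i = X (Sum.inl i) from rfl, coeff_frame hs hy]
    split_ifs with h
    · rw [← h]
      simp [X, hl]
    · simp
  · intro v
    rw [oneForm_apply]
    refine LinearMap.congr_fun ((hs.toBasisAt hxW).ext fun j => ?_) v
    rw [hs.toBasisAt_coe]
    simp only [LinearMap.sum_apply, LinearMap.smul_apply, smul_eq_mul, coeff_frame hs hxW]
    simp

/-- The bracket of two fields in the span of independent fields `A i` lies, at each point, in the
span of the `A i` and their brackets. -/
theorem mlieBracket_mem_of_span {r : ℕ} {W : Set M} (hW : IsOpen W)
    {A : Fin r → Π x : M, TangentSpace (𝓡 n) x} (hA : ∀ i, SmoothFieldOn W (A i)) {x : M}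
    (hx : x ∈ W) (hli : LinearIndependent ℝ (fun i => A i x))
    {Y Z : Π x : M, TangentSpace (𝓡 n) x} (hY : SmoothFieldOn W Y) (hZ : SmoothFieldOn W Z)
    (hYA : ∀ y ∈ W, Y y ∈ Submodule.span ℝ (range fun i => A i y))
    (hZA : ∀ y ∈ W, Z y ∈ Submodule.span ℝ (range fun i => A i y))
    {K : Submodule ℝ (TangentSpace (𝓡 n) x)} (hAK : ∀ i, A i x ∈ K)
    (hbr : ∀ i j, mlieBracket (𝓡 n) (A i) (A j) x ∈ K) : mlieBracket (𝓡 n) Y Z x ∈ K := by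
  -- Argue by duality: separate the bracket from K by a functional and extend it to a form α
  -- annihilating the `A i`. Then α([Y, Z]) = −dα(Y, Z) depends only on the values of Y and Z at x,
  -- and dα vanishes on all pairs of the `A i` because their brackets lie in K.
  by_contra hcon
  obtain ⟨l, hl, hK⟩ := Submodule.exists_le_ker_of_notMem hcon
  obtain ⟨W', hW'W, hW', hxW', α, hα, hαA, hαl⟩ :=
    exists_oneForm_extension hW hA hx hli l fun i => hK (hAK i)
  have hker : ∀ y ∈ W', ∀ v ∈ Submodule.span ℝ (range fun i => A i y), α y ![v] = 0 := by
    intro y hy v hv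
    have : Submodule.span ℝ (range fun i => A i y) ≤ LinearMap.ker (lin (α y)) := by
      rw [Submodule.span_le]
      rintro _ ⟨i, rfl⟩
      exact hαA y hy i
    exact this hv
  have hA' := fun i => (hA i).mono hW'W
  have h0 : ∀ i j, bilin (mextDeriv α x) (A i x) (A j x) = 0 := by
    intro i j
    have h := hα.apply_mlieBracket hW' (hA' i) (hA' j) hxW' (fun y hy => hαA y hy i)
      (fun y hy => hαA y hy j)
    rw [hαl] at h
    have h2 : l (mlieBracket (𝓡 n) (A i) (A j) x) = 0 := hK (hbr i j)
    rw [bilin_apply]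
    linarith
  have h1 : ∀ i, ∀ v ∈ Submodule.span ℝ (range fun i => A i x),
      bilin (mextDeriv α x) (A i x) v = 0 := by
    intro i v hv
    have : Submodule.span ℝ (range fun i => A i x) ≤
        LinearMap.ker (bilin (mextDeriv α x) (A i x)) := by
      rw [Submodule.span_le]
      rintro _ ⟨j, rfl⟩
      exact h0 i j
    exact this hv
  have h2 : bilin (mextDeriv α x) (Y x) (Z x) = 0 := by
    have : Submodule.span ℝ (range fun i => A i x) ≤
        LinearMap.ker ((bilin (mextDeriv α x)).flip (Z x)) := by
      rw [Submodule.span_le]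
      rintro _ ⟨j, rfl⟩
      exact h1 j _ (hZA x hx)
    exact this (hYA x hx)
  have h3 := hα.apply_mlieBracket hW' (hY.mono hW'W) (hZ.mono hW'W) hxW'
    (fun y hy => hker y hy _ (hYA y (hW'W hy))) (fun y hy => hker y hy _ (hZA y (hW'W hy)))
  rw [hαl, ← bilin_apply, h2, neg_zero] at h3
  exact hl h3

end

/-! ### The flag, orthonormal frames and rotations -/

section

variable {n : ℕ} {M : Type*} [TopologicalSpace M] [ChartedSpace (EuclideanSpace ℝ (Fin n)) M]
  [IsManifold (𝓡 n) ∞ M]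

theorem IsSubbundleOn.finrank_eq {U : Set M} {F : Π x : M, Submodule ℝ (TangentSpace (𝓡 n) x)}
    {r : ℕ} (h : IsSubbundleOn U F r) {x : M} (hx : x ∈ U) : Module.finrank ℝ (F x) = r := by
  obtain ⟨W, -, hxW, -, X, -, hX⟩ := h x hx
  rw [← (hX x hxW).2, finrank_span_eq_card (hX x hxW).1, Fintype.card_fin]

namespace Structure

variable {S : Structure n M} {U W : Set M}

theorem IsIterBracket.pos {j : ℕ} {Z : Π x : M, TangentSpace (𝓡 n) x}
    (h : S.IsIterBracket U j Z) : 0 < j := by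
  cases h <;> omega

theorem IsIterBracket.smooth (hU : IsOpen U) {j : ℕ} {Z : Π x : M, TangentSpace (𝓡 n) x}
    (h : S.IsIterBracket U j Z) : SmoothFieldOn U Z := by
  induction h with
  | base X hX => exact hX
  | step X hX j Z hZ ih => exact SmoothFieldOn.mlieBracket hU hX ih

theorem IsIterBracket.mem_flag (hU : IsOpen U) {j k : ℕ} (hjk : j ≤ k)
    {Z : Π x : M, TangentSpace (𝓡 n) x} (h : S.IsIterBracket U j Z) {x : M} (hx : x ∈ U) :
    Z x ∈ S.flag k x :=
  Submodule.subset_span ⟨U, hU, hx, j, hjk, Z, h, rfl⟩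

theorem flag_zero (x : M) : S.flag 0 x = ⊥ := by
  rw [flag, Submodule.span_eq_bot]
  rintro _ ⟨U, -, -, j, hj, Z, hZ, -⟩
  exact absurd hZ.pos (by omega)

theorem IsSection.mono {X : Π x : M, S.E x} (hX : S.IsSection U X) (h : W ⊆ U) :
    S.IsSection W X :=
  SmoothFieldOn.mono hX h

theorem IsSection.smul {f : M → ℝ} (hf : ContMDiffOn (𝓡 n) 𝓘(ℝ, ℝ) ∞ f U) {X : Π x : M, S.E x}
    (hX : S.IsSection U X) : S.IsSection U (fun x => f x • X x) :=
  SmoothFieldOn.smul hf hX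

theorem IsSection.add {X Y : Π x : M, S.E x} (hX : S.IsSection U X) (hY : S.IsSection U Y) :
    S.IsSection U (fun x => X x + Y x) :=
  SmoothFieldOn.add hX hY

theorem IsSection.neg {X : Π x : M, S.E x} (hX : S.IsSection U X) :
    S.IsSection U (fun x => - X x) := by
  have h := hX.smul (f := fun _ => (-1 : ℝ)) contMDiffOn_const
  simpa using h

/-- Every horizontal vector is the value of a local section of `E`. -/
theorem exists_section (x : M) (u : S.E x) : ∃ W : Set M, IsOpen W ∧ x ∈ W ∧
    ∃ X : Π y : M, S.E y, S.IsSection W X ∧ X x = u := by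
  classical
  obtain ⟨r, hr⟩ := S.isSubbundle
  obtain ⟨W, hW, hxW, -, X, hX, hspan⟩ := hr x (mem_univ x)
  have hu : (u : TangentSpace (𝓡 n) x) ∈ Submodule.span ℝ (range fun i => X i x) := by
    rw [(hspan x hxW).2]; exact u.2
  obtain ⟨c, hc⟩ := (Submodule.mem_span_range_iff_exists_fun ℝ).1 hu
  let Y : Π y : M, TangentSpace (𝓡 n) y := fun y => ∑ i, c i • X i y
  have hY : ∀ y ∈ W, Y y ∈ S.E y := by
    intro y hy
    rw [← (hspan y hy).2]
    exact Submodule.sum_mem _ fun i _ => Submodule.smul_mem _ _ (Submodule.subset_span ⟨i, rfl⟩)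
  have hYs : SmoothFieldOn W Y :=
    SmoothFieldOn.sum Finset.univ fun i _ => (hX i).smul (f := fun _ => c i) contMDiffOn_const
  -- A section must take values in E at every point of M, so the combination is replaced by zero
  -- where it leaves E; over W nothing changes.
  refine ⟨W, hW, hxW, fun y => if h : Y y ∈ S.E y then ⟨Y y, h⟩ else 0, ?_, ?_⟩
  · refine SmoothFieldOn.congr hYs fun y hy => ?_
    exact congrArg Subtype.val (dif_pos (hY y hy))
  · exact (dif_pos (hY x hxW)).trans (Subtype.ext hc)

theorem flag_one (x : M) : S.flag 1 x = S.E x := by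
  apply le_antisymm
  · rw [flag, Submodule.span_le]
    rintro _ ⟨U, -, -, j, hj, Z, hZ, rfl⟩
    cases hZ with
    | base X hX => exact (X x).2
    | step X hX j Z hZ => exact absurd hZ.pos (by omega)
  · intro u hu
    obtain ⟨W, hW, hxW, X, hX, hXx⟩ := S.exists_section x ⟨u, hu⟩
    have := (IsIterBracket.base X hX).mem_flag hW le_rfl hxW
    rwa [hXx] at this

theorem HasGrowthVector.finrank_E (hS : S.HasGrowthVector ![2, 3, 5]) (x : M) :
    Module.finrank ℝ (S.E x) = 2 := by
  rw [← S.flag_one x]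
  exact (hS.1 0).finrank_eq (mem_univ x)

theorem HasGrowthVector.finrank_flag_two (hS : S.HasGrowthVector ![2, 3, 5]) (x : M) :
    Module.finrank ℝ (S.flag 2 x) = 3 :=
  (hS.1 1).finrank_eq (mem_univ x)

theorem HasGrowthVector.finrank_flag_three (hS : S.HasGrowthVector ![2, 3, 5]) (x : M) :
    Module.finrank ℝ (S.flag 3 x) = 5 :=
  (hS.1 2).finrank_eq (mem_univ x)

theorem HasGrowthVector.dim_eq (hS : S.HasGrowthVector ![2, 3, 5]) (x : M) : n = 5 := by
  have h := HasGrowthVector.finrank_flag_three hS x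
  rw [hS.2.1 x, finrank_top, finrank_tangentSpace] at h
  exact h

theorem exists_normalized {Z : Π x : M, S.E x} (hW : IsOpen W) (hZ : S.IsSection W Z) {x : M}
    (hx : x ∈ W) (hZx : Z x ≠ 0) : ∃ W' ⊆ W, IsOpen W' ∧ x ∈ W' ∧ ∃ (f : M → ℝ),
      S.IsSection W' (fun y => f y • Z y) ∧ ∀ y ∈ W', S.g y (f y • Z y) (f y • Z y) = 1 := by
  have hg := S.smooth W hW Z Z hZ hZ
  let W' := W ∩ (fun y => S.g y (Z y) (Z y)) ⁻¹' Ioi 0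
  have hW' : IsOpen W' := hg.continuousOn.isOpen_inter_preimage hW isOpen_Ioi
  have hpos : ∀ y ∈ W', 0 < S.g y (Z y) (Z y) := fun y hy => hy.2
  have hsq : ContMDiffOn (𝓡 n) 𝓘(ℝ, ℝ) ∞ (fun y => Real.sqrt (S.g y (Z y) (Z y))) W' := by
    intro y hy
    have h1 := (Real.contDiffAt_sqrt (n := ∞) (hpos y hy).ne').contMDiffAt
    exact h1.comp_contMDiffWithinAt (I := 𝓡 n) y ((hg y hy.1).mono inter_subset_left)
  have hne : ∀ y ∈ W', Real.sqrt (S.g y (Z y) (Z y)) ≠ 0 := fun y hy =>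
    (Real.sqrt_pos.2 (hpos y hy)).ne'
  refine ⟨W', inter_subset_left, hW', ⟨hx, S.pos x _ hZx⟩,
    fun y => (Real.sqrt (S.g y (Z y) (Z y)))⁻¹, ?_, ?_⟩
  · exact (hZ.mono inter_subset_left).smul (hsq.inv₀ hne)
  · intro y hy
    have h1 := hne y hy
    simp only [map_smul, LinearMap.smul_apply, smul_eq_mul]
    field_simp
    rw [Real.sq_sqrt (hpos y hy).le]

/-- The sections `e₀, e₁` of `E` are orthonormal over `W`. -/
structure IsOrthonormalOn (S : Structure n M) (W : Set M) (e₀ e₁ : Π x : M, S.E x) : Prop where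
  isSection₀ : S.IsSection W e₀
  isSection₁ : S.IsSection W e₁
  norm₀ : ∀ y ∈ W, S.g y (e₀ y) (e₀ y) = 1
  norm₁ : ∀ y ∈ W, S.g y (e₁ y) (e₁ y) = 1
  orth : ∀ y ∈ W, S.g y (e₀ y) (e₁ y) = 0

theorem IsOrthonormalOn.mono {e₀ e₁ : Π x : M, S.E x} (h : S.IsOrthonormalOn U e₀ e₁)
    (hWU : W ⊆ U) : S.IsOrthonormalOn W e₀ e₁ :=
  ⟨h.1.mono hWU, h.2.mono hWU, fun y hy => h.3 y (hWU hy), fun y hy => h.4 y (hWU hy),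
    fun y hy => h.5 y (hWU hy)⟩

theorem IsOrthonormalOn.linearIndependent {e₀ e₁ : Π x : M, S.E x}
    (h : S.IsOrthonormalOn W e₀ e₁) {y : M} (hy : y ∈ W) :
    LinearIndependent ℝ ![e₀ y, e₁ y] := by
  rw [LinearIndependent.pair_iff]
  intro s t hst
  have h0 := congrArg (S.g y (e₀ y)) hst
  have h1 := congrArg (S.g y (e₁ y)) hst
  simp only [map_add, map_smul, smul_eq_mul, h.norm₀ y hy, h.norm₁ y hy, h.orth y hy,
    S.symm y (e₁ y) (e₀ y), map_zero] at h0 h1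
  constructor <;> linarith

theorem IsOrthonormalOn.eq_sum (hS : S.HasGrowthVector ![2, 3, 5]) {e₀ e₁ : Π x : M, S.E x}
    (h : S.IsOrthonormalOn W e₀ e₁) {y : M} (hy : y ∈ W) (u : S.E y) :
    u = S.g y (e₀ y) u • e₀ y + S.g y (e₁ y) u • e₁ y := by
  have hsp := (h.linearIndependent hy).span_eq_top_of_card_eq_finrank
    (by rw [HasGrowthVector.finrank_E hS, Fintype.card_fin])
  have hu : u ∈ Submodule.span ℝ (range ![e₀ y, e₁ y]) := by rw [hsp]; trivial
  rw [Matrix.range_cons_cons_empty, Submodule.mem_span_pair] at hu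
  obtain ⟨a, b, rfl⟩ := hu
  simp [h.norm₀ y hy, h.norm₁ y hy, h.orth y hy, S.symm y (e₁ y) (e₀ y)]

theorem exists_unit_section (hS : S.HasGrowthVector ![2, 3, 5]) (hU : IsOpen U) {x : M}
    (hx : x ∈ U) : ∃ W ⊆ U, IsOpen W ∧ x ∈ W ∧ ∃ e : Π y : M, S.E y,
      S.IsSection W e ∧ ∀ y ∈ W, S.g y (e y) (e y) = 1 := by
  have : Nontrivial (S.E x) := Module.nontrivial_of_finrank_pos (R := ℝ)
    (by rw [HasGrowthVector.finrank_E hS]; norm_num)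
  obtain ⟨u, hu⟩ := exists_ne (0 : S.E x)
  obtain ⟨W, hW, hxW, X, hX, hXx⟩ := S.exists_section x u
  obtain ⟨W', hW'W, hW', hxW', f, hf, hf1⟩ :=
    exists_normalized (hU.inter hW) (hX.mono inter_subset_right) ⟨hx, hxW⟩ (by rwa [hXx])
  exact ⟨W', hW'W.trans inter_subset_left, hW', hxW', _, hf, hf1⟩

/-- Gram–Schmidt: beside a unit section take a section whose value at x is off its line, subtract
the projection and normalize. The neighbourhood shrinks to where the difference is nonzero. -/
theorem exists_isOrthonormalOn (hS : S.HasGrowthVector ![2, 3, 5]) (x : M) :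
    ∃ W : Set M, IsOpen W ∧ x ∈ W ∧ ∃ e₀ e₁ : Π y : M, S.E y, S.IsOrthonormalOn W e₀ e₁ := by
  obtain ⟨W, -, hW, hxW, e₀, he₀, hn₀⟩ := exists_unit_section hS isOpen_univ (mem_univ x)
  obtain ⟨v, hv⟩ : ∃ v : S.E x, v ∉ Submodule.span ℝ {e₀ x} := by
    by_contra! hcon
    have htop : Submodule.span ℝ {e₀ x} = ⊤ := eq_top_iff.2 fun v _ => hcon v
    have hne : e₀ x ≠ 0 := fun h0 => by simpa [h0] using hn₀ x hxW
    have := finrank_span_singleton (K := ℝ) hne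
    rw [htop, finrank_top, HasGrowthVector.finrank_E hS] at this
    omega
  obtain ⟨W₁, hW₁, hxW₁, Y, hY, hYx⟩ := S.exists_section x v
  have hW₂ := hW.inter hW₁
  have he₀' := he₀.mono (inter_subset_left (t := W₁))
  have hY' := hY.mono (inter_subset_right (s := W))
  let Z : Π y : M, S.E y := fun y => Y y + (-1 : ℝ) • S.g y (e₀ y) (Y y) • e₀ y
  have hZ : S.IsSection (W ∩ W₁) Z :=
    hY'.add ((he₀'.smul (S.smooth _ hW₂ e₀ Y he₀' hY')).smul (f := fun _ => (-1 : ℝ))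
      contMDiffOn_const)
  have hZx : Z x ≠ 0 := by
    intro h0
    apply hv
    rw [← hYx, Submodule.mem_span_singleton]
    refine ⟨S.g x (e₀ x) (Y x), ?_⟩
    have h0' : Y x + (-1 : ℝ) • S.g x (e₀ x) (Y x) • e₀ x = 0 := h0
    rw [neg_one_smul, ← sub_eq_add_neg, sub_eq_zero] at h0'
    exact h0'.symm
  obtain ⟨W', hW'W, hW', hxW', f, hf, hf1⟩ := exists_normalized hW₂ hZ ⟨hxW, hxW₁⟩ hZx
  refine ⟨W', hW', hxW', e₀, _, he₀'.mono hW'W, hf, fun y hy => hn₀ y (hW'W hy).1, hf1, ?_⟩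
  intro y hy
  simp [Z, hn₀ y (hW'W hy).1]

/-- The rotation by a right angle determined by an orthonormal frame. -/
def rotation (S : Structure n M) (e₀ e₁ : Π y : M, S.E y) (y : M) : S.E y →ₗ[ℝ] S.E y :=
  (S.g y (e₀ y)).smulRight (e₁ y) - (S.g y (e₁ y)).smulRight (e₀ y)

theorem rotation_apply (e₀ e₁ : Π y : M, S.E y) (y : M) (u : S.E y) :
    S.rotation e₀ e₁ y u = S.g y (e₀ y) u • e₁ y - S.g y (e₁ y) u • e₀ y := rfl

theorem IsOrthonormalOn.isRotationOn (hS : S.HasGrowthVector ![2, 3, 5])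
    {e₀ e₁ : Π x : M, S.E x} (h : S.IsOrthonormalOn W e₀ e₁) :
    S.IsRotationOn W (S.rotation e₀ e₁) where
  smooth := by
    intro W' hW' hW'o X hX
    have h0 := h.isSection₀.mono hW'
    have h1 := h.isSection₁.mono hW'
    have h2 := (h1.smul (S.smooth W' hW'o e₀ X h0 hX)).add
      (h0.smul (S.smooth W' hW'o e₁ X h1 hX)).neg
    simpa only [rotation_apply, sub_eq_add_neg] using h2
  orthonormal := by
    intro y hy u hu
    have hu' := h.eq_sum hS hy u
    set a := S.g y (e₀ y) u
    set b := S.g y (e₁ y) u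
    have hab : S.rotation e₀ e₁ y u = a • e₁ y - b • e₀ y := rfl
    rw [hab]
    rw [hu'] at hu ⊢
    simp only [map_add, map_sub, map_smul, LinearMap.add_apply, LinearMap.sub_apply,
      LinearMap.smul_apply, smul_eq_mul, h.norm₀ y hy, h.norm₁ y hy, h.orth y hy,
      S.symm y (e₁ y) (e₀ y)] at hu ⊢
    constructor
    · ring
    · linarith

theorem IsRotationOn.mono {J : Π x : M, S.E x →ₗ[ℝ] S.E x} (hJ : S.IsRotationOn U J)
    (hWU : W ⊆ U) : S.IsRotationOn W J :=
  ⟨fun W' hW' => hJ.smooth W' (hW'.trans hWU), fun x hx => hJ.orthonormal x (hWU hx)⟩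

theorem IsRotationOn.skew {J : Π x : M, S.E x →ₗ[ℝ] S.E x} (hJ : S.IsRotationOn U J) {x : M}
    (hx : x ∈ U) (u v : S.E x) : S.g x (J x u) v = - S.g x (J x v) u := by
  have h := hJ.self_eq_zero hx (u + v)
  simp only [map_add, LinearMap.add_apply, hJ.self_eq_zero hx] at h
  linarith

/-- Near each point of an oriented open set there is a positively oriented orthonormal frame. -/
theorem IsRotationOn.exists_isOrthonormalOn (hS : S.HasGrowthVector ![2, 3, 5]) (hU : IsOpen U)
    {J : Π x : M, S.E x →ₗ[ℝ] S.E x} (hJ : S.IsRotationOn U J) {x : M} (hx : x ∈ U) :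
    ∃ W ⊆ U, IsOpen W ∧ x ∈ W ∧ ∃ e₀ : Π y : M, S.E y,
      S.IsOrthonormalOn W e₀ (fun y => J y (e₀ y)) := by
  obtain ⟨W, hWU, hW, hxW, e₀, he₀, hn₀⟩ := exists_unit_section hS hU hx
  exact ⟨W, hWU, hW, hxW, e₀, he₀, hJ.smooth W hWU hW e₀ he₀, hn₀,
    fun y hy => (hJ.orthonormal y (hWU hy) _ (hn₀ y hy)).2,
    fun y hy => (hJ.orthonormal y (hWU hy) _ (hn₀ y hy)).1⟩

/-- In rank two, skew-symmetry and the orthonormality of e₀, J e₀ determine J completely. This lets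
any given orientation be computed in the frame e₀, J e₀. -/
theorem IsRotationOn.eq_rotation (hS : S.HasGrowthVector ![2, 3, 5])
    {J : Π x : M, S.E x →ₗ[ℝ] S.E x} (hJ : S.IsRotationOn U J) {e₀ : Π y : M, S.E y} (hWU : W ⊆ U)
    (h : S.IsOrthonormalOn W e₀ (fun y => J y (e₀ y))) {y : M} (hy : y ∈ W) :
    J y = S.rotation e₀ (fun y => J y (e₀ y)) y := by
  ext1 u
  rw [rotation_apply, h.eq_sum hS hy (J y u), S.symm y (e₀ y) (J y u), hJ.skew (hWU hy) u (e₀ y)]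
  have h1 : S.g y (J y (e₀ y)) (J y u) = S.g y (e₀ y) u := by
    conv_lhs => rw [h.eq_sum hS hy u]
    have h2 : S.g y (J y (e₀ y)) (J y (J y (e₀ y))) = 0 := by
      rw [S.symm]; exact hJ.self_eq_zero (hWU hy) _
    simp only [map_add, map_smul, smul_eq_mul, h.norm₁ y hy, h2]
    ring
  rw [h1]
  module

end Structure

end

/-! ### Adapted frames -/

section

variable {n : ℕ} {M : Type*} [TopologicalSpace M] [ChartedSpace (EuclideanSpace ℝ (Fin n)) M]
  [IsManifold (𝓡 n) ∞ M]

namespace Structure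

variable {S : Structure n M} {U W : Set M}

/-- A section of `E` as a vector field. -/
def field (e : Π y : M, S.E y) : Π y : M, TangentSpace (𝓡 n) y :=
  fun y => (e y : TangentSpace (𝓡 n) y)

/-- The fields `X₀, X₁, X₂ = [X₀, X₁], [X₀, X₂], [X₁, X₂]` derived from two sections of `E`. -/
def derivedFrame (e₀ e₁ : Π y : M, S.E y) : Fin 5 → Π y : M, TangentSpace (𝓡 n) y :=
  ![field e₀, field e₁, mlieBracket (𝓡 n) (field e₀) (field e₁),
    mlieBracket (𝓡 n) (field e₀) (mlieBracket (𝓡 n) (field e₀) (field e₁)),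
    mlieBracket (𝓡 n) (field e₁) (mlieBracket (𝓡 n) (field e₀) (field e₁))]

theorem smoothFieldOn_derivedFrame (hW : IsOpen W) {e₀ e₁ : Π y : M, S.E y}
    (h₀ : S.IsSection W e₀) (h₁ : S.IsSection W e₁) (i : Fin 5) :
    SmoothFieldOn W (derivedFrame e₀ e₁ i) := by
  have h0 : SmoothFieldOn W (field e₀) := h₀
  have h1 : SmoothFieldOn W (field e₁) := h₁
  have h2 := SmoothFieldOn.mlieBracket hW h0 h1
  fin_cases i
  exacts [h0, h1, h2, SmoothFieldOn.mlieBracket hW h0 h2, SmoothFieldOn.mlieBracket hW h1 h2]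

/-- An orthonormal frame of `E` over an open set whose iterated brackets form a frame of `TM`
adapted to the flag. -/
structure IsAdapted (S : Structure n M) (W : Set M) (e₀ e₁ : Π y : M, S.E y) : Prop
    extends S.IsOrthonormalOn W e₀ e₁ where
  isOpen : IsOpen W
  frame : IsLocalFrameOn (𝓡 n) (EuclideanSpace ℝ (Fin n)) ∞ (derivedFrame e₀ e₁) W
  mem_E : ∀ y ∈ W, ∀ v : TangentSpace (𝓡 n) y,
    v ∈ S.E y ↔ ∃ a b : ℝ, v = a • derivedFrame e₀ e₁ 0 y + b • derivedFrame e₀ e₁ 1 y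
  mem_flag_two : ∀ y ∈ W, ∀ v : TangentSpace (𝓡 n) y, v ∈ S.flag 2 y ↔ ∃ a b c : ℝ,
    v = a • derivedFrame e₀ e₁ 0 y + b • derivedFrame e₀ e₁ 1 y + c • derivedFrame e₀ e₁ 2 y

/-- Each step of the flag is spanned by the previous one and the brackets of its spanning fields
(`mlieBracket_mem_of_span`). So X₀, X₁, X₂ span E⁻² and all five fields span TM; as their numbers
are the ranks in the growth vector, they are independent. -/
theorem IsOrthonormalOn.isAdapted (hS : S.HasGrowthVector ![2, 3, 5]) (hW : IsOpen W)
    {e₀ e₁ : Π y : M, S.E y} (h : S.IsOrthonormalOn W e₀ e₁) : S.IsAdapted W e₀ e₁ := by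
  set X := derivedFrame e₀ e₁
  have hXs := smoothFieldOn_derivedFrame hW h.isSection₀ h.isSection₁
  -- the span of the horizontal fields
  let A : Fin 2 → Π y : M, TangentSpace (𝓡 n) y := ![X 0, X 1]
  have hA : ∀ i, SmoothFieldOn W (A i) := by
    intro i; fin_cases i; exacts [hXs 0, hXs 1]
  have hAli : ∀ y ∈ W, LinearIndependent ℝ (fun i => A i y) := by
    intro y hy
    have h1 := (h.linearIndependent hy).map' (S.E y).subtype (Submodule.ker_subtype _)
    have h2 : (fun i => A i y) = (S.E y).subtype ∘ ![e₀ y, e₁ y] := by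
      funext i; fin_cases i <;> rfl
    rw [h2]
    exact h1
  have hE : ∀ y ∈ W, ∀ u : S.E y, (u : TangentSpace (𝓡 n) y) ∈
      Submodule.span ℝ (range fun i => A i y) := by
    intro y hy u
    rw [h.eq_sum hS hy u]
    exact Submodule.add_mem _ (Submodule.smul_mem _ _ (Submodule.subset_span ⟨0, rfl⟩))
      (Submodule.smul_mem _ _ (Submodule.subset_span ⟨1, rfl⟩))
  -- the second step of the flag
  let B : Fin 3 → Π y : M, TangentSpace (𝓡 n) y := ![X 0, X 1, X 2]
  have hB : ∀ i, SmoothFieldOn W (B i) := by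
    intro i; fin_cases i; exacts [hXs 0, hXs 1, hXs 2]
  have hAB : ∀ y, Submodule.span ℝ (range fun i => A i y) ≤
      Submodule.span ℝ (range fun i => B i y) := by
    intro y
    rw [Submodule.span_le]
    rintro _ ⟨i, rfl⟩
    fin_cases i
    exacts [Submodule.subset_span ⟨0, rfl⟩, Submodule.subset_span ⟨1, rfl⟩]
  have hflag2 : ∀ y ∈ W, S.flag 2 y = Submodule.span ℝ (range fun i => B i y) := by
    intro y hy
    apply le_antisymm
    · rw [flag, Submodule.span_le]
      rintro _ ⟨V, hV, hyV, j, hj, Z, hZ, rfl⟩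
      cases hZ with
      | base Y hY => exact hAB y (hE y hy (Y y))
      | step Y hY j Z hZ =>
        cases hZ with
        | step Y' hY' j Z hZ => exact absurd hZ.pos (by omega)
        | base Y' hY' =>
          refine mlieBracket_mem_of_span (hW.inter hV) (A := A)
            (fun i => (hA i).mono inter_subset_left) ⟨hy, hyV⟩ (hAli y hy)
            (SmoothFieldOn.mono hY inter_subset_right) (SmoothFieldOn.mono hY' inter_subset_right)
            (fun z hz => hE z hz.1 _) (fun z hz => hE z hz.1 _) (fun i => ?_) (fun i j => ?_)
          · exact hAB y (Submodule.subset_span ⟨i, rfl⟩)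
          · have h2 : X 2 y ∈ Submodule.span ℝ (range fun i => B i y) :=
              Submodule.subset_span ⟨2, rfl⟩
            fin_cases i <;> fin_cases j
            · change mlieBracket (𝓡 n) (X 0) (X 0) y ∈ _
              rw [mlieBracket_self]; exact Submodule.zero_mem _
            · exact h2
            · change mlieBracket (𝓡 n) (X 1) (X 0) y ∈ _
              rw [mlieBracket_swap_apply]; exact Submodule.neg_mem _ h2
            · change mlieBracket (𝓡 n) (X 1) (X 1) y ∈ _
              rw [mlieBracket_self]; exact Submodule.zero_mem _
    · rw [Submodule.span_le]
      have hb1 := IsIterBracket.base e₁ h.isSection₁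
      rintro _ ⟨i, rfl⟩
      fin_cases i
      · exact (IsIterBracket.base e₀ h.isSection₀).mem_flag hW (by norm_num) hy
      · exact hb1.mem_flag hW (by norm_num) hy
      · exact (IsIterBracket.step e₀ h.isSection₀ 1 _ hb1).mem_flag hW le_rfl hy
  -- Three fields spanning a space of dimension three. Their independence is needed to use the span
  -- argument once more, for the third step.
  have hBli : ∀ y ∈ W, LinearIndependent ℝ (fun i => B i y) := by
    intro y hy
    rw [linearIndependent_iff_card_eq_finrank_span, Set.finrank, ← hflag2 y hy,
      HasGrowthVector.finrank_flag_two hS, Fintype.card_fin]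
  -- the third step of the flag
  have hBX : ∀ y, Submodule.span ℝ (range fun i => B i y) ≤
      Submodule.span ℝ (range fun i => X i y) := by
    intro y
    rw [Submodule.span_le]
    rintro _ ⟨i, rfl⟩
    fin_cases i
    exacts [Submodule.subset_span ⟨0, rfl⟩, Submodule.subset_span ⟨1, rfl⟩,
      Submodule.subset_span ⟨2, rfl⟩]
  have hflag3 : ∀ y ∈ W, S.flag 3 y ≤ Submodule.span ℝ (range fun i => X i y) := by
    intro y hy
    rw [flag, Submodule.span_le]
    rintro _ ⟨V, hV, hyV, j, hj, Z, hZ, rfl⟩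
    rcases Nat.lt_or_ge j 3 with hj3 | hj3
    · refine hBX y ?_
      rw [← hflag2 y hy]
      exact hZ.mem_flag hV (by omega) hyV
    · cases hZ with
      | base Y hY => omega
      | step Y hY j Z hZ =>
        refine mlieBracket_mem_of_span (hW.inter hV) (A := B)
          (fun i => (hB i).mono inter_subset_left) ⟨hy, hyV⟩ (hBli y hy)
          (SmoothFieldOn.mono hY inter_subset_right)
          (SmoothFieldOn.mono (hZ.smooth hV) inter_subset_right)
          (fun z hz => hAB z (hE z hz.1 _)) (fun z hz => ?_) (fun i => ?_) (fun i j => ?_)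
        · rw [← hflag2 z hz.1]
          exact hZ.mem_flag hV (by omega) hz.2
        · exact hBX y (Submodule.subset_span ⟨i, rfl⟩)
        · have hmem : ∀ k, X k y ∈ Submodule.span ℝ (range fun i => X i y) := fun k =>
            Submodule.subset_span ⟨k, rfl⟩
          have hlt : ∀ i j : Fin 3, i < j → mlieBracket (𝓡 n) (B i) (B j) y ∈
              Submodule.span ℝ (range fun i => X i y) := by
            intro i j hij
            fin_cases i <;> fin_cases j <;> first | exact absurd hij (by decide) | skip
            exacts [hmem 2, hmem 3, hmem 4]
          rcases lt_trichotomy i j with hij | hij | hij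
          · exact hlt i j hij
          · rw [hij, mlieBracket_self]; exact Submodule.zero_mem _
          · rw [mlieBracket_swap_apply]; exact Submodule.neg_mem _ (hlt j i hij)
  have hXli : ∀ y ∈ W, LinearIndependent ℝ (fun i => X i y) := by
    intro y hy
    have htop : Submodule.span ℝ (range fun i => X i y) = ⊤ := by
      rw [eq_top_iff, ← hS.2.1 y]
      exact hflag3 y hy
    rw [linearIndependent_iff_card_eq_finrank_span, Set.finrank, htop, finrank_top,
      finrank_tangentSpace, HasGrowthVector.dim_eq hS y, Fintype.card_fin]
  refine { toIsOrthonormalOn := h, isOpen := hW, frame := ?_, mem_E := ?_, mem_flag_two := ?_ }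
  · refine ⟨fun {y} hy => hXli y hy, fun {y} hy => ?_, hXs⟩
    rw [← hS.2.1 y]
    exact hflag3 y hy
  · intro y hy v
    constructor
    · intro hv
      refine ⟨_, _, congrArg Subtype.val (h.eq_sum hS hy ⟨v, hv⟩)⟩
    · rintro ⟨a, b, rfl⟩
      exact Submodule.add_mem _ (Submodule.smul_mem _ _ (e₀ y).2)
        (Submodule.smul_mem _ _ (e₁ y).2)
  · intro y hy v
    rw [hflag2 y hy, Submodule.mem_span_range_iff_exists_fun]
    constructor
    · rintro ⟨c, rfl⟩
      exact ⟨c 0, c 1, c 2, Fin.sum_univ_three _⟩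
    · rintro ⟨a, b, c, rfl⟩
      exact ⟨![a, b, c], Fin.sum_univ_three _⟩

end Structure

end

/-! ### The dual coframe and the transversal components of brackets -/

section

variable {n : ℕ} {M : Type*} [TopologicalSpace M] [ChartedSpace (EuclideanSpace ℝ (Fin n)) M]
  [IsManifold (𝓡 n) ∞ M]

theorem sum_coeff_smul {ι : Type*} [Fintype ι] {W : Set M}
    {X : ι → Π x : M, TangentSpace (𝓡 n) x}
    (hs : IsLocalFrameOn (𝓡 n) (EuclideanSpace ℝ (Fin n)) ∞ X W) {x : M} (hx : x ∈ W)
    (v : TangentSpace (𝓡 n) x) : v = ∑ i, hs.coeff i x v • X i x := by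
  conv_lhs => rw [← (hs.toBasisAt hx).sum_repr v]
  refine Finset.sum_congr rfl fun i _ => ?_
  rw [hs.toBasisAt_coe]
  simp [IsLocalFrameOn.coeff, hx]

namespace Structure

variable {S : Structure n M} {U W : Set M} {e₀ e₁ : Π y : M, S.E y}

theorem IsAdapted.mem_E_iff (h : S.IsAdapted W e₀ e₁) {x : M} (hx : x ∈ W)
    (v : TangentSpace (𝓡 n) x) :
    v ∈ S.E x ↔ h.frame.coeff 2 x v = 0 ∧ h.frame.coeff 3 x v = 0 ∧ h.frame.coeff 4 x v = 0 := by
  constructor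
  · intro hv
    obtain ⟨a, b, rfl⟩ := (h.mem_E x hx v).1 hv
    simp [coeff_frame h.frame hx]
  · rintro ⟨h2, h3, h4⟩
    refine (h.mem_E x hx v).2 ⟨h.frame.coeff 0 x v, h.frame.coeff 1 x v, ?_⟩
    conv_lhs => rw [sum_coeff_smul h.frame hx v, Fin.sum_univ_five, h2, h3, h4]
    simp only [zero_smul, add_zero]

theorem IsAdapted.mem_flag_two_iff (h : S.IsAdapted W e₀ e₁) {x : M} (hx : x ∈ W)
    (v : TangentSpace (𝓡 n) x) :
    v ∈ S.flag 2 x ↔ h.frame.coeff 3 x v = 0 ∧ h.frame.coeff 4 x v = 0 := by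
  constructor
  · intro hv
    obtain ⟨a, b, c, rfl⟩ := (h.mem_flag_two x hx v).1 hv
    simp [coeff_frame h.frame hx]
  · rintro ⟨h3, h4⟩
    refine (h.mem_flag_two x hx v).2
      ⟨h.frame.coeff 0 x v, h.frame.coeff 1 x v, h.frame.coeff 2 x v, ?_⟩
    conv_lhs => rw [sum_coeff_smul h.frame hx v, Fin.sum_univ_five, h3, h4]
    simp only [zero_smul, add_zero]

/-- The forms of the coframe dual to an adapted frame. -/
def IsAdapted.coform (h : S.IsAdapted W e₀ e₁) (i : Fin 5) :
    Π x : M, TangentSpace (𝓡 n) x [⋀^Fin 1]→L[ℝ] ℝ :=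
  oneForm (h.frame.coeff i)

theorem IsAdapted.coform_apply (h : S.IsAdapted W e₀ e₁) (i : Fin 5) {x : M}
    (v : TangentSpace (𝓡 n) x) : h.coform i x ![v] = h.frame.coeff i x v := rfl

theorem IsAdapted.smooth_coform (h : S.IsAdapted W e₀ e₁) (i : Fin 5) :
    SmoothFormOn W (h.coform i) :=
  smoothFormOn_oneForm fun _ hW'W hW' _ hY => contMDiffOn_coeff h.frame h.isOpen hW' hW'W hY i

/-- Structure equations of the coframe: both fields are annihilated by ξⁱ, so only the bracket term
of dξⁱ survives. -/
theorem IsAdapted.mextDeriv_coform (h : S.IsAdapted W e₀ e₁) {i j k : Fin 5} (hj : j ≠ i)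
    (hk : k ≠ i) {x : M} (hx : x ∈ W) :
    bilin (mextDeriv (h.coform i) x) (derivedFrame e₀ e₁ j x) (derivedFrame e₀ e₁ k x) =
      - h.frame.coeff i x
        (mlieBracket (𝓡 n) (derivedFrame e₀ e₁ j) (derivedFrame e₀ e₁ k) x) := by
  have h1 := (h.smooth_coform i).apply_mlieBracket h.isOpen (h.frame.contMDiffOn j)
    (h.frame.contMDiffOn k) hx
    (fun y hy => by rw [h.coform_apply, coeff_frame h.frame hy, if_neg hj])
    (fun y hy => by rw [h.coform_apply, coeff_frame h.frame hy, if_neg hk])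
  rw [h.coform_apply] at h1
  rw [h1, bilin_apply, neg_neg]

theorem IsAdapted.isRotationOn (hS : S.HasGrowthVector ![2, 3, 5]) (h : S.IsAdapted W e₀ e₁) :
    S.IsRotationOn W (S.rotation e₀ e₁) :=
  h.toIsOrthonormalOn.isRotationOn hS

/-- The components, transversal to `E`, of the bracket of two sections of `E`. -/
theorem IsAdapted.coeff_mlieBracket (h : S.IsAdapted W e₀ e₁) {W' : Set M} (hW' : IsOpen W')
    (hWW : W' ⊆ W) {Y Z : Π x : M, TangentSpace (𝓡 n) x} (hY : SmoothFieldOn W' Y)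
    (hZ : SmoothFieldOn W' Z) (hYE : ∀ y ∈ W', Y y ∈ S.E y) (hZE : ∀ y ∈ W', Z y ∈ S.E y)
    {x : M} (hx : x ∈ W') (i : Fin 5) (hi : 2 ≤ i) :
    h.frame.coeff i x (mlieBracket (𝓡 n) Y Z x) =
      (h.frame.coeff 0 x (Y x) * h.frame.coeff 1 x (Z x) -
        h.frame.coeff 1 x (Y x) * h.frame.coeff 0 x (Z x)) * if i = 2 then 1 else 0 := by
  have hE : ∀ y ∈ W', ∀ v ∈ S.E y, h.frame.coeff i y v = 0 := by
    intro y hy v hv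
    obtain ⟨h2, h3, h4⟩ := (h.mem_E_iff (hWW hy) v).1 hv
    fin_cases i
    · exact absurd hi (by decide)
    · exact absurd hi (by decide)
    exacts [h2, h3, h4]
  -- For i ≥ 2 the form ξⁱ annihilates E, so the component is −dξⁱ(Y, Z), a multiple of dξⁱ(X₀, X₁)
  -- = −ξⁱ(X₂).
  have h1 := ((h.smooth_coform i).mono hWW).apply_mlieBracket hW' hY hZ hx
    (fun y hy => hE y hy _ (hYE y hy)) (fun y hy => hE y hy _ (hZE y hy))
  rw [h.coform_apply, ← bilin_apply] at h1
  have h01 := h.mextDeriv_coform (i := i) (j := 0) (k := 1)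
    (by rintro rfl; exact absurd hi (by decide)) (by rintro rfl; exact absurd hi (by decide))
    (hWW hx)
  have hX2 : mlieBracket (𝓡 n) (derivedFrame e₀ e₁ 0) (derivedFrame e₀ e₁ 1) x =
      derivedFrame e₀ e₁ 2 x := rfl
  rw [hX2, coeff_frame h.frame (hWW hx)] at h01
  obtain ⟨a, b, hab⟩ := (h.mem_E x (hWW hx) _).1 (hYE x hx)
  obtain ⟨c, d, hcd⟩ := (h.mem_E x (hWW hx) _).1 (hZE x hx)
  rw [h1, hab, hcd]
  simp only [map_add, map_smul, LinearMap.add_apply, LinearMap.smul_apply, bilin_self, smul_eq_mul,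
    bilin_swap _ (derivedFrame e₀ e₁ 1 x) (derivedFrame e₀ e₁ 0 x), h01,
    coeff_frame h.frame (hWW hx)]
  have h10 : ¬ ((1 : Fin 5) = 0) := by decide
  have h02 : ¬ ((0 : Fin 5) = 1) := by decide
  have hii : (2 = i) = (i = 2) := propext eq_comm
  simp only [h10, h02, hii, if_false, if_true]
  ring

/-- The components, transversal to `E⁻²`, of the bracket of a section of `E` with one of `E⁻²`. -/
theorem IsAdapted.coeff_mlieBracket_flag_two (h : S.IsAdapted W e₀ e₁) {W' : Set M}
    (hW' : IsOpen W') (hWW : W' ⊆ W) {Y Z : Π x : M, TangentSpace (𝓡 n) x}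
    (hY : SmoothFieldOn W' Y) (hZ : SmoothFieldOn W' Z) (hYE : ∀ y ∈ W', Y y ∈ S.E y)
    (hZE : ∀ y ∈ W', Z y ∈ S.flag 2 y) {x : M} (hx : x ∈ W') :
    h.frame.coeff 3 x (mlieBracket (𝓡 n) Y Z x) =
      h.frame.coeff 0 x (Y x) * h.frame.coeff 2 x (Z x) ∧
    h.frame.coeff 4 x (mlieBracket (𝓡 n) Y Z x) =
      h.frame.coeff 1 x (Y x) * h.frame.coeff 2 x (Z x) := by
  obtain ⟨a, b, hab⟩ := (h.mem_E x (hWW hx) _).1 (hYE x hx)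
  obtain ⟨p, q, r, hpqr⟩ := (h.mem_flag_two x (hWW hx) _).1 (hZE x hx)
  -- Both ξ³ and ξ⁴ annihilate E⁻², so the component is −dξⁱ(Y, Z). Among the pairs of X₀, X₁, X₂
  -- only (X₀, X₂) contributes for i = 3, and only (X₁, X₂) for i = 4.
  have key : ∀ i : Fin 5, (i = 3 ∨ i = 4) → h.frame.coeff i x (mlieBracket (𝓡 n) Y Z x) =
      r * (a * (if i = 3 then 1 else 0) + b * if i = 4 then 1 else 0) := by
    intro i hi
    have hY0 : ∀ y ∈ W', h.frame.coeff i y (Y y) = 0 := by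
      intro y hy
      obtain ⟨-, h3, h4⟩ := (h.mem_E_iff (hWW hy) _).1 (hYE y hy)
      rcases hi with rfl | rfl
      exacts [h3, h4]
    have hZ0 : ∀ y ∈ W', h.frame.coeff i y (Z y) = 0 := by
      intro y hy
      obtain ⟨h3, h4⟩ := (h.mem_flag_two_iff (hWW hy) _).1 (hZE y hy)
      rcases hi with rfl | rfl
      exacts [h3, h4]
    have h1 := ((h.smooth_coform i).mono hWW).apply_mlieBracket hW' hY hZ hx hY0 hZ0
    rw [h.coform_apply, ← bilin_apply] at h1
    have h01 := h.mextDeriv_coform (i := i) (j := 0) (k := 1)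
      (by rcases hi with rfl | rfl <;> decide) (by rcases hi with rfl | rfl <;> decide) (hWW hx)
    have h02 := h.mextDeriv_coform (i := i) (j := 0) (k := 2)
      (by rcases hi with rfl | rfl <;> decide) (by rcases hi with rfl | rfl <;> decide) (hWW hx)
    have h12 := h.mextDeriv_coform (i := i) (j := 1) (k := 2)
      (by rcases hi with rfl | rfl <;> decide) (by rcases hi with rfl | rfl <;> decide) (hWW hx)
    have hX2 : mlieBracket (𝓡 n) (derivedFrame e₀ e₁ 0) (derivedFrame e₀ e₁ 1) x =
        derivedFrame e₀ e₁ 2 x := rfl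
    have hX3 : mlieBracket (𝓡 n) (derivedFrame e₀ e₁ 0) (derivedFrame e₀ e₁ 2) x =
        derivedFrame e₀ e₁ 3 x := rfl
    have hX4 : mlieBracket (𝓡 n) (derivedFrame e₀ e₁ 1) (derivedFrame e₀ e₁ 2) x =
        derivedFrame e₀ e₁ 4 x := rfl
    rw [hX2, coeff_frame h.frame (hWW hx)] at h01
    rw [hX3, coeff_frame h.frame (hWW hx)] at h02
    rw [hX4, coeff_frame h.frame (hWW hx)] at h12
    have hi2 : ¬ ((2 : Fin 5) = i) := by rcases hi with rfl | rfl <;> decide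
    have hi3 : ((3 : Fin 5) = i) = (i = 3) := propext eq_comm
    have hi4 : ((4 : Fin 5) = i) = (i = 4) := propext eq_comm
    rw [h1, hab, hpqr]
    simp only [map_add, map_smul, LinearMap.add_apply, LinearMap.smul_apply, bilin_self,
      smul_eq_mul, bilin_swap _ (derivedFrame e₀ e₁ 1 x) (derivedFrame e₀ e₁ 0 x), h01, h02, h12,
      hi2, hi3, hi4, if_false]
    ring
  have hc0 : h.frame.coeff 0 x (Y x) = a := by rw [hab]; simp [coeff_frame h.frame (hWW hx)]
  have hc1 : h.frame.coeff 1 x (Y x) = b := by rw [hab]; simp [coeff_frame h.frame (hWW hx)]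
  have hc2 : h.frame.coeff 2 x (Z x) = r := by rw [hpqr]; simp [coeff_frame h.frame (hWW hx)]
  rw [hc0, hc1, hc2, key 3 (Or.inl rfl), key 4 (Or.inr rfl)]
  have h34 : ¬ ((3 : Fin 5) = 4) := by decide
  have h43 : ¬ ((4 : Fin 5) = 3) := by decide
  simp only [h34, h43, if_true, if_false]
  constructor <;> ring

end Structure

end

/-! ### Gluing, and the one-form φ -/

section

/-- Local objects which are locally unique glue to a global one. -/
theorem exists_of_locally_unique {M : Type*} [TopologicalSpace M] {A : M → Type*}
    {P : Set M → (Π x, A x) → Prop}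
    (mono : ∀ {U W f}, IsOpen U → IsOpen W → W ⊆ U → P U f → P W f)
    (unique : ∀ {U f f'}, IsOpen U → P U f → P U f' → ∀ x ∈ U, f x = f' x)
    (local_ : ∀ {U f}, (∀ x ∈ U, ∃ W ⊆ U, IsOpen W ∧ x ∈ W ∧ ∃ f', P W f' ∧ ∀ y ∈ W, f y = f' y) →
      P U f)
    [∀ x, Nonempty (A x)] {U : Set M}
    (h : ∀ x ∈ U, ∃ W ⊆ U, IsOpen W ∧ x ∈ W ∧ ∃ f, P W f) : ∃ f, P U f := by
  classical
  choose! W hWU hW hxW f hf using h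
  -- At x the glued object takes the value of the local object chosen for x. Uniqueness on overlaps
  -- makes it agree near x with that single local object.
  refine ⟨fun x => if x ∈ U then f x x else Classical.arbitrary _, local_ fun x hx =>
    ⟨W x, hWU x hx, hW x hx, hxW x hx, f x, hf x hx, fun y hy => ?_⟩⟩
  have hyU := hWU x hx hy
  rw [if_pos hyU]
  exact unique ((hW y hyU).inter (hW x hx))
    (mono (hW y hyU) ((hW y hyU).inter (hW x hx)) inter_subset_left (hf y hyU))
    (mono (hW x hx) ((hW y hyU).inter (hW x hx)) inter_subset_right (hf x hx)) y ⟨hxW y hyU, hy⟩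

variable {n : ℕ} {M : Type*} [TopologicalSpace M] [ChartedSpace (EuclideanSpace ℝ (Fin n)) M]
  [IsManifold (𝓡 n) ∞ M]

theorem smoothFieldOn_of_local {U : Set M} {X : Π x : M, TangentSpace (𝓡 n) x}
    (h : ∀ x ∈ U, ∃ W : Set M, IsOpen W ∧ x ∈ W ∧ SmoothFieldOn (U ∩ W) X) : SmoothFieldOn U X :=
  contMDiffOn_of_locally_contMDiffOn h

namespace Structure

variable {S : Structure n M} {U W : Set M} {e₀ e₁ : Π y : M, S.E y}

/-- The defining properties of `φ` over the open set `U`. -/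
structure IsPhiOn (S : Structure n M) (U : Set M)
    (φ : Π x : M, TangentSpace (𝓡 n) x →ₗ[ℝ] S.E x) : Prop where
  smooth : ∀ W ⊆ U, IsOpen W → ∀ X : Π x : M, TangentSpace (𝓡 n) x, SmoothFieldOn W X →
    S.IsSection W (fun x => φ x (X x))
  ker_eq : ∀ x ∈ U, LinearMap.ker (φ x) = S.flag 2 x
  bracket : ∀ W ⊆ U, IsOpen W → ∀ J : Π x : M, S.E x →ₗ[ℝ] S.E x, S.IsRotationOn W J →
    ∀ X : Π x : M, S.E x, S.IsSection W X → ∀ x ∈ W,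
      φ x (mlieBracket (𝓡 n) (field X) (mlieBracket (𝓡 n) (field X)
        (field fun y => J y (X y))) x) = S.g x (X x) (X x) • J x (X x)

theorem isPhiOn_univ_iff {φ : Π x : M, TangentSpace (𝓡 n) x →ₗ[ℝ] S.E x} :
    S.IsPhiOn univ φ ↔ S.IsPhi φ :=
  ⟨fun h => ⟨fun W hW => h.1 W (subset_univ W) hW, fun x => h.2 x (mem_univ x),
    fun W hW => h.3 W (subset_univ W) hW⟩,
   fun h => ⟨fun W _ hW => h.1 W hW, fun x _ => h.2 x, fun W _ hW => h.3 W hW⟩⟩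

theorem IsPhiOn.mono {φ : Π x : M, TangentSpace (𝓡 n) x →ₗ[ℝ] S.E x} (h : S.IsPhiOn U φ)
    (hWU : W ⊆ U) : S.IsPhiOn W φ :=
  ⟨fun W' hW' => h.1 W' (hW'.trans hWU), fun x hx => h.2 x (hWU hx),
    fun W' hW' => h.3 W' (hW'.trans hWU)⟩

theorem rotation_e₀ (h : S.IsOrthonormalOn W e₀ e₁) {y : M} (hy : y ∈ W) :
    S.rotation e₀ e₁ y (e₀ y) = e₁ y := by
  rw [rotation_apply, h.norm₀ y hy, S.symm, h.orth y hy, one_smul, zero_smul, sub_zero]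

theorem rotation_e₁ (h : S.IsOrthonormalOn W e₀ e₁) {y : M} (hy : y ∈ W) :
    S.rotation e₀ e₁ y (e₁ y) = - e₀ y := by
  rw [rotation_apply, h.norm₁ y hy, h.orth y hy, one_smul, zero_smul, zero_sub]

/-- The defining identity for X = e₀: here J X = e₁, so the double bracket is X₃. The equality J e₀
= e₁ holds only over W, hence the passage through germs. -/
theorem IsPhiOn.apply_three (hS : S.HasGrowthVector ![2, 3, 5]) (h : S.IsAdapted W e₀ e₁)
    {φ : Π x : M, TangentSpace (𝓡 n) x →ₗ[ℝ] S.E x} (hφ : S.IsPhiOn W φ) {x : M} (hx : x ∈ W) :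
    φ x (derivedFrame e₀ e₁ 3 x) = e₁ x := by
  have h1 := hφ.bracket W subset_rfl h.isOpen _ (h.isRotationOn hS) e₀ h.isSection₀ x hx
  have h2 : (field fun y => S.rotation e₀ e₁ y (e₀ y)) =ᶠ[𝓝 x] field e₁ := by
    filter_upwards [h.isOpen.mem_nhds hx] with y hy
    exact congrArg Subtype.val (rotation_e₀ h.toIsOrthonormalOn hy)
  have h3 : mlieBracket (𝓡 n) (field e₀) (mlieBracket (𝓡 n) (field e₀)
      (field fun y => S.rotation e₀ e₁ y (e₀ y))) x = derivedFrame e₀ e₁ 3 x :=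
    (EventuallyEq.refl _ (field e₀)).mlieBracket_vectorField_eq
      ((EventuallyEq.refl _ (field e₀)).mlieBracket_vectorField h2)
  rw [h3, h.norm₀ x hx, rotation_e₀ h.toIsOrthonormalOn hx, one_smul] at h1
  exact h1

/-- The defining identity for X = e₁: here J X = −e₀ and [X₁, −X₀] = X₂, so the double bracket is
X₄. -/
theorem IsPhiOn.apply_four (hS : S.HasGrowthVector ![2, 3, 5]) (h : S.IsAdapted W e₀ e₁)
    {φ : Π x : M, TangentSpace (𝓡 n) x →ₗ[ℝ] S.E x} (hφ : S.IsPhiOn W φ) {x : M} (hx : x ∈ W) :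
    φ x (derivedFrame e₀ e₁ 4 x) = - e₀ x := by
  have := isManifold_one (n := n) (M := M)
  have h1 := hφ.bracket W subset_rfl h.isOpen _ (h.isRotationOn hS) e₁ h.isSection₁ x hx
  have h2 : ∀ z ∈ W, (field fun y => S.rotation e₀ e₁ y (e₁ y)) =ᶠ[𝓝 z]
      (-1 : ℝ) • field e₀ := by
    intro z hz
    filter_upwards [h.isOpen.mem_nhds hz] with y hy
    rw [Pi.smul_apply, neg_one_smul]
    exact congrArg Subtype.val (rotation_e₁ h.toIsOrthonormalOn hy)
  have h3 : mlieBracket (𝓡 n) (field e₁) (field fun y => S.rotation e₀ e₁ y (e₁ y)) =ᶠ[𝓝 x]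
      derivedFrame e₀ e₁ 2 := by
    filter_upwards [h.isOpen.mem_nhds hx] with z hz
    have hd := (SmoothFieldOn.contMDiffAt h.isSection₀ h.isOpen hz).mdifferentiableAt (by simp)
    rw [(EventuallyEq.refl _ (field e₁)).mlieBracket_vectorField_eq (h2 z hz)]
    refine (mlieBracket_const_smul_right (V := field e₁) (W := field e₀) (c := (-1 : ℝ))
      hd).trans ?_
    rw [neg_one_smul]
    exact mlieBracket_swap_apply.symm
  have h4 : mlieBracket (𝓡 n) (field e₁) (mlieBracket (𝓡 n) (field e₁)
      (field fun y => S.rotation e₀ e₁ y (e₁ y))) x = derivedFrame e₀ e₁ 4 x :=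
    (EventuallyEq.refl _ (field e₁)).mlieBracket_vectorField_eq h3
  rw [h4, h.norm₁ x hx, rotation_e₁ h.toIsOrthonormalOn hx, one_smul] at h1
  exact h1

/-- The form `φ` in terms of an adapted frame. -/
def IsAdapted.phi (h : S.IsAdapted W e₀ e₁) (x : M) : TangentSpace (𝓡 n) x →ₗ[ℝ] S.E x :=
  (h.frame.coeff 3 x).smulRight (e₁ x) - (h.frame.coeff 4 x).smulRight (e₀ x)

theorem IsAdapted.phi_apply (h : S.IsAdapted W e₀ e₁) (x : M) (v : TangentSpace (𝓡 n) x) :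
    h.phi x v = h.frame.coeff 3 x v • e₁ x - h.frame.coeff 4 x v • e₀ x := rfl

/-- The values on the frame are forced: X₀, X₁, X₂ lie in the kernel E⁻², and the identity for e₀
and e₁ gives the values on X₃ and X₄. -/
theorem IsPhiOn.eq_phi (hS : S.HasGrowthVector ![2, 3, 5]) (h : S.IsAdapted W e₀ e₁)
    {φ : Π x : M, TangentSpace (𝓡 n) x →ₗ[ℝ] S.E x} (hφ : S.IsPhiOn W φ) {x : M} (hx : x ∈ W) :
    φ x = h.phi x := by
  refine (h.frame.toBasisAt hx).ext fun i => ?_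
  rw [h.frame.toBasisAt_coe, h.phi_apply]
  have hker : ∀ v ∈ S.flag 2 x, φ x v = 0 := by
    intro v hv
    rw [← hφ.ker_eq x hx] at hv
    exact hv
  fin_cases i
  · refine (hker _ ((h.mem_flag_two_iff hx _).2 ?_)).trans ?_ <;>
      simp [coeff_frame h.frame hx]
  · refine (hker _ ((h.mem_flag_two_iff hx _).2 ?_)).trans ?_ <;>
      simp [coeff_frame h.frame hx]
  · refine (hker _ ((h.mem_flag_two_iff hx _).2 ?_)).trans ?_ <;>
      simp [coeff_frame h.frame hx]
  · refine (hφ.apply_three hS h hx).trans ?_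
    simp [coeff_frame h.frame hx]
  · refine (hφ.apply_four hS h hx).trans ?_
    simp [coeff_frame h.frame hx]

theorem IsAdapted.coeff_e (hS : S.HasGrowthVector ![2, 3, 5]) (h : S.IsAdapted W e₀ e₁) {x : M}
    (hx : x ∈ W) (u : S.E x) :
    h.frame.coeff 0 x (u : TangentSpace (𝓡 n) x) = S.g x (e₀ x) u ∧
    h.frame.coeff 1 x (u : TangentSpace (𝓡 n) x) = S.g x (e₁ x) u := by
  have h1 : (u : TangentSpace (𝓡 n) x) = S.g x (e₀ x) u • derivedFrame e₀ e₁ 0 x +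
      S.g x (e₁ x) u • derivedFrame e₀ e₁ 1 x := congrArg Subtype.val (h.eq_sum hS hx u)
  constructor <;> (rw [h1]; simp [coeff_frame h.frame hx])

/-- Let Y = a X₀ + b X₁ and J Y = c X₀ + d X₁. Then [Y, J Y] ≡ (ad − bc) X₂ modulo E, hence [Y, [Y,
J Y]] ≡ (ad − bc)(a X₃ + b X₄) modulo E⁻². Orthogonality ac + bd = 0 turns the image (ad − bc)(a e₁
− b e₀) into (a² + b²)(c e₀ + d e₁). The sign of J never enters, so both orientations are covered.
-/
theorem IsAdapted.isPhiOn (hS : S.HasGrowthVector ![2, 3, 5]) (h : S.IsAdapted W e₀ e₁) :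
    S.IsPhiOn W h.phi where
  smooth := by
    intro W' hW'W hW' X hX
    have h3 := contMDiffOn_coeff h.frame h.isOpen hW' hW'W hX 3
    have h4 := contMDiffOn_coeff h.frame h.isOpen hW' hW'W hX 4
    have := ((h.isSection₁.mono hW'W).smul h3).add ((h.isSection₀.mono hW'W).smul h4).neg
    simpa only [h.phi_apply, sub_eq_add_neg] using this
  ker_eq := by
    intro x hx
    ext v
    rw [LinearMap.mem_ker, h.phi_apply, h.mem_flag_two_iff hx]
    constructor
    · intro h0
      have h1 := LinearIndependent.pair_iff.1 (h.linearIndependent hx) (- h.frame.coeff 4 x v)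
        (h.frame.coeff 3 x v) (by rw [← h0]; module)
      exact ⟨h1.2, by linarith [h1.1]⟩
    · rintro ⟨h3, h4⟩
      simp [h3, h4]
  bracket := by
    intro W' hW'W hW' J hJ Y hY x hx
    have hJY := hJ.smooth W' subset_rfl hW' Y hY
    set Z := mlieBracket (𝓡 n) (field Y) (field fun y => J y (Y y))
    have hZs : SmoothFieldOn W' Z := SmoothFieldOn.mlieBracket hW' hY hJY
    have hYE : ∀ y ∈ W', field Y y ∈ S.E y := fun y _ => (Y y).2
    have hZc := fun y (hy : y ∈ W') i hi => h.coeff_mlieBracket hW' hW'W hY hJY hYE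
      (fun y _ => (J y (Y y)).2) hy i hi
    have hZE : ∀ y ∈ W', Z y ∈ S.flag 2 y := by
      intro y hy
      rw [h.mem_flag_two_iff (hW'W hy)]
      constructor
      · exact (hZc y hy 3 (by decide)).trans (by simp)
      · exact (hZc y hy 4 (by decide)).trans (by simp)
    have hZ2 := hZc x hx 2 le_rfl
    rw [if_pos rfl, mul_one] at hZ2
    obtain ⟨hc3, hc4⟩ := h.coeff_mlieBracket_flag_two hW' hW'W hY hZs hYE hZE hx
    obtain ⟨hY0, hY1⟩ := h.coeff_e hS (hW'W hx) (Y x)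
    obtain ⟨hJ0, hJ1⟩ := h.coeff_e hS (hW'W hx) (J x (Y x))
    have hYsum := h.eq_sum hS (hW'W hx) (Y x)
    have hJsum := h.eq_sum hS (hW'W hx) (J x (Y x))
    have horth := hJ.self_eq_zero hx (Y x)
    have hnorm : S.g x (Y x) (Y x) = S.g x (e₀ x) (Y x) * S.g x (e₀ x) (Y x) +
        S.g x (e₁ x) (Y x) * S.g x (e₁ x) (Y x) := by
      conv_lhs => enter [1]; rw [hYsum]
      simp
    have horth' : S.g x (e₀ x) (J x (Y x)) * S.g x (e₀ x) (Y x) +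
        S.g x (e₁ x) (J x (Y x)) * S.g x (e₁ x) (Y x) = 0 := by
      rw [← horth]
      conv_rhs => enter [1]; rw [hJsum]
      simp
    have hr : h.frame.coeff 2 x (Z x) = S.g x (e₀ x) (Y x) * S.g x (e₁ x) (J x (Y x)) -
        S.g x (e₁ x) (Y x) * S.g x (e₀ x) (J x (Y x)) :=
      hZ2.trans (by simp only [hY0, hY1, hJ0, hJ1])
    have hr3 : h.frame.coeff 3 x (mlieBracket (𝓡 n) (field Y) Z x) = _ :=
      hc3.trans (congrArg₂ (· * ·) hY0 hr)
    have hr4 : h.frame.coeff 4 x (mlieBracket (𝓡 n) (field Y) Z x) = _ :=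
      hc4.trans (congrArg₂ (· * ·) hY1 hr)
    rw [h.phi_apply, hr3, hr4, hnorm]
    conv_rhs => rw [hJsum]
    set a := S.g x (e₀ x) (Y x)
    set b := S.g x (e₁ x) (Y x)
    set c := S.g x (e₀ x) (J x (Y x))
    set d := S.g x (e₁ x) (J x (Y x))
    have h1 : a * (a * d - b * c) = (a * a + b * b) * d := by linear_combination (-b) * horth'
    have h2 : b * (a * d - b * c) = - ((a * a + b * b) * c) := by linear_combination a * horth'
    rw [h1, h2]
    module

theorem IsPhiOn.eq_of_isOpen (hS : S.HasGrowthVector ![2, 3, 5]) (hU : IsOpen U)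
    {φ φ' : Π x : M, TangentSpace (𝓡 n) x →ₗ[ℝ] S.E x} (hφ : S.IsPhiOn U φ)
    (hφ' : S.IsPhiOn U φ') {x : M} (hx : x ∈ U) : φ x = φ' x := by
  obtain ⟨W, hW, hxW, e₀, e₁, h⟩ := exists_isOrthonormalOn hS x
  have h' := (h.mono (inter_subset_left (t := U))).isAdapted hS (hW.inter hU)
  rw [(hφ.mono inter_subset_right).eq_phi hS h' ⟨hxW, hx⟩,
    (hφ'.mono inter_subset_right).eq_phi hS h' ⟨hxW, hx⟩]

theorem isPhiOn_of_local {φ : Π x : M, TangentSpace (𝓡 n) x →ₗ[ℝ] S.E x}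
    (h : ∀ x ∈ U, ∃ W ⊆ U, IsOpen W ∧ x ∈ W ∧ ∃ φ', S.IsPhiOn W φ' ∧ ∀ y ∈ W, φ y = φ' y) :
    S.IsPhiOn U φ where
  smooth := by
    intro W' hW'U hW' X hX
    refine smoothFieldOn_of_local fun x hx => ?_
    obtain ⟨W, hWU, hW, hxW, φ', hφ', heq⟩ := h x (hW'U hx)
    refine ⟨W, hW, hxW, SmoothFieldOn.congr (hφ'.smooth (W' ∩ W) inter_subset_right (hW'.inter hW) X
      (hX.mono inter_subset_left)) fun y hy => ?_⟩
    exact congrArg (fun l : TangentSpace (𝓡 n) y →ₗ[ℝ] S.E y => (l (X y)).1) (heq y hy.2)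
  ker_eq := by
    intro x hx
    obtain ⟨W, hWU, hW, hxW, φ', hφ', heq⟩ := h x hx
    rw [heq x hxW, hφ'.ker_eq x hxW]
  bracket := by
    intro W' hW'U hW' J hJ X hX x hx
    obtain ⟨W, hWU, hW, hxW, φ', hφ', heq⟩ := h x (hW'U hx)
    rw [heq x hxW]
    exact hφ'.bracket (W' ∩ W) inter_subset_right (hW'.inter hW) J (hJ.mono inter_subset_left) X
      (hX.mono inter_subset_left) x ⟨hx, hxW⟩

theorem existsUnique_isPhi (hS : S.HasGrowthVector ![2, 3, 5]) :
    ∃! φ : Π x : M, TangentSpace (𝓡 n) x →ₗ[ℝ] S.E x, S.IsPhi φ := by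
  obtain ⟨φ, hφ⟩ := exists_of_locally_unique (P := S.IsPhiOn) (U := univ)
    (fun _ _ hWU h => h.mono hWU) (fun hU h h' x hx => h.eq_of_isOpen hS hU h' hx)
    (fun h => isPhiOn_of_local h) (fun x _ => by
      obtain ⟨W, hW, hxW, e₀, e₁, h⟩ := exists_isOrthonormalOn hS x
      exact ⟨W, subset_univ W, hW, hxW, _, (h.isAdapted hS hW).isPhiOn hS⟩)
  refine ⟨φ, isPhiOn_univ_iff.1 hφ, fun φ' hφ' => funext fun x => ?_⟩
  exact (isPhiOn_univ_iff.2 hφ').eq_of_isOpen hS isOpen_univ hφ (mem_univ x)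

end Structure

end

/-! ### Gradings and their one-forms θ -/

section

section ThreeSummands

variable {T : Type*} [AddCommGroup T] [Module ℝ T] {V : Fin 3 → Submodule ℝ T}

theorem isInternal_fin_three_iff : DirectSum.IsInternal V ↔
    (∀ v₀ ∈ V 0, ∀ v₁ ∈ V 1, ∀ v₂ ∈ V 2, v₀ + v₁ + v₂ = 0 → v₀ = 0 ∧ v₁ = 0 ∧ v₂ = 0) ∧
    ∀ v, ∃ v₀ ∈ V 0, ∃ v₁ ∈ V 1, ∃ v₂ ∈ V 2, v = v₀ + v₁ + v₂ := by
  have hsup : ∀ v, v ∈ ⨆ i, V i ↔ ∃ v₀ ∈ V 0, ∃ v₁ ∈ V 1, ∃ v₂ ∈ V 2, v = v₀ + v₁ + v₂ := by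
    intro v
    have : ⨆ i, V i = V 0 ⊔ V 1 ⊔ V 2 := by
      apply le_antisymm
      · refine iSup_le fun i => ?_
        fin_cases i
        exacts [le_sup_left.trans le_sup_left, le_sup_right.trans le_sup_left, le_sup_right]
      · exact sup_le (sup_le (le_iSup V 0) (le_iSup V 1)) (le_iSup V 2)
    rw [this]
    simp only [Submodule.mem_sup]
    constructor
    · rintro ⟨_, ⟨a, ha, b, hb, rfl⟩, c, hc, rfl⟩
      exact ⟨a, ha, b, hb, c, hc, rfl⟩
    · rintro ⟨a, ha, b, hb, c, hc, rfl⟩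
      exact ⟨_, ⟨a, ha, b, hb, rfl⟩, c, hc, rfl⟩
  have hmem : ∀ (i j k : Fin 3), j ≠ i → k ≠ i → ∀ a ∈ V j, ∀ b ∈ V k,
      a + b ∈ ⨆ l, ⨆ (_ : l ≠ i), V l := by
    intro i j k hj hk a ha b hb
    exact Submodule.add_mem _ (Submodule.mem_iSup_of_mem j (Submodule.mem_iSup_of_mem hj ha))
      (Submodule.mem_iSup_of_mem k (Submodule.mem_iSup_of_mem hk hb))
  have hle : ∀ (i j k : Fin 3), (∀ l, l ≠ i → l = j ∨ l = k) →
      ⨆ l, ⨆ (_ : l ≠ i), V l ≤ V j ⊔ V k := by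
    intro i j k h
    refine iSup₂_le fun l hl => ?_
    rcases h l hl with rfl | rfl
    exacts [le_sup_left, le_sup_right]
  rw [DirectSum.isInternal_submodule_iff_iSupIndep_and_iSup_eq_top]
  refine and_congr ?_ ?_
  · rw [iSupIndep_def]
    constructor
    · intro h v₀ h₀ v₁ h₁ v₂ h₂ hsum
      have key : ∀ i j k : Fin 3, j ≠ i → k ≠ i → ∀ a ∈ V i, ∀ b ∈ V j, ∀ c ∈ V k,
          a + (b + c) = 0 → a = 0 := by
        intro i j k hj hk a ha b hb c hc habc
        refine (Submodule.disjoint_def.1 (h i)) a ha ?_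
        rw [eq_neg_of_add_eq_zero_left habc]
        exact Submodule.neg_mem _ (hmem i j k hj hk b hb c hc)
      refine ⟨key 0 1 2 (by decide) (by decide) _ h₀ _ h₁ _ h₂ (by rw [← hsum]; abel),
        key 1 0 2 (by decide) (by decide) _ h₁ _ h₀ _ h₂ (by rw [← hsum]; abel),
        key 2 0 1 (by decide) (by decide) _ h₂ _ h₀ _ h₁ (by rw [← hsum]; abel)⟩
    · intro h i
      rw [Submodule.disjoint_def]
      intro v hv hv'
      fin_cases i
      · obtain ⟨a, ha, b, hb, hab⟩ := Submodule.mem_sup.1 (hle 0 1 2 (by decide) hv')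
        have := (h v hv (-a) (Submodule.neg_mem _ ha) (-b) (Submodule.neg_mem _ hb)
          (by rw [← hab]; abel)).1
        exact this
      · obtain ⟨a, ha, b, hb, hab⟩ := Submodule.mem_sup.1 (hle 1 0 2 (by decide) hv')
        have := (h (-a) (Submodule.neg_mem _ ha) v hv (-b) (Submodule.neg_mem _ hb)
          (by rw [← hab]; abel)).2.1
        exact this
      · obtain ⟨a, ha, b, hb, hab⟩ := Submodule.mem_sup.1 (hle 2 0 1 (by decide) hv')
        have := (h (-a) (Submodule.neg_mem _ ha) (-b) (Submodule.neg_mem _ hb) v hv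
          (by rw [← hab]; abel)).2.2
        exact this
  · rw [Submodule.eq_top_iff']
    exact forall_congr' hsup

theorem iSup_lt_one : ⨆ i : {i : Fin 3 // (i : ℕ) < 1}, V i = V 0 := by
  apply le_antisymm
  · refine iSup_le ?_
    rintro ⟨i, hi⟩
    fin_cases i
    · exact le_rfl
    all_goals exact absurd hi (by decide)
  · exact le_iSup (fun i : {i : Fin 3 // (i : ℕ) < 1} => V i) ⟨0, by decide⟩

theorem iSup_lt_two : ⨆ i : {i : Fin 3 // (i : ℕ) < 2}, V i = V 0 ⊔ V 1 := by
  apply le_antisymm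
  · refine iSup_le ?_
    rintro ⟨i, hi⟩
    fin_cases i
    · exact le_sup_left
    · exact le_sup_right
    · exact absurd hi (by decide)
  · exact sup_le (le_iSup (fun i : {i : Fin 3 // (i : ℕ) < 2} => V i) ⟨0, by decide⟩)
      (le_iSup (fun i : {i : Fin 3 // (i : ℕ) < 2} => V i) ⟨1, by decide⟩)

theorem iSup_lt_three : ⨆ i : {i : Fin 3 // (i : ℕ) < 3}, V i = ⨆ i, V i :=
  le_antisymm (iSup_le fun i => le_iSup V i)
    (iSup_le fun i => le_iSup (fun i : {i : Fin 3 // (i : ℕ) < 3} => V i) ⟨i, i.2⟩)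

end ThreeSummands

variable {n : ℕ} {M : Type*} [TopologicalSpace M] [ChartedSpace (EuclideanSpace ℝ (Fin n)) M]
  [IsManifold (𝓡 n) ∞ M]

theorem IsSubbundleOn.mono {U W : Set M} {F : Π x : M, Submodule ℝ (TangentSpace (𝓡 n) x)}
    {r : ℕ} (h : IsSubbundleOn U F r) (hW : IsOpen W) (hWU : W ⊆ U) : IsSubbundleOn W F r := by
  intro x hx
  obtain ⟨W', hW', hxW', -, X, hX, hspan⟩ := h x (hWU hx)
  exact ⟨W ∩ W', hW.inter hW', ⟨hx, hxW'⟩, inter_subset_left, X,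
    fun i => (hX i).mono inter_subset_right, fun y hy => hspan y hy.2⟩

namespace Structure

variable {S : Structure n M} {U W : Set M} {e₀ e₁ : Π y : M, S.E y}
  {V : Fin 3 → Π x : M, Submodule ℝ (TangentSpace (𝓡 n) x)}
  {J : Π x : M, S.E x →ₗ[ℝ] S.E x}

theorem IsGradingOn.mono (h : S.IsGradingOn U V) (hW : IsOpen W) (hWU : W ⊆ U) :
    S.IsGradingOn W V :=
  ⟨fun i => (h.1 i).imp fun _ hr => hr.mono hW hWU, fun x hx => h.2 x (hWU hx),
    fun x hx => h.3 x (hWU hx)⟩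

theorem IsGradingOn.eq_E (h : S.IsGradingOn U V) {x : M} (hx : x ∈ U) : V 0 x = S.E x := by
  rw [← S.flag_one x, h.flag_eq x hx 1 (by norm_num)]
  exact (iSup_lt_one (V := fun i => V i x)).symm

theorem IsGradingOn.flag_two (h : S.IsGradingOn U V) {x : M} (hx : x ∈ U) :
    S.flag 2 x = V 0 x ⊔ V 1 x := by
  rw [h.flag_eq x hx 2 (by norm_num)]
  exact iSup_lt_two (V := fun i => V i x)

theorem IsGradingOn.eq_zero (h : S.IsGradingOn U V) {x : M} (hx : x ∈ U)
    {v₀ v₁ v₂ : TangentSpace (𝓡 n) x} (h₀ : v₀ ∈ V 0 x) (h₁ : v₁ ∈ V 1 x) (h₂ : v₂ ∈ V 2 x)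
    (hsum : v₀ + v₁ + v₂ = 0) : v₀ = 0 ∧ v₁ = 0 ∧ v₂ = 0 :=
  (isInternal_fin_three_iff.1 (h.isInternal x hx)).1 v₀ h₀ v₁ h₁ v₂ h₂ hsum

theorem IsGradingOn.exists_add (h : S.IsGradingOn U V) {x : M} (hx : x ∈ U)
    (v : TangentSpace (𝓡 n) x) : ∃ v₀ ∈ V 0 x, ∃ v₁ ∈ V 1 x, ∃ v₂ ∈ V 2 x, v = v₀ + v₁ + v₂ :=
  (isInternal_fin_three_iff.1 (h.isInternal x hx)).2 v

theorem IsThetaOn.mono {θ : Π x : M, TangentSpace (𝓡 n) x [⋀^Fin 1]→L[ℝ] ℝ}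
    (h : S.IsThetaOn U J V θ) (hWU : W ⊆ U) : S.IsThetaOn W J V θ :=
  ⟨h.1.mono hWU, fun x hx => h.2 x (hWU hx), fun x hx => h.3 x (hWU hx)⟩

theorem IsThetaOn.apply_E {θ : Π x : M, TangentSpace (𝓡 n) x [⋀^Fin 1]→L[ℝ] ℝ}
    (hV : S.IsGradingOn U V) (h : S.IsThetaOn U J V θ) {x : M} (hx : x ∈ U)
    {u : TangentSpace (𝓡 n) x} (hu : u ∈ S.E x) : θ x ![u] = 0 := by
  rw [← hV.eq_E hx] at hu
  exact (h.ker_eq x hx u).2 (Submodule.mem_sup_right hu)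

theorem IsAdapted.mem_zero (_h : S.IsAdapted W e₀ e₁) (x : M) : derivedFrame e₀ e₁ 0 x ∈ S.E x :=
  (e₀ x).2

theorem IsAdapted.mem_one (_h : S.IsAdapted W e₀ e₁) (x : M) : derivedFrame e₀ e₁ 1 x ∈ S.E x :=
  (e₁ x).2

/-- The form annihilates X₀ and X₁, so only the term of [X₀, X₁] = X₂ is left. The normalization of
θ thereby becomes a condition on its value at X₂. -/
theorem IsAdapted.mextDeriv_horizontal (h : S.IsAdapted W e₀ e₁)
    {α : Π x : M, TangentSpace (𝓡 n) x [⋀^Fin 1]→L[ℝ] ℝ} (hα : SmoothFormOn W α)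
    (hE : ∀ x ∈ W, ∀ u ∈ S.E x, α x ![u] = 0) {x : M} (hx : x ∈ W) :
    bilin (mextDeriv α x) (derivedFrame e₀ e₁ 0 x) (derivedFrame e₀ e₁ 1 x) =
      - α x ![derivedFrame e₀ e₁ 2 x] := by
  have h1 := hα.apply_mlieBracket h.isOpen (h.frame.contMDiffOn 0) (h.frame.contMDiffOn 1) hx
    (fun y hy => hE y hy _ (h.mem_zero y)) (fun y hy => hE y hy _ (h.mem_one y))
  rw [bilin_apply, ← neg_eq_iff_eq_neg]
  exact h1.symm

/-- The normalization of `θ` in terms of an adapted frame. -/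
theorem IsAdapted.mextDeriv_eq_metric (hS : S.HasGrowthVector ![2, 3, 5])
    (h : S.IsAdapted W e₀ e₁) (hJ : ∀ y ∈ W, J y = S.rotation e₀ e₁ y)
    {α : Π x : M, TangentSpace (𝓡 n) x [⋀^Fin 1]→L[ℝ] ℝ} (hα : SmoothFormOn W α)
    (hE : ∀ x ∈ W, ∀ u ∈ S.E x, α x ![u] = 0) {x : M} (hx : x ∈ W)
    (h2 : α x ![derivedFrame e₀ e₁ 2 x] = 1) (u v : S.E x) :
    mextDeriv α x ![(u : TangentSpace (𝓡 n) x), (v : TangentSpace (𝓡 n) x)] =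
      S.g x u (J x v) := by
  have h01 := h.mextDeriv_horizontal hα hE hx
  rw [h2] at h01
  have hu : (u : TangentSpace (𝓡 n) x) = S.g x (e₀ x) u • derivedFrame e₀ e₁ 0 x +
      S.g x (e₁ x) u • derivedFrame e₀ e₁ 1 x := congrArg Subtype.val (h.eq_sum hS hx u)
  have hv : (v : TangentSpace (𝓡 n) x) = S.g x (e₀ x) v • derivedFrame e₀ e₁ 0 x +
      S.g x (e₁ x) v • derivedFrame e₀ e₁ 1 x := congrArg Subtype.val (h.eq_sum hS hx v)
  rw [← bilin_apply, hu, hv, hJ x hx, rotation_apply]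
  simp only [map_add, map_sub, map_smul, LinearMap.add_apply, LinearMap.smul_apply, bilin_self,
    smul_eq_mul, bilin_swap _ (derivedFrame e₀ e₁ 1 x) (derivedFrame e₀ e₁ 0 x), h01,
    S.symm x u (e₀ x), S.symm x u (e₁ x)]
  ring

/-- Two signs cancel: −θ(X₂) = dθ(X₀, X₁) = ⟨e₀, J e₁⟩ = −1. -/
theorem IsThetaOn.apply_two {θ : Π x : M, TangentSpace (𝓡 n) x [⋀^Fin 1]→L[ℝ] ℝ}
    (h : S.IsAdapted W e₀ e₁) (hJ : ∀ y ∈ W, J y = S.rotation e₀ e₁ y)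
    (hV : S.IsGradingOn W V) (hθ : S.IsThetaOn W J V θ) {x : M} (hx : x ∈ W) :
    θ x ![derivedFrame e₀ e₁ 2 x] = 1 := by
  have h1 := h.mextDeriv_horizontal hθ.smooth (fun y hy u hu => hθ.apply_E hV hy hu) hx
  have h2 := hθ.normalized x hx (e₀ x) (e₁ x)
  rw [hJ x hx, rotation_e₁ h.toIsOrthonormalOn hx, map_neg, h.norm₀ x hx] at h2
  rw [bilin_apply] at h1
  have h3 := h1.symm.trans h2
  linarith

theorem IsThetaOn.apply_flag_two {θ : Π x : M, TangentSpace (𝓡 n) x [⋀^Fin 1]→L[ℝ] ℝ}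
    (h : S.IsAdapted W e₀ e₁) (hJ : ∀ y ∈ W, J y = S.rotation e₀ e₁ y)
    (hV : S.IsGradingOn W V) (hθ : S.IsThetaOn W J V θ) {x : M} (hx : x ∈ W)
    {v : TangentSpace (𝓡 n) x} (hv : v ∈ S.flag 2 x) : θ x ![v] = h.frame.coeff 2 x v := by
  obtain ⟨a, b, c, rfl⟩ := (h.mem_flag_two x hx v).1 hv
  simp only [oneForm_add, oneForm_smul, hθ.apply_E hV hx (h.mem_zero x),
    hθ.apply_E hV hx (h.mem_one x), hθ.apply_two h hJ hV hx]
  simp [coeff_frame h.frame hx]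

/-- The values on the three summands are prescribed: zero on `V 0` and `V 2`, and ξ² on `V 1`, which
lies in E⁻². -/
theorem IsThetaOn.eq_of_isAdapted {θ θ' : Π x : M, TangentSpace (𝓡 n) x [⋀^Fin 1]→L[ℝ] ℝ}
    (h : S.IsAdapted W e₀ e₁) (hJ : ∀ y ∈ W, J y = S.rotation e₀ e₁ y)
    (hV : S.IsGradingOn W V) (hθ : S.IsThetaOn W J V θ) (hθ' : S.IsThetaOn W J V θ') {x : M}
    (hx : x ∈ W) : θ x = θ' x := by
  refine oneForm_ext fun v => ?_
  obtain ⟨v₀, h₀, v₁, h₁, v₂, h₂, rfl⟩ := hV.exists_add hx v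
  have h1 : v₁ ∈ S.flag 2 x := by rw [hV.flag_two hx]; exact Submodule.mem_sup_right h₁
  rw [hV.eq_E hx] at h₀
  simp only [oneForm_add, hθ.apply_E hV hx h₀, hθ'.apply_E hV hx h₀,
    hθ.apply_flag_two h hJ hV hx h1, hθ'.apply_flag_two h hJ hV hx h1,
    (hθ.ker_eq x hx v₂).2 (Submodule.mem_sup_left h₂),
    (hθ'.ker_eq x hx v₂).2 (Submodule.mem_sup_left h₂)]

/-- Near each point of an oriented open set there is a positively oriented adapted frame. -/
theorem IsRotationOn.exists_isAdapted (hS : S.HasGrowthVector ![2, 3, 5]) (hU : IsOpen U)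
    (hJ : S.IsRotationOn U J) {x : M} (hx : x ∈ U) :
    ∃ W ⊆ U, IsOpen W ∧ x ∈ W ∧ ∃ e₀ e₁ : Π y : M, S.E y,
      S.IsAdapted W e₀ e₁ ∧ ∀ y ∈ W, J y = S.rotation e₀ e₁ y := by
  obtain ⟨W, hWU, hW, hxW, e₀, h⟩ := hJ.exists_isOrthonormalOn hS hU hx
  exact ⟨W, hWU, hW, hxW, e₀, _, h.isAdapted hS hW, fun y hy => hJ.eq_rotation hS hWU h hy⟩

theorem IsThetaOn.eq_of_isOpen {θ θ' : Π x : M, TangentSpace (𝓡 n) x [⋀^Fin 1]→L[ℝ] ℝ}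
    (hS : S.HasGrowthVector ![2, 3, 5]) (hU : IsOpen U) (hJ : S.IsRotationOn U J)
    (hV : S.IsGradingOn U V) (hθ : S.IsThetaOn U J V θ) (hθ' : S.IsThetaOn U J V θ') {x : M}
    (hx : x ∈ U) : θ x = θ' x := by
  obtain ⟨W, hWU, hW, hxW, e₀, e₁, h, hJe⟩ := hJ.exists_isAdapted hS hU hx
  exact (hθ.mono hWU).eq_of_isAdapted h hJe (hV.mono hW hWU) (hθ'.mono hWU) hxW

theorem IsThetaOn.congr {θ θ' : Π x : M, TangentSpace (𝓡 n) x [⋀^Fin 1]→L[ℝ] ℝ}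
    {V' : Fin 3 → Π x : M, Submodule ℝ (TangentSpace (𝓡 n) x)} (hU : IsOpen U)
    (hθ : S.IsThetaOn U J V θ) (heq : ∀ x ∈ U, θ' x = θ x) (hV : ∀ i, ∀ x ∈ U, V' i x = V i x) :
    S.IsThetaOn U J V' θ' where
  smooth := fun W hWU hW X hX => (hθ.smooth W hWU hW X hX).congr fun x hx => by
    rw [heq x (hWU hx)]
  ker_eq := fun x hx w => by rw [heq x hx, hV 2 x hx, hV 0 x hx, hθ.ker_eq x hx]
  normalized := fun x hx u v => by
    rw [mextDeriv_congr (β := θ) (by filter_upwards [hU.mem_nhds hx] with y hy using heq y hy),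
      hθ.normalized x hx]

theorem isThetaOn_of_local {θ : Π x : M, TangentSpace (𝓡 n) x [⋀^Fin 1]→L[ℝ] ℝ}
    (h : ∀ x ∈ U, ∃ W ⊆ U, IsOpen W ∧ x ∈ W ∧ ∃ θ', S.IsThetaOn W J V θ' ∧ ∀ y ∈ W, θ y = θ' y) :
    S.IsThetaOn U J V θ := by
  have h' : ∀ x ∈ U, ∃ W, IsOpen W ∧ x ∈ W ∧ S.IsThetaOn W J V θ := by
    intro x hx
    obtain ⟨W, hWU, hW, hxW, θ', hθ', heq⟩ := h x hx
    exact ⟨W, hW, hxW, hθ'.congr hW heq fun _ _ _ => rfl⟩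
  refine ⟨?_, fun x hx => ?_, fun x hx => ?_⟩
  · intro W hWU hW X hX
    refine contMDiffOn_of_locally_contMDiffOn fun x hx => ?_
    obtain ⟨W', hW', hxW', hθ⟩ := h' x (hWU hx)
    exact ⟨W', hW', hxW', hθ.smooth _ inter_subset_right (hW.inter hW') X
      fun i => (hX i).mono inter_subset_left⟩
  · obtain ⟨W', hW', hxW', hθ⟩ := h' x hx
    exact hθ.ker_eq x hxW'
  · obtain ⟨W', hW', hxW', hθ⟩ := h' x hx
    exact hθ.normalized x hxW'

/-- The fields X₀, X₁, X₂ span E⁻², so together with a local frame of `V 2` they form a frame of TM;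
θ is the form dual to X₂ in this frame. -/
theorem IsAdapted.exists_isThetaOn (hS : S.HasGrowthVector ![2, 3, 5]) (h : S.IsAdapted W e₀ e₁)
    (hJ : ∀ y ∈ W, J y = S.rotation e₀ e₁ y) (hV : S.IsGradingOn W V) {x : M} (hx : x ∈ W) :
    ∃ W' ⊆ W, IsOpen W' ∧ x ∈ W' ∧ ∃ θ, S.IsThetaOn W' J V θ := by
  classical
  obtain ⟨r, hr⟩ := hV.isSubbundle 2
  obtain ⟨W', hW', hxW', hW'W, B, hB, hspan⟩ := hr x hx
  let A : Fin 3 → Π y : M, TangentSpace (𝓡 n) y := fun i =>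
    derivedFrame e₀ e₁ (Fin.castLE (by norm_num) i)
  let X : Fin 3 ⊕ Fin r → Π y : M, TangentSpace (𝓡 n) y := Sum.elim A B
  have hX : ∀ y, (fun i => X i y) = Sum.elim (fun i => A i y) (fun i => B i y) := by
    intro y; funext i; rcases i with i | i <;> rfl
  have hA : ∀ y ∈ W', Submodule.span ℝ (range fun i => A i y) = V 0 y ⊔ V 1 y := by
    intro y hy
    rw [← hV.flag_two (hW'W hy)]
    ext v
    rw [h.mem_flag_two y (hW'W hy), Submodule.mem_span_range_iff_exists_fun]
    constructor
    · rintro ⟨c, rfl⟩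
      exact ⟨c 0, c 1, c 2, Fin.sum_univ_three _⟩
    · rintro ⟨a, b, c, rfl⟩
      exact ⟨![a, b, c], Fin.sum_univ_three _⟩
  have hs : IsLocalFrameOn (𝓡 n) (EuclideanSpace ℝ (Fin n)) ∞ X W' := by
    refine ⟨fun {y} hy => ?_, fun {y} hy => ?_, ?_⟩
    · rw [hX]
      have hAli : LinearIndependent ℝ (fun i => A i y) :=
        (h.frame.linearIndependent (hW'W hy)).comp _ (Fin.castLE_injective (by norm_num))
      refine hAli.sum_type (hspan y hy).1 ?_
      rw [(hspan y hy).2, hA y hy, Submodule.disjoint_def]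
      intro v hv hv2
      obtain ⟨v₀, h₀, v₁, h₁, rfl⟩ := Submodule.mem_sup.1 hv
      have := (hV.eq_zero (hW'W hy) h₀ h₁ (Submodule.neg_mem _ hv2) (by abel)).2.2
      exact neg_eq_zero.1 this
    · rw [hX, Sum.elim_range, Submodule.span_union, (hspan y hy).2, hA y hy]
      intro v _
      obtain ⟨v₀, h₀, v₁, h₁, v₂, h₂, rfl⟩ := hV.exists_add (hW'W hy) v
      exact Submodule.add_mem_sup (Submodule.add_mem_sup h₀ h₁) h₂
    · rintro (i | i)
      · exact (h.frame.contMDiffOn _).mono hW'W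
      · exact hB i
  have hE0 : ∀ y ∈ W', ∀ u ∈ S.E y, hs.coeff (Sum.inl 2) y u = 0 := by
    intro y hy u hu
    obtain ⟨a, b, rfl⟩ := (h.mem_E y (hW'W hy) u).1 hu
    have h0 := coeff_frame hs hy (Sum.inl 2) (Sum.inl 0)
    have h1 := coeff_frame hs hy (Sum.inl 2) (Sum.inl 1)
    change hs.coeff (Sum.inl 2) y (derivedFrame e₀ e₁ 0 y) = _ at h0
    change hs.coeff (Sum.inl 2) y (derivedFrame e₀ e₁ 1 y) = _ at h1
    rw [map_add, map_smul, map_smul, h0, h1]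
    simp
  have hV2 : ∀ y ∈ W', ∀ w ∈ V 2 y, hs.coeff (Sum.inl 2) y w = 0 := by
    intro y hy w hw
    rw [← (hspan y hy).2] at hw
    have hle : Submodule.span ℝ (range fun i => B i y) ≤
        LinearMap.ker (hs.coeff (Sum.inl 2) y) := by
      rw [Submodule.span_le]
      rintro _ ⟨i, rfl⟩
      have h0 := coeff_frame hs hy (Sum.inl 2) (Sum.inr i)
      rw [if_neg (by simp)] at h0
      exact h0
    exact hle hw
  have hθ : SmoothFormOn W' (oneForm (hs.coeff (Sum.inl 2))) :=
    smoothFormOn_oneForm fun _ hW'' hW''o _ hY => contMDiffOn_coeff hs hW' hW''o hW'' hY _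
  have h' : S.IsAdapted W' e₀ e₁ := (h.toIsOrthonormalOn.mono hW'W).isAdapted hS hW'
  refine ⟨W', hW'W, hW', hxW', oneForm (hs.coeff (Sum.inl 2)), hθ, ?_, ?_⟩
  · intro y hy w
    rw [oneForm_apply]
    constructor
    · intro hw
      rw [sum_coeff_smul hs hy w, Fintype.sum_sum_type, Fin.sum_univ_three, hw, zero_smul, add_zero]
      refine Submodule.add_mem _ (Submodule.mem_sup_right ?_) (Submodule.mem_sup_left ?_)
      · rw [hV.eq_E (hW'W hy)]
        exact Submodule.add_mem _ (Submodule.smul_mem _ _ (e₀ y).2)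
          (Submodule.smul_mem _ _ (e₁ y).2)
      · rw [← (hspan y hy).2]
        exact Submodule.sum_mem _ fun i _ => Submodule.smul_mem _ _
          (Submodule.subset_span ⟨i, rfl⟩)
    · intro hw
      obtain ⟨a, ha, b, hb, rfl⟩ := Submodule.mem_sup.1 hw
      rw [hV.eq_E (hW'W hy)] at hb
      rw [map_add, hE0 y hy b hb, hV2 y hy a ha, add_zero]
  · intro y hy u v
    refine h'.mextDeriv_eq_metric hS (fun z hz => hJ z (hW'W hz)) hθ
      (fun z hz w hw => hE0 z hz w hw) hy ?_ u v
    have h2 := coeff_frame hs hy (Sum.inl 2) (Sum.inl 2)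
    rw [if_pos rfl] at h2
    exact h2

theorem exists_isThetaOn (hS : S.HasGrowthVector ![2, 3, 5]) (hU : IsOpen U)
    (hJ : S.IsRotationOn U J) (hV : S.IsGradingOn U V) : ∃ θ, S.IsThetaOn U J V θ := by
  obtain ⟨θ, -, hθ⟩ := exists_of_locally_unique (U := U)
    (A := fun x => TangentSpace (𝓡 n) x [⋀^Fin 1]→L[ℝ] ℝ)
    -- The clause `W ⊆ U` is carried along because uniqueness of θ uses the grading and the
    -- rotation, which are given only over U.
    (P := fun W θ => W ⊆ U ∧ S.IsThetaOn W J V θ)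
    (fun _ _ hWU h => ⟨hWU.trans h.1, h.2.mono hWU⟩)
    (fun hW h h' x hx => h.2.eq_of_isOpen hS hW (hJ.mono h.1) (hV.mono hW h.1) h'.2 hx)
    (fun {W θ} h => ⟨fun x hx => by
        obtain ⟨W', -, -, hxW', θ', h', -⟩ := h x hx
        exact h'.1 hxW',
      isThetaOn_of_local fun x hx => by
        obtain ⟨W', hW'W, hW', hxW', θ', h', heq⟩ := h x hx
        exact ⟨W', hW'W, hW', hxW', θ', h'.2, heq⟩⟩)
    (fun x hx => by
      obtain ⟨W, hWU, hW, hxW, e₀, e₁, h, hJe⟩ := hJ.exists_isAdapted hS hU hx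
      obtain ⟨W', hW'W, hW', hxW', θ, hθ⟩ := h.exists_isThetaOn hS hJe (hV.mono hW hWU) hxW
      exact ⟨W', hW'W.trans hWU, hW', hxW', θ, hW'W.trans hWU, hθ⟩)
  exact ⟨θ, hθ⟩

end Structure

end

/-! ### Condition (i) in an adapted frame, and uniqueness of the grading -/

section

section AlternatingForms

variable {T : Type*} [AddCommGroup T] [Module ℝ T] [TopologicalSpace T]

theorem trilin_self_left (w : T [⋀^Fin 3]→L[ℝ] ℝ) (u v : T) : trilin w u u v = 0 :=
  w.map_eq_zero_of_eq _ (i := 0) (j := 1) rfl (by decide)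

theorem trilin_swap_left (w : T [⋀^Fin 3]→L[ℝ] ℝ) (u v v' : T) :
    trilin w u v v' = - trilin w v u v' := by
  have h := trilin_self_left w (u + v) v'
  simp only [map_add, LinearMap.add_apply, trilin_add, trilin_self_left] at h
  linarith

end AlternatingForms

variable {n : ℕ} {M : Type*} [TopologicalSpace M] [ChartedSpace (EuclideanSpace ℝ (Fin n)) M]
  [IsManifold (𝓡 n) ∞ M]

theorem mvfderiv_eq_zero_of_eventually_const {f : M → ℝ} {c : ℝ} {x : M}
    (h : ∀ᶠ y in 𝓝 x, f y = c) (v : TangentSpace (𝓡 n) x) : mvfderiv (𝓡 n) f x v = 0 := by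
  have h' : f =ᶠ[𝓝 x] fun _ => c := h
  rw [mvfderiv, h'.mfderiv_eq, mfderiv_const]
  rfl

namespace Structure

variable {S : Structure n M} {U W : Set M} {e₀ e₁ : Π y : M, S.E y}
  {V V' : Fin 3 → Π x : M, Submodule ℝ (TangentSpace (𝓡 n) x)}
  {J : Π x : M, S.E x →ₗ[ℝ] S.E x}
  {Ω : Π x : M, TangentSpace (𝓡 n) x [⋀^Fin 2]→L[ℝ] ℝ}
  {θ θ' : Π x : M, TangentSpace (𝓡 n) x [⋀^Fin 1]→L[ℝ] ℝ}

/-- Over `W`, the two-form `Ω` is the wedge product of the last two forms of the coframe dual to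
an adapted frame. -/
def IsAdapted.IsWedge (h : S.IsAdapted W e₀ e₁)
    (Ω : Π x : M, TangentSpace (𝓡 n) x [⋀^Fin 2]→L[ℝ] ℝ) : Prop :=
  ∀ x ∈ W, ∀ v w : TangentSpace (𝓡 n) x, bilin (Ω x) v w =
    h.frame.coeff 3 x v * h.frame.coeff 4 x w - h.frame.coeff 4 x v * h.frame.coeff 3 x w

theorem IsAdapted.IsWedge.smooth {h : S.IsAdapted W e₀ e₁} (hΩ : h.IsWedge Ω) :
    SmoothFormOn W Ω := by
  intro W' hW'W hW' X hX
  have h3 := fun i => contMDiffOn_coeff h.frame h.isOpen hW' hW'W (hX i) 3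
  have h4 := fun i => contMDiffOn_coeff h.frame h.isOpen hW' hW'W (hX i) 4
  refine (((h3 0).mul (h4 1)).sub ((h4 0).mul (h3 1))).congr fun x hx => ?_
  have e : (fun i => X i x) = ![X 0 x, X 1 x] := by funext i; fin_cases i <;> rfl
  rw [e]
  exact hΩ x (hW'W hx) (X 0 x) (X 1 x)

/-- The functions Ω(Xᵢ, Xⱼ) are constant, so the derivative terms of the invariant formula drop out.
-/
theorem IsAdapted.IsWedge.mextDeriv_frame {h : S.IsAdapted W e₀ e₁} (hΩ : h.IsWedge Ω) {x : M}
    (hx : x ∈ W) (i j k : Fin 5) :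
    trilin (mextDeriv Ω x) (derivedFrame e₀ e₁ i x) (derivedFrame e₀ e₁ j x)
        (derivedFrame e₀ e₁ k x) =
      - bilin (Ω x) (mlieBracket (𝓡 n) (derivedFrame e₀ e₁ i) (derivedFrame e₀ e₁ j) x)
          (derivedFrame e₀ e₁ k x)
      + bilin (Ω x) (mlieBracket (𝓡 n) (derivedFrame e₀ e₁ i) (derivedFrame e₀ e₁ k) x)
          (derivedFrame e₀ e₁ j x)
      - bilin (Ω x) (mlieBracket (𝓡 n) (derivedFrame e₀ e₁ j) (derivedFrame e₀ e₁ k) x)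
          (derivedFrame e₀ e₁ i x) := by
  have hc : ∀ a b : Fin 5, ∀ v : TangentSpace (𝓡 n) x, mvfderiv (𝓡 n)
      (fun y => Ω y ![derivedFrame e₀ e₁ a y, derivedFrame e₀ e₁ b y]) x v = 0 := by
    intro a b v
    refine mvfderiv_eq_zero_of_eventually_const (c := (if a = 3 then 1 else 0) *
      (if b = 4 then 1 else 0) - (if a = 4 then 1 else 0) * (if b = 3 then 1 else 0)) ?_ v
    filter_upwards [h.isOpen.mem_nhds hx] with y hy
    refine (hΩ y hy _ _).trans ?_
    simp only [coeff_frame h.frame hy]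
  have h1 := mextDeriv_twoForm h.isOpen hΩ.smooth (h.frame.contMDiffOn i) (h.frame.contMDiffOn j)
    (h.frame.contMDiffOn k) hx
  rw [hc, hc, hc] at h1
  simp only [trilin_apply, bilin_apply]
  rw [h1]
  ring

theorem IsAdapted.IsWedge.apply_frame {h : S.IsAdapted W e₀ e₁} (hΩ : h.IsWedge Ω) {x : M}
    (hx : x ∈ W) (v : TangentSpace (𝓡 n) x) (i : Fin 5) :
    bilin (Ω x) v (derivedFrame e₀ e₁ i x) = h.frame.coeff 3 x v * (if i = 4 then 1 else 0) -
      h.frame.coeff 4 x v * (if i = 3 then 1 else 0) := by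
  rw [hΩ x hx, coeff_frame h.frame hx, coeff_frame h.frame hx]

/-- Each of the three bracket terms contains X₀, X₁ or [X₀, X₁] = X₂, and Ω annihilates all of
these. -/
theorem IsAdapted.IsWedge.trilin_zero_one {h : S.IsAdapted W e₀ e₁} (hΩ : h.IsWedge Ω) {x : M}
    (hx : x ∈ W) (k : Fin 5) : trilin (mextDeriv Ω x) (derivedFrame e₀ e₁ 0 x)
      (derivedFrame e₀ e₁ 1 x) (derivedFrame e₀ e₁ k x) = 0 := by
  have h2 : mlieBracket (𝓡 n) (derivedFrame e₀ e₁ 0) (derivedFrame e₀ e₁ 1) x =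
      derivedFrame e₀ e₁ 2 x := rfl
  rw [hΩ.mextDeriv_frame hx, h2]
  simp only [hΩ.apply_frame hx, coeff_frame h.frame hx]
  simp

/-- Since Ω annihilates E⁻², only the brackets [X₀, X₂] = X₃ and [X₁, X₂] = X₄ matter, paired with
the last argument by ξ³ ∧ ξ⁴. -/
theorem IsAdapted.IsWedge.trilin_two {h : S.IsAdapted W e₀ e₁} (hΩ : h.IsWedge Ω) {x : M}
    (hx : x ∈ W) :
    (trilin (mextDeriv Ω x) (derivedFrame e₀ e₁ 0 x) (derivedFrame e₀ e₁ 2 x)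
      (derivedFrame e₀ e₁ 3 x) = 0 ∧
    trilin (mextDeriv Ω x) (derivedFrame e₀ e₁ 0 x) (derivedFrame e₀ e₁ 2 x)
      (derivedFrame e₀ e₁ 4 x) = -1) ∧
    trilin (mextDeriv Ω x) (derivedFrame e₀ e₁ 1 x) (derivedFrame e₀ e₁ 2 x)
      (derivedFrame e₀ e₁ 3 x) = 1 ∧
    trilin (mextDeriv Ω x) (derivedFrame e₀ e₁ 1 x) (derivedFrame e₀ e₁ 2 x)
      (derivedFrame e₀ e₁ 4 x) = 0 := by
  have h3 : mlieBracket (𝓡 n) (derivedFrame e₀ e₁ 0) (derivedFrame e₀ e₁ 2) x =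
      derivedFrame e₀ e₁ 3 x := rfl
  have h4 : mlieBracket (𝓡 n) (derivedFrame e₀ e₁ 1) (derivedFrame e₀ e₁ 2) x =
      derivedFrame e₀ e₁ 4 x := rfl
  simp only [hΩ.mextDeriv_frame hx, h3, h4, hΩ.apply_frame hx, coeff_frame h.frame hx]
  simp

/-- An alternating bilinear form which is degenerate along `E`, in an adapted frame. -/
theorem IsAdapted.trilin_eq (h : S.IsAdapted W e₀ e₁) {x : M} (hx : x ∈ W)
    {D : TangentSpace (𝓡 n) x [⋀^Fin 3]→L[ℝ] ℝ} {u : TangentSpace (𝓡 n) x}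
    (h0 : ∀ k, trilin D u (derivedFrame e₀ e₁ 0 x) (derivedFrame e₀ e₁ k x) = 0)
    (h1 : ∀ k, trilin D u (derivedFrame e₀ e₁ 1 x) (derivedFrame e₀ e₁ k x) = 0)
    (v w : TangentSpace (𝓡 n) x) : trilin D u v w =
      (h.frame.coeff 2 x v * h.frame.coeff 3 x w - h.frame.coeff 3 x v * h.frame.coeff 2 x w) *
        trilin D u (derivedFrame e₀ e₁ 2 x) (derivedFrame e₀ e₁ 3 x) +
      (h.frame.coeff 2 x v * h.frame.coeff 4 x w - h.frame.coeff 4 x v * h.frame.coeff 2 x w) *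
        trilin D u (derivedFrame e₀ e₁ 2 x) (derivedFrame e₀ e₁ 4 x) +
      (h.frame.coeff 3 x v * h.frame.coeff 4 x w - h.frame.coeff 4 x v * h.frame.coeff 3 x w) *
        trilin D u (derivedFrame e₀ e₁ 3 x) (derivedFrame e₀ e₁ 4 x) := by
  have h0' := fun k => (trilin_swap D u (derivedFrame e₀ e₁ k x) _).trans
    (neg_eq_zero.2 (h0 k))
  have h1' := fun k => (trilin_swap D u (derivedFrame e₀ e₁ k x) _).trans
    (neg_eq_zero.2 (h1 k))
  conv_lhs => rw [sum_coeff_smul h.frame hx v, sum_coeff_smul h.frame hx w]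
  rw [Fin.sum_univ_five, Fin.sum_univ_five]
  simp only [map_add, map_smul, LinearMap.add_apply, LinearMap.smul_apply, smul_eq_mul, h0, h1,
    h0', h1', trilin_self, trilin_swap D u (derivedFrame e₀ e₁ 3 x) (derivedFrame e₀ e₁ 2 x),
    trilin_swap D u (derivedFrame e₀ e₁ 4 x) (derivedFrame e₀ e₁ 2 x),
    trilin_swap D u (derivedFrame e₀ e₁ 4 x) (derivedFrame e₀ e₁ 3 x)]
  ring

/-- The components of `dΩ` along `X₀, X₃, X₄` and along `X₁, X₃, X₄`. -/
def torsion (Ω : Π x : M, TangentSpace (𝓡 n) x [⋀^Fin 2]→L[ℝ] ℝ) (e₀ e₁ : Π y : M, S.E y)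
    (i : Fin 5) (x : M) : ℝ :=
  trilin (mextDeriv Ω x) (derivedFrame e₀ e₁ i x) (derivedFrame e₀ e₁ 3 x)
    (derivedFrame e₀ e₁ 4 x)

theorem IsAdapted.IsWedge.smooth_torsion {h : S.IsAdapted W e₀ e₁} (hΩ : h.IsWedge Ω)
    (i : Fin 5) : ContMDiffOn (𝓡 n) 𝓘(ℝ, ℝ) ∞ (torsion Ω e₀ e₁ i) W := by
  have h1 := hΩ.smooth.mextDeriv W subset_rfl h.isOpen
    ![derivedFrame e₀ e₁ i, derivedFrame e₀ e₁ 3, derivedFrame e₀ e₁ 4] (by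
      intro j; fin_cases j
      exacts [h.frame.contMDiffOn i, h.frame.contMDiffOn 3, h.frame.contMDiffOn 4])
  refine h1.congr fun x _ => ?_
  refine congrArg (mextDeriv Ω x) ?_
  funext j
  fin_cases j <;> rfl

/-- The contractions of dΩ with X₀ and X₁ are t₀ ξ³∧ξ⁴ − ξ²∧ξ⁴ and t₁ ξ³∧ξ⁴ + ξ²∧ξ³. Condition (i)
thus becomes two linear equations for the X₂-components of vectors in `V 2`. -/
theorem IsAdapted.IsWedge.trilin_eq {h : S.IsAdapted W e₀ e₁} (hΩ : h.IsWedge Ω) {x : M}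
    (hx : x ∈ W) (v w : TangentSpace (𝓡 n) x) :
    trilin (mextDeriv Ω x) (derivedFrame e₀ e₁ 0 x) v w =
      (h.frame.coeff 3 x v * h.frame.coeff 4 x w - h.frame.coeff 4 x v * h.frame.coeff 3 x w) *
        torsion Ω e₀ e₁ 0 x -
      (h.frame.coeff 2 x v * h.frame.coeff 4 x w - h.frame.coeff 4 x v * h.frame.coeff 2 x w) ∧
    trilin (mextDeriv Ω x) (derivedFrame e₀ e₁ 1 x) v w =
      (h.frame.coeff 3 x v * h.frame.coeff 4 x w - h.frame.coeff 4 x v * h.frame.coeff 3 x w) *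
        torsion Ω e₀ e₁ 1 x +
      (h.frame.coeff 2 x v * h.frame.coeff 3 x w - h.frame.coeff 3 x v * h.frame.coeff 2 x w) := by
  obtain ⟨⟨h1, h2⟩, h3, h4⟩ := hΩ.trilin_two hx
  constructor
  · rw [h.trilin_eq hx (fun k => trilin_self_left _ _ _) (hΩ.trilin_zero_one hx), h1, h2, torsion]
    ring
  · rw [h.trilin_eq hx (fun k => by rw [trilin_swap_left, hΩ.trilin_zero_one hx, neg_zero])
      (fun k => trilin_self_left _ _ _), h3, h4, torsion]
    ring

/-- The one-form `θ` of a grading for which `Ω` is closed in the directions of the conditions is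
determined by `Ω`. -/
theorem IsThetaOn.apply_eq (h : S.IsAdapted W e₀ e₁) (hJ : ∀ y ∈ W, J y = S.rotation e₀ e₁ y)
    (hΩ : h.IsWedge Ω) (hV : S.IsGradingOn W V) (hθ : S.IsThetaOn W J V θ) {x : M} (hx : x ∈ W)
    (hI : ∀ u ∈ S.E x, ∀ w₁ ∈ V 2 x, ∀ w₂ ∈ V 2 x, mextDeriv Ω x ![u, w₁, w₂] = 0)
    (v : TangentSpace (𝓡 n) x) : θ x ![v] = h.frame.coeff 2 x v -
      torsion Ω e₀ e₁ 0 x * h.frame.coeff 3 x v - torsion Ω e₀ e₁ 1 x * h.frame.coeff 4 x v := by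
  have key : ∀ v : TangentSpace (𝓡 n) x, ∃ v' ∈ S.flag 2 x, ∃ v₂ ∈ V 2 x, v = v' + v₂ ∧
      θ x ![v] = h.frame.coeff 2 x v' := by
    intro v
    obtain ⟨v₀, h₀, v₁, h₁, v₂, h₂, hv⟩ := hV.exists_add hx v
    have h' : v₀ + v₁ ∈ S.flag 2 x := by
      rw [hV.flag_two hx]; exact Submodule.add_mem_sup h₀ h₁
    refine ⟨v₀ + v₁, h', v₂, h₂, hv, ?_⟩
    rw [hv, oneForm_add _ (v₀ + v₁), hθ.apply_flag_two h hJ hV hx h',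
      (hθ.ker_eq x hx v₂).2 (Submodule.mem_sup_left h₂), add_zero]
  -- Let a and b be the `V 2`-components of X₃ and X₄. Modulo E they are X₃ + ξ²(a) X₂ and X₄ +
  -- ξ²(b) X₂, and θ(X₃) = −ξ²(a), θ(X₄) = −ξ²(b). Condition (i) for the pair a, b gives ξ²(a) = t₀
  -- and ξ²(b) = t₁.
  obtain ⟨a', ha', a, ha, ha3, hθ3⟩ := key (derivedFrame e₀ e₁ 3 x)
  obtain ⟨b', hb', b, hb, hb4, hθ4⟩ := key (derivedFrame e₀ e₁ 4 x)
  have hca : ∀ i, (if (3 : Fin 5) = i then (1 : ℝ) else 0) =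
      h.frame.coeff i x a' + h.frame.coeff i x a := by
    intro i; rw [← coeff_frame h.frame hx, ha3, map_add]
  have hcb : ∀ i, (if (4 : Fin 5) = i then (1 : ℝ) else 0) =
      h.frame.coeff i x b' + h.frame.coeff i x b := by
    intro i; rw [← coeff_frame h.frame hx, hb4, map_add]
  obtain ⟨ha3', ha4'⟩ := (h.mem_flag_two_iff hx a').1 ha'
  obtain ⟨hb3', hb4'⟩ := (h.mem_flag_two_iff hx b').1 hb'
  have a2 := hca 2
  have a3 := hca 3
  have a4 := hca 4
  have b2 := hcb 2
  have b3 := hcb 3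
  have b4 := hcb 4
  rw [if_neg (by decide)] at a2 a4 b2 b3
  rw [if_pos rfl] at a3 b4
  rw [ha3', zero_add] at a3
  rw [ha4', zero_add] at a4
  rw [hb3', zero_add] at b3
  rw [hb4', zero_add] at b4
  obtain ⟨h0, h1⟩ := hΩ.trilin_eq hx a b
  have h0' : trilin (mextDeriv Ω x) (derivedFrame e₀ e₁ 0 x) a b = 0 :=
    hI _ (h.mem_zero x) a ha b hb
  have h1' : trilin (mextDeriv Ω x) (derivedFrame e₀ e₁ 1 x) a b = 0 :=
    hI _ (h.mem_one x) a ha b hb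
  rw [h0', ← a3, ← a4, ← b3, ← b4] at h0
  rw [h1', ← a3, ← a4, ← b3, ← b4] at h1
  have e3 : θ x ![derivedFrame e₀ e₁ 3 x] = - torsion Ω e₀ e₁ 0 x := by rw [hθ3]; linarith
  have e4 : θ x ![derivedFrame e₀ e₁ 4 x] = - torsion Ω e₀ e₁ 1 x := by rw [hθ4]; linarith
  conv_lhs => rw [sum_coeff_smul h.frame hx v, Fin.sum_univ_five]
  simp only [oneForm_add, oneForm_smul, e3, e4, hθ.apply_E hV hx (h.mem_zero x),
    hθ.apply_E hV hx (h.mem_one x), hθ.apply_two h hJ hV hx]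
  ring

/-- A grading is contained in another one with the same `θ` if both satisfy the second condition
with respect to it. -/
theorem IsGradingOn.le_of_theta (hV : S.IsGradingOn W V) (hV' : S.IsGradingOn W V') {x : M}
    (hx : x ∈ W) {l : TangentSpace (𝓡 n) x →ₗ[ℝ] ℝ}
    {B : TangentSpace (𝓡 n) x →ₗ[ℝ] TangentSpace (𝓡 n) x →ₗ[ℝ] ℝ}
    (hl : ∀ w, l w = 0 ↔ w ∈ V 2 x ⊔ V 0 x) (hl' : ∀ w ∈ V' 2 x, l w = 0)
    (hB : ∀ u ∈ S.E x, ∀ w ∈ V 1 x ⊔ V 2 x, B u w = 0)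
    (hB' : ∀ u ∈ S.E x, ∀ w ∈ V' 1 x ⊔ V' 2 x, B u w = 0)
    (hE : ∀ w ∈ S.E x, (∀ u ∈ S.E x, B u w = 0) → w = 0) (i : Fin 3) : V' i x ≤ V i x := by
  -- Both v and v₁ + v₂ are orthogonal to E for `B`, hence so is the E-component v₀, which vanishes
  -- by nondegeneracy.
  have hdec : ∀ v ∈ V' 1 x ⊔ V' 2 x, ∃ v₁ ∈ V 1 x, ∃ v₂ ∈ V 2 x, v = v₁ + v₂ := by
    intro v hv
    obtain ⟨v₀, h₀, v₁, h₁, v₂, h₂, rfl⟩ := hV.exists_add hx v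
    refine ⟨v₁, h₁, v₂, h₂, ?_⟩
    rw [hV.eq_E hx] at h₀
    have := hE v₀ h₀ fun u hu => by
      have h1 := hB' u hu _ hv
      have h2 := hB u hu _ (Submodule.add_mem_sup h₁ h₂)
      rw [add_assoc, map_add, h2, add_zero] at h1
      exact h1
    rw [this, zero_add]
  match i with
  | 0 => rw [hV.eq_E hx, hV'.eq_E hx]
  | 1 =>
    intro v hv
    obtain ⟨v₁, h₁, v₂, h₂, hsum⟩ := hdec v (Submodule.mem_sup_left hv)
    have hv2 : v ∈ S.flag 2 x := by rw [hV'.flag_two hx]; exact Submodule.mem_sup_right hv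
    rw [hV.flag_two hx] at hv2
    obtain ⟨a, ha, b, hb, hab⟩ := Submodule.mem_sup.1 hv2
    have := (hV.eq_zero hx ha (Submodule.sub_mem _ hb h₁) (Submodule.neg_mem _ h₂) (by
      rw [← sub_eq_zero] at hsum
      rw [← hsum, ← hab]; abel)).2.2
    rw [neg_eq_zero] at this
    rw [hsum, this, add_zero]
    exact h₁
  | 2 =>
    intro v hv
    obtain ⟨v₁, h₁, v₂, h₂, hsum⟩ := hdec v (Submodule.mem_sup_right hv)
    -- As `l` vanishes on v and v₂, it vanishes on v₁. So v₁ lies in both `V 1` and `V 2 ⊔ V 0`, and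
    -- must be zero.
    have h0 := hl' v hv
    rw [hsum, map_add, (hl v₂).2 (Submodule.mem_sup_left h₂), add_zero] at h0
    obtain ⟨a, ha, b, hb, hab⟩ := Submodule.mem_sup.1 ((hl v₁).1 h0)
    have := (hV.eq_zero hx (Submodule.neg_mem _ hb) h₁ (Submodule.neg_mem _ ha) (by
      rw [← hab]; abel)).2.1
    rw [hsum, this, zero_add]
    exact h₂

theorem IsAdapted.horizontal_nondegenerate (h : S.IsAdapted W e₀ e₁) {x : M} (hx : x ∈ W)
    {w : TangentSpace (𝓡 n) x [⋀^Fin 2]→L[ℝ] ℝ}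
    (h01 : bilin w (derivedFrame e₀ e₁ 0 x) (derivedFrame e₀ e₁ 1 x) = -1)
    {v : TangentSpace (𝓡 n) x} (hv : v ∈ S.E x) (h0 : ∀ u ∈ S.E x, bilin w u v = 0) : v = 0 := by
  obtain ⟨a, b, rfl⟩ := (h.mem_E x hx v).1 hv
  have h1 := h0 _ (h.mem_zero x)
  have h2 := h0 _ (h.mem_one x)
  simp only [map_add, map_smul, bilin_self, h01, smul_eq_mul,
    bilin_swap _ (derivedFrame e₀ e₁ 1 x) (derivedFrame e₀ e₁ 0 x)] at h1 h2
  have ha : a = 0 := by linarith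
  have hb : b = 0 := by linarith
  rw [ha, hb, zero_smul, zero_smul, add_zero]

/-- Condition (i) gives both gradings the same θ on all of W, hence the same dθ. Condition (ii) then
yields the inclusions of the summands in both directions. -/
theorem IsAdapted.grading_unique (h : S.IsAdapted W e₀ e₁)
    (hJ : ∀ y ∈ W, J y = S.rotation e₀ e₁ y) (hΩ : h.IsWedge Ω)
    (hV : S.IsGradingOn W V) (hV' : S.IsGradingOn W V')
    (hθ : S.IsThetaOn W J V θ) (hθ' : S.IsThetaOn W J V' θ')
    (hI : ∀ x ∈ W, ∀ u ∈ S.E x, ∀ w₁ ∈ V 2 x, ∀ w₂ ∈ V 2 x, mextDeriv Ω x ![u, w₁, w₂] = 0)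
    (hI' : ∀ x ∈ W, ∀ u ∈ S.E x, ∀ w₁ ∈ V' 2 x, ∀ w₂ ∈ V' 2 x, mextDeriv Ω x ![u, w₁, w₂] = 0)
    (hII : S.CondII W V θ) (hII' : S.CondII W V' θ') (i : Fin 3) {x : M} (hx : x ∈ W) :
    V i x = V' i x := by
  have heq : ∀ y ∈ W, θ y = θ' y := fun y hy => oneForm_ext fun v => by
    rw [hθ.apply_eq h hJ hΩ hV hy (hI y hy), hθ'.apply_eq h hJ hΩ hV' hy (hI' y hy)]
  have hd : mextDeriv θ x = mextDeriv θ' x :=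
    mextDeriv_congr (by filter_upwards [h.isOpen.mem_nhds hx] with y hy using heq y hy)
  have h01 := h.mextDeriv_horizontal hθ.smooth (fun y hy u hu => hθ.apply_E hV hy hu) hx
  rw [hθ.apply_two h hJ hV hx] at h01
  have hB : ∀ u ∈ S.E x, ∀ w ∈ V 1 x ⊔ V 2 x, bilin (mextDeriv θ x) u w = 0 := hII x hx
  have hB' : ∀ u ∈ S.E x, ∀ w ∈ V' 1 x ⊔ V' 2 x, bilin (mextDeriv θ x) u w = 0 := by
    rw [hd]; exact hII' x hx
  have hE := fun w (hw : w ∈ S.E x) => h.horizontal_nondegenerate hx h01 hw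
  have hl : ∀ w, lin (θ x) w = 0 ↔ w ∈ V 2 x ⊔ V 0 x := hθ.ker_eq x hx
  have hl' : ∀ w, lin (θ x) w = 0 ↔ w ∈ V' 2 x ⊔ V' 0 x := by
    rw [heq x hx]; exact hθ'.ker_eq x hx
  exact le_antisymm
    (hV'.le_of_theta hV hx hl' (fun w hw => (hl w).2 (Submodule.mem_sup_left hw)) hB' hB hE i)
    (hV.le_of_theta hV' hx hl (fun w hw => (hl' w).2 (Submodule.mem_sup_left hw)) hB hB' hE i)

end Structure

end

/-! ### Local existence of the canonical grading -/

section

variable {n : ℕ} {M : Type*} [TopologicalSpace M] [ChartedSpace (EuclideanSpace ℝ (Fin n)) M]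
  [IsManifold (𝓡 n) ∞ M]

theorem SmoothFormOn.bilin {W : Set M} (hW : IsOpen W)
    {α : Π x : M, TangentSpace (𝓡 n) x [⋀^Fin 2]→L[ℝ] ℝ} (hα : SmoothFormOn W α)
    {X Y : Π x : M, TangentSpace (𝓡 n) x} (hX : SmoothFieldOn W X) (hY : SmoothFieldOn W Y) :
    ContMDiffOn (𝓡 n) 𝓘(ℝ, ℝ) ∞ (fun x => bilin (α x) (X x) (Y x)) W := by
  refine (hα W subset_rfl hW ![X, Y] (by intro j; fin_cases j; exacts [hX, hY])).congr
    fun x _ => ?_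
  refine congrArg (α x) ?_
  funext j
  fin_cases j <;> rfl

namespace Structure

variable {S : Structure n M} {U W : Set M} {e₀ e₁ : Π y : M, S.E y}
  {V V' : Fin 3 → Π x : M, Submodule ℝ (TangentSpace (𝓡 n) x)}
  {J J' : Π x : M, S.E x →ₗ[ℝ] S.E x}
  {Ω Ω' : Π x : M, TangentSpace (𝓡 n) x [⋀^Fin 2]→L[ℝ] ℝ}
  {θ θ' : Π x : M, TangentSpace (𝓡 n) x [⋀^Fin 1]→L[ℝ] ℝ}

/-- Over `W`, the grading `V` satisfies both conditions, for the two-form `Ω` in the first one and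
the rotation `J` in the second one. -/
structure IsCanonicalOn (S : Structure n M) (W : Set M) (J : Π x : M, S.E x →ₗ[ℝ] S.E x)
    (Ω : Π x : M, TangentSpace (𝓡 n) x [⋀^Fin 2]→L[ℝ] ℝ)
    (V : Fin 3 → Π x : M, Submodule ℝ (TangentSpace (𝓡 n) x)) : Prop where
  isGradingOn : S.IsGradingOn W V
  closed : ∀ x ∈ W, ∀ u ∈ S.E x, ∀ w₁ ∈ V 2 x, ∀ w₂ ∈ V 2 x, mextDeriv Ω x ![u, w₁, w₂] = 0
  condII : ∀ θ, S.IsThetaOn W J V θ → S.CondII W V θ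

/-- The horizontal modification of `Z` which is orthogonal to `E` with respect to `dθ`. -/
def horizontalShift (θ : Π x : M, TangentSpace (𝓡 n) x [⋀^Fin 1]→L[ℝ] ℝ) (e₀ e₁ : Π y : M, S.E y)
    (Z : Π x : M, TangentSpace (𝓡 n) x) (x : M) : TangentSpace (𝓡 n) x :=
  Z x + (bilin (mextDeriv θ x) (Z x) (derivedFrame e₀ e₁ 1 x) • derivedFrame e₀ e₁ 0 x +
    bilin (mextDeriv θ x) (derivedFrame e₀ e₁ 0 x) (Z x) • derivedFrame e₀ e₁ 1 x)

theorem IsAdapted.smooth_horizontalShift (h : S.IsAdapted W e₀ e₁) (hθ : SmoothFormOn W θ)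
    {Z : Π x : M, TangentSpace (𝓡 n) x} (hZ : SmoothFieldOn W Z) :
    SmoothFieldOn W (horizontalShift θ e₀ e₁ Z) := by
  have h0 := h.frame.contMDiffOn 0
  have h1 := h.frame.contMDiffOn 1
  have hd := hθ.mextDeriv
  exact hZ.add ((SmoothFieldOn.smul (hd.bilin h.isOpen hZ h1) h0).add
    (SmoothFieldOn.smul (hd.bilin h.isOpen h0 hZ) h1))

/-- The shift is by a vector of E, which only ξ⁰ and ξ¹ see. Arranging condition (ii) therefore does
not disturb condition (i), which involves ξ², ξ³, ξ⁴ alone. -/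
theorem IsAdapted.coeff_horizontalShift (h : S.IsAdapted W e₀ e₁)
    (Z : Π x : M, TangentSpace (𝓡 n) x) {x : M} (hx : x ∈ W) (i : Fin 5) (hi : 2 ≤ i) :
    h.frame.coeff i x (horizontalShift θ e₀ e₁ Z x) = h.frame.coeff i x (Z x) := by
  have h0 : ¬ ((0 : Fin 5) = i) := by rintro rfl; exact absurd hi (by decide)
  have h1 : ¬ ((1 : Fin 5) = i) := by rintro rfl; exact absurd hi (by decide)
  simp only [horizontalShift, map_add, map_smul, coeff_frame h.frame hx, if_neg h0, if_neg h1,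
    smul_zero, add_zero]

/-- Because dθ(X₀, X₁) = −1, the two coefficients of the shift are exactly those that cancel dθ(X₀,
Z) and dθ(X₁, Z). -/
theorem IsAdapted.bilin_horizontalShift (h : S.IsAdapted W e₀ e₁)
    (Z : Π x : M, TangentSpace (𝓡 n) x) {x : M} (hx : x ∈ W)
    (h01 : bilin (mextDeriv θ x) (derivedFrame e₀ e₁ 0 x) (derivedFrame e₀ e₁ 1 x) = -1)
    {u : TangentSpace (𝓡 n) x} (hu : u ∈ S.E x) :
    bilin (mextDeriv θ x) u (horizontalShift θ e₀ e₁ Z x) = 0 := by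
  obtain ⟨a, b, rfl⟩ := (h.mem_E x hx u).1 hu
  simp only [horizontalShift, map_add, map_smul, LinearMap.add_apply, LinearMap.smul_apply,
    bilin_self, bilin_swap _ (Z x) (derivedFrame e₀ e₁ 1 x), h01, smul_eq_mul,
    bilin_swap _ (derivedFrame e₀ e₁ 1 x) (derivedFrame e₀ e₁ 0 x)]
  ring

/-- Local existence of the canonical grading. -/
theorem IsAdapted.exists_isCanonicalOn (hS : S.HasGrowthVector ![2, 3, 5])
    (h : S.IsAdapted W e₀ e₁) (hJ : ∀ y ∈ W, J y = S.rotation e₀ e₁ y) (hΩ : h.IsWedge Ω) :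
    ∃ V, (∀ i, IsSubbundleOn W (V i) (![2, 1, 2] i)) ∧ S.IsCanonicalOn W J Ω V := by
  let t₀ := torsion Ω e₀ e₁ 0
  let t₁ := torsion Ω e₀ e₁ 1
  have ht₀ : ContMDiffOn (𝓡 n) 𝓘(ℝ, ℝ) ∞ t₀ W := hΩ.smooth_torsion 0
  have ht₁ : ContMDiffOn (𝓡 n) 𝓘(ℝ, ℝ) ∞ t₁ W := hΩ.smooth_torsion 1
  -- The only θ compatible with condition (i), by `IsThetaOn.apply_eq`.
  let c : Fin 5 → M → ℝ := ![fun _ => 0, fun _ => 0, fun _ => 1, fun x => - t₀ x, fun x => - t₁ x]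
  have hc : ∀ i, ContMDiffOn (𝓡 n) 𝓘(ℝ, ℝ) ∞ (c i) W := by
    intro i
    fin_cases i
    exacts [contMDiffOn_const, contMDiffOn_const, contMDiffOn_const, ht₀.neg, ht₁.neg]
  let θ : Π x : M, TangentSpace (𝓡 n) x [⋀^Fin 1]→L[ℝ] ℝ :=
    oneForm fun x => ∑ i, c i x • h.frame.coeff i x
  have hθ : SmoothFormOn W θ := smoothFormOn_oneForm_coeff h.isOpen h.frame hc
  have hθv : ∀ x (v : TangentSpace (𝓡 n) x), θ x ![v] = h.frame.coeff 2 x v -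
      t₀ x * h.frame.coeff 3 x v - t₁ x * h.frame.coeff 4 x v := by
    intro x v
    change (∑ i, c i x • h.frame.coeff i x) v = _
    rw [Fin.sum_univ_five]
    change (0 : ℝ) * h.frame.coeff 0 x v + (0 : ℝ) * h.frame.coeff 1 x v +
      (1 : ℝ) * h.frame.coeff 2 x v + (- t₀ x) * h.frame.coeff 3 x v +
      (- t₁ x) * h.frame.coeff 4 x v = _
    ring
  have hθE : ∀ x ∈ W, ∀ u ∈ S.E x, θ x ![u] = 0 := by
    intro x hx u hu
    obtain ⟨h2, h3, h4⟩ := (h.mem_E_iff hx u).1 hu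
    rw [hθv, h2, h3, h4]
    ring
  have h01 : ∀ x ∈ W,
      bilin (mextDeriv θ x) (derivedFrame e₀ e₁ 0 x) (derivedFrame e₀ e₁ 1 x) = -1 := by
    intro x hx
    rw [h.mextDeriv_horizontal hθ hθE hx, hθv]
    simp only [coeff_frame h.frame hx]
    simp
  -- The last two fields lie in ker θ; the corrections by X₂ are those dictated by condition (i).
  let Z : Fin 3 → Π x : M, TangentSpace (𝓡 n) x := ![derivedFrame e₀ e₁ 2,
    fun x => derivedFrame e₀ e₁ 3 x + t₀ x • derivedFrame e₀ e₁ 2 x,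
    fun x => derivedFrame e₀ e₁ 4 x + t₁ x • derivedFrame e₀ e₁ 2 x]
  have hZ : ∀ i, SmoothFieldOn W (Z i) := by
    intro i
    fin_cases i
    exacts [h.frame.contMDiffOn 2,
      SmoothFieldOn.add (h.frame.contMDiffOn 3) (SmoothFieldOn.smul ht₀ (h.frame.contMDiffOn 2)),
      SmoothFieldOn.add (h.frame.contMDiffOn 4) (SmoothFieldOn.smul ht₁ (h.frame.contMDiffOn 2))]
  let Y : Fin 3 → Π x : M, TangentSpace (𝓡 n) x := fun i => horizontalShift θ e₀ e₁ (Z i)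
  have hY := fun i => h.smooth_horizontalShift hθ (hZ i)
  have hY0 : ∀ x ∈ W, h.frame.coeff 2 x (Y 0 x) = 1 ∧ h.frame.coeff 3 x (Y 0 x) = 0 ∧
      h.frame.coeff 4 x (Y 0 x) = 0 := by
    intro x hx
    simp only [Y, h.coeff_horizontalShift _ hx 2 le_rfl, h.coeff_horizontalShift _ hx 3 (by decide),
      h.coeff_horizontalShift _ hx 4 (by decide)]
    change h.frame.coeff 2 x (derivedFrame e₀ e₁ 2 x) = 1 ∧
      h.frame.coeff 3 x (derivedFrame e₀ e₁ 2 x) = 0 ∧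
      h.frame.coeff 4 x (derivedFrame e₀ e₁ 2 x) = 0
    simp [coeff_frame h.frame hx]
  have hY1 : ∀ x ∈ W, h.frame.coeff 2 x (Y 1 x) = t₀ x ∧ h.frame.coeff 3 x (Y 1 x) = 1 ∧
      h.frame.coeff 4 x (Y 1 x) = 0 := by
    intro x hx
    simp only [Y, h.coeff_horizontalShift _ hx 2 le_rfl, h.coeff_horizontalShift _ hx 3 (by decide),
      h.coeff_horizontalShift _ hx 4 (by decide)]
    change h.frame.coeff 2 x (derivedFrame e₀ e₁ 3 x + t₀ x • derivedFrame e₀ e₁ 2 x) = t₀ x ∧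
      h.frame.coeff 3 x (derivedFrame e₀ e₁ 3 x + t₀ x • derivedFrame e₀ e₁ 2 x) = 1 ∧
      h.frame.coeff 4 x (derivedFrame e₀ e₁ 3 x + t₀ x • derivedFrame e₀ e₁ 2 x) = 0
    simp [coeff_frame h.frame hx]
  have hY2 : ∀ x ∈ W, h.frame.coeff 2 x (Y 2 x) = t₁ x ∧ h.frame.coeff 3 x (Y 2 x) = 0 ∧
      h.frame.coeff 4 x (Y 2 x) = 1 := by
    intro x hx
    simp only [Y, h.coeff_horizontalShift _ hx 2 le_rfl, h.coeff_horizontalShift _ hx 3 (by decide),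
      h.coeff_horizontalShift _ hx 4 (by decide)]
    change h.frame.coeff 2 x (derivedFrame e₀ e₁ 4 x + t₁ x • derivedFrame e₀ e₁ 2 x) = t₁ x ∧
      h.frame.coeff 3 x (derivedFrame e₀ e₁ 4 x + t₁ x • derivedFrame e₀ e₁ 2 x) = 0 ∧
      h.frame.coeff 4 x (derivedFrame e₀ e₁ 4 x + t₁ x • derivedFrame e₀ e₁ 2 x) = 1
    simp [coeff_frame h.frame hx]
  let A : Fin 1 → Π x : M, TangentSpace (𝓡 n) x := ![Y 0]
  let B : Fin 2 → Π x : M, TangentSpace (𝓡 n) x := ![Y 1, Y 2]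
  let V : Fin 3 → Π x : M, Submodule ℝ (TangentSpace (𝓡 n) x) := ![S.E,
    fun x => Submodule.span ℝ (range fun i => A i x),
    fun x => Submodule.span ℝ (range fun i => B i x)]
  have hV1 : ∀ x (v : TangentSpace (𝓡 n) x), v ∈ V 1 x ↔ ∃ a : ℝ, v = a • Y 0 x := by
    intro x v
    change v ∈ Submodule.span ℝ (range fun i => A i x) ↔ _
    rw [Submodule.mem_span_range_iff_exists_fun]
    constructor
    · rintro ⟨c, rfl⟩
      exact ⟨c 0, Fin.sum_univ_one _⟩
    · rintro ⟨a, rfl⟩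
      exact ⟨![a], Fin.sum_univ_one _⟩
  have hV2 : ∀ x (v : TangentSpace (𝓡 n) x), v ∈ V 2 x ↔
      ∃ a b : ℝ, v = a • Y 1 x + b • Y 2 x := by
    intro x v
    change v ∈ Submodule.span ℝ (range fun i => B i x) ↔ _
    rw [Submodule.mem_span_range_iff_exists_fun]
    constructor
    · rintro ⟨c, rfl⟩
      exact ⟨c 0, c 1, Fin.sum_univ_two _⟩
    · rintro ⟨a, b, rfl⟩
      exact ⟨![a, b], Fin.sum_univ_two _⟩
  have hlin : ∀ x ∈ W, ∀ v₀ ∈ S.E x, ∀ a b c : ℝ,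
      v₀ + a • Y 0 x + (b • Y 1 x + c • Y 2 x) = 0 → v₀ = 0 ∧ a = 0 ∧ b = 0 ∧ c = 0 := by
    intro x hx v₀ hv₀ a b c hsum
    obtain ⟨h2, h3, h4⟩ := (h.mem_E_iff hx v₀).1 hv₀
    have k2 := congrArg (h.frame.coeff 2 x) hsum
    have k3 := congrArg (h.frame.coeff 3 x) hsum
    have k4 := congrArg (h.frame.coeff 4 x) hsum
    simp only [map_add, map_smul, map_zero, smul_eq_mul, hY0 x hx, hY1 x hx, hY2 x hx, h2, h3,
      h4] at k2 k3 k4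
    have hc : c = 0 := by linarith
    have hb : b = 0 := by linarith
    have ha : a = 0 := by rw [hb, hc] at k2; linarith
    refine ⟨?_, ha, hb, hc⟩
    rw [← hsum, ha, hb, hc]
    module
  -- The coefficient of `Y 0` is θ(v), since `Y 1` and `Y 2` lie in ker θ and θ(`Y 0`) = 1.
  have hdec : ∀ x ∈ W, ∀ v : TangentSpace (𝓡 n) x, v - (h.frame.coeff 2 x v -
      t₀ x * h.frame.coeff 3 x v - t₁ x * h.frame.coeff 4 x v) • Y 0 x -
      (h.frame.coeff 3 x v • Y 1 x + h.frame.coeff 4 x v • Y 2 x) ∈ S.E x := by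
    intro x hx v
    rw [h.mem_E_iff hx]
    simp only [map_sub, map_add, map_smul, smul_eq_mul, hY0 x hx, hY1 x hx, hY2 x hx]
    refine ⟨?_, ?_, ?_⟩ <;> ring
  have hrank : ∀ i, IsSubbundleOn W (V i) (![2, 1, 2] i) := by
    intro i
    match i with
    | 0 =>
      have h1 := hS.1 0
      have h2 : S.flag (((0 : Fin 3) : ℕ) + 1) = S.E := funext fun x => S.flag_one x
      rw [h2] at h1
      exact h1.mono h.isOpen (subset_univ W)
    | 1 =>
      change IsSubbundleOn W (V 1) 1
      intro x hx
      refine ⟨W, h.isOpen, hx, subset_rfl, A, fun j => ?_, fun y hy => ⟨?_, rfl⟩⟩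
      · fin_cases j; exact hY 0
      · rw [Fintype.linearIndependent_iff]
        intro g hg j
        have hg' : g 0 • Y 0 y = 0 := (Fin.sum_univ_one _).symm.trans hg
        have := (hlin y hy 0 (Submodule.zero_mem _) (g 0) 0 0 (by rw [hg']; module)).2.1
        fin_cases j; exact this
    | 2 =>
      change IsSubbundleOn W (V 2) 2
      intro x hx
      refine ⟨W, h.isOpen, hx, subset_rfl, B, fun j => ?_, fun y hy => ⟨?_, rfl⟩⟩
      · fin_cases j
        exacts [hY 1, hY 2]
      · rw [Fintype.linearIndependent_iff]
        intro g hg j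
        have hg' : g 0 • Y 1 y + g 1 • Y 2 y = 0 := (Fin.sum_univ_two _).symm.trans hg
        have := (hlin y hy 0 (Submodule.zero_mem _) 0 (g 0) (g 1) (by rw [hg']; module)).2.2
        fin_cases j
        exacts [this.1, this.2]
  have hgrad : S.IsGradingOn W V := by
    refine ⟨fun i => ⟨_, hrank i⟩, fun x hx => isInternal_fin_three_iff.2 ⟨?_, ?_⟩, ?_⟩
    · intro v₀ h₀ v₁ h₁ v₂ h₂ hsum
      obtain ⟨a, rfl⟩ := (hV1 x v₁).1 h₁
      obtain ⟨b, c, rfl⟩ := (hV2 x v₂).1 h₂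
      obtain ⟨r0, ra, rb, rc⟩ := hlin x hx v₀ h₀ a b c hsum
      refine ⟨r0, ?_, ?_⟩
      · rw [ra, zero_smul]
      · rw [rb, rc, zero_smul, zero_smul, add_zero]
    · intro v
      exact ⟨_, hdec x hx v, _, (hV1 x _).2 ⟨_, rfl⟩, _, (hV2 x _).2 ⟨_, _, rfl⟩, by abel⟩
    · intro x hx k hk
      match k, hk with
      | 0, _ =>
        rw [S.flag_zero]
        refine (iSup_eq_bot.2 fun i => absurd i.2 (Nat.not_lt_zero _)).symm
      | 1, _ =>
        rw [S.flag_one]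
        exact (iSup_lt_one (V := fun i => V i x)).symm
      | 2, _ =>
        refine Eq.trans ?_ (iSup_lt_two (V := fun i => V i x)).symm
        ext v
        rw [h.mem_flag_two_iff hx, Submodule.mem_sup]
        constructor
        · rintro ⟨h3, h4⟩
          refine ⟨_, hdec x hx v, _, (hV1 x _).2 ⟨h.frame.coeff 2 x v, rfl⟩, ?_⟩
          rw [h3, h4]
          module
        · rintro ⟨v₀, h₀, v₁, h₁, rfl⟩
          obtain ⟨a, rfl⟩ := (hV1 x v₁).1 h₁
          obtain ⟨-, h3, h4⟩ := (h.mem_E_iff hx v₀).1 h₀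
          simp only [map_add, map_smul, hY0 x hx, h3, h4]
          simp
      | 3, _ =>
        rw [hS.2.1 x]
        refine (((iSup_lt_three (V := fun i => V i x))).trans ?_).symm
        rw [eq_top_iff]
        intro v _
        have hv : v = (v - (h.frame.coeff 2 x v - t₀ x * h.frame.coeff 3 x v -
          t₁ x * h.frame.coeff 4 x v) • Y 0 x -
          (h.frame.coeff 3 x v • Y 1 x + h.frame.coeff 4 x v • Y 2 x)) +
          (h.frame.coeff 2 x v - t₀ x * h.frame.coeff 3 x v -
          t₁ x * h.frame.coeff 4 x v) • Y 0 x +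
          (h.frame.coeff 3 x v • Y 1 x + h.frame.coeff 4 x v • Y 2 x) := by abel
        rw [hv]
        exact Submodule.add_mem _ (Submodule.add_mem _
          (Submodule.mem_iSup_of_mem 0 (hdec x hx v))
          (Submodule.mem_iSup_of_mem 1 ((hV1 x _).2 ⟨_, rfl⟩)))
          (Submodule.mem_iSup_of_mem 2 ((hV2 x _).2 ⟨_, _, rfl⟩))
  have hclosed : ∀ x ∈ W, ∀ u ∈ S.E x, ∀ w₁ ∈ V 2 x, ∀ w₂ ∈ V 2 x,
      mextDeriv Ω x ![u, w₁, w₂] = 0 := by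
    intro x hx u hu w₁ hw₁ w₂ hw₂
    obtain ⟨a, b, rfl⟩ := (h.mem_E x hx u).1 hu
    obtain ⟨p, q, rfl⟩ := (hV2 x w₁).1 hw₁
    obtain ⟨r, s, rfl⟩ := (hV2 x w₂).1 hw₂
    obtain ⟨h0, h1⟩ := hΩ.trilin_eq hx (p • Y 1 x + q • Y 2 x) (r • Y 1 x + s • Y 2 x)
    rw [← trilin_apply, trilin_add, trilin_smul, trilin_smul, h0, h1]
    simp only [map_add, map_smul, smul_eq_mul, hY1 x hx, hY2 x hx]
    change a * (_ * t₀ x - _) + b * (_ * t₁ x + _) = 0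
    ring
  refine ⟨V, hrank, hgrad, hclosed, fun θ' hθ' x hx u hu w hw => ?_⟩
  -- The grading was built from the explicit θ, but condition (ii) concerns any form θ' belonging to
  -- it. Condition (i), already established, forces θ' = θ over W.
  have hd : mextDeriv θ' x = mextDeriv θ x :=
    mextDeriv_congr (by
      filter_upwards [h.isOpen.mem_nhds hx] with y hy
      exact oneForm_ext fun v => (hθ'.apply_eq h hJ hΩ hgrad hy (hclosed y hy) v).trans
        (hθv y v).symm)
  rw [hd, ← bilin_apply]
  have hYu := fun i => h.bilin_horizontalShift (Z i) hx (h01 x hx) hu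
  obtain ⟨v₁, h₁, v₂, h₂, rfl⟩ := Submodule.mem_sup.1 hw
  obtain ⟨a, rfl⟩ := (hV1 x v₁).1 h₁
  obtain ⟨b, c, rfl⟩ := (hV2 x v₂).1 h₂
  simp only [map_add, map_smul, Y, hYu, smul_zero, add_zero]

end Structure

end

/-! ### Change of orientation and globalization -/

section

variable {n : ℕ} {M : Type*} [TopologicalSpace M] [ChartedSpace (EuclideanSpace ℝ (Fin n)) M]
  [IsManifold (𝓡 n) ∞ M]

theorem isSubbundleOn_of_local {U : Set M} {F : Π x : M, Submodule ℝ (TangentSpace (𝓡 n) x)}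
    {r : ℕ} (h : ∀ x ∈ U, ∃ W ⊆ U, IsOpen W ∧ x ∈ W ∧ ∃ F', IsSubbundleOn W F' r ∧
      ∀ y ∈ W, F y = F' y) : IsSubbundleOn U F r := by
  intro x hx
  obtain ⟨W, hWU, hW, hxW, F', hF', heq⟩ := h x hx
  obtain ⟨W', hW', hxW', hW'W, X, hX, hspan⟩ := hF' x hxW
  exact ⟨W', hW', hxW', hW'W.trans hWU, X, hX, fun y hy =>
    ⟨(hspan y hy).1, (hspan y hy).2.trans (heq y (hW'W hy)).symm⟩⟩

namespace Structure

variable {S : Structure n M} {U W : Set M} {e₀ e₁ : Π y : M, S.E y}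
  {V V' : Fin 3 → Π x : M, Submodule ℝ (TangentSpace (𝓡 n) x)}
  {J J' : Π x : M, S.E x →ₗ[ℝ] S.E x}
  {φ : Π x : M, TangentSpace (𝓡 n) x →ₗ[ℝ] S.E x}
  {Ω Ω' : Π x : M, TangentSpace (𝓡 n) x [⋀^Fin 2]→L[ℝ] ℝ}
  {θ θ' : Π x : M, TangentSpace (𝓡 n) x [⋀^Fin 1]→L[ℝ] ℝ}

theorem Psi_apply (hJ : S.IsRotationOn U J) {x : M} (hx : x ∈ U)
    (v : Fin 2 → TangentSpace (𝓡 n) x) :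
    S.Psi hJ φ x v = S.g x (J x (φ x (v 0))) (φ x (v 1)) := by
  unfold Psi
  rw [dif_pos hx]
  rfl

/-- From φ = ξ³ e₁ − ξ⁴ e₀ one gets J φ = −ξ³ e₀ − ξ⁴ e₁, and the inner product of the two is ξ³ ∧
ξ⁴. -/
theorem IsAdapted.isWedge_Psi (hS : S.HasGrowthVector ![2, 3, 5]) (h : S.IsAdapted W e₀ e₁)
    (hWU : W ⊆ U) (hJ : S.IsRotationOn U J) (hJe : ∀ y ∈ W, J y = S.rotation e₀ e₁ y)
    (hφ : S.IsPhi φ) : h.IsWedge (S.Psi hJ φ) := by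
  intro x hx v w
  refine (Psi_apply hJ (hWU hx) ![v, w]).trans ?_
  have hφx := ((isPhiOn_univ_iff.2 hφ).mono (subset_univ W)).eq_phi hS h hx
  change S.g x (J x (φ x v)) (φ x w) = _
  rw [hφx, hJe x hx, h.phi_apply, h.phi_apply]
  simp only [map_sub, map_smul, rotation_e₀ h.toIsOrthonormalOn hx,
    rotation_e₁ h.toIsOrthonormalOn hx, LinearMap.sub_apply, LinearMap.smul_apply, map_neg,
    LinearMap.neg_apply, smul_eq_mul, h.norm₀ x hx, h.norm₁ x hx, h.orth x hx,
    S.symm x (e₁ x) (e₀ x)]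
  ring

/-- Condition (ii) over U speaks of forms θ over U, while the smaller set comes with its own θ. A
form θ' over U exists, and by uniqueness it agrees over W with the given one. -/
theorem IsCanonicalOn.mono (hS : S.HasGrowthVector ![2, 3, 5]) (hU : IsOpen U) (hW : IsOpen W)
    (hWU : W ⊆ U) (hJ : S.IsRotationOn U J) (h : S.IsCanonicalOn U J Ω V) :
    S.IsCanonicalOn W J Ω V := by
  refine ⟨h.1.mono hW hWU, fun x hx => h.2 x (hWU hx), fun θ hθ x hx u hu w hw => ?_⟩
  obtain ⟨θ', hθ'⟩ := exists_isThetaOn hS hU hJ h.1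
  rw [mextDeriv_congr (β := θ') (by
    filter_upwards [hW.mem_nhds hx] with y hy
    exact hθ.eq_of_isOpen hS hW (hJ.mono hWU) (h.1.mono hW hWU) (hθ'.mono hWU) hy)]
  exact h.3 θ' hθ' x (hWU hx) u hu w hw

/-- The ranks are fixed beforehand because a grading has one rank per summand over the whole set,
and local gradings alone would allow it to vary. -/
theorem isGradingOn_of_local {r : Fin 3 → ℕ} (hV : ∀ i, IsSubbundleOn U (V i) (r i))
    (h : ∀ x ∈ U, ∃ W ⊆ U, IsOpen W ∧ x ∈ W ∧ ∃ V', S.IsGradingOn W V' ∧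
      ∀ i, ∀ y ∈ W, V i y = V' i y) : S.IsGradingOn U V := by
  refine ⟨fun i => ⟨r i, hV i⟩, fun x hx => ?_, fun x hx k hk => ?_⟩ <;>
  obtain ⟨W, -, -, hxW, V', h', heq⟩ := h x hx
  · rw [show (fun i => V i x) = fun i => V' i x from funext fun i => heq i x hxW]
    exact h'.isInternal x hxW
  · rw [h'.flag_eq x hxW k hk]
    exact iSup_congr fun i => (heq i x hxW).symm

theorem isCanonicalOn_of_local {r : Fin 3 → ℕ} (hV : ∀ i, IsSubbundleOn U (V i) (r i))
    (h : ∀ x ∈ U, ∃ W ⊆ U, IsOpen W ∧ x ∈ W ∧ ∃ V', S.IsCanonicalOn W J Ω V' ∧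
      ∀ i, ∀ y ∈ W, V i y = V' i y) : S.IsCanonicalOn U J Ω V := by
  refine ⟨isGradingOn_of_local hV fun x hx => ?_, fun x hx => ?_, fun θ hθ x hx => ?_⟩ <;>
  obtain ⟨W, hWU, hW, hxW, V', h', heq⟩ := h x hx
  · exact ⟨W, hWU, hW, hxW, V', h'.1, heq⟩
  · rw [heq 2 x hxW]
    exact h'.2 x hxW
  · rw [heq 1 x hxW, heq 2 x hxW]
    exact h'.3 θ ((hθ.mono hWU).congr hW (fun _ _ => rfl) fun i y hy => (heq i y hy).symm) x hxW

theorem IsCanonicalOn.unique (hS : S.HasGrowthVector ![2, 3, 5]) (hφ : S.IsPhi φ) (hWU : W ⊆ U)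
    (hW : IsOpen W) (hJ : S.IsRotationOn U J) (h : S.IsCanonicalOn W J (S.Psi hJ φ) V)
    (h' : S.IsCanonicalOn W J (S.Psi hJ φ) V') (i : Fin 3) {x : M} (hx : x ∈ W) :
    V i x = V' i x := by
  have hJW := hJ.mono hWU
  obtain ⟨W', hW'W, hW', hxW', e₀, e₁, ha, hJe⟩ := hJW.exists_isAdapted hS hW hx
  have hc := h.mono hS hW hW' hW'W hJW
  have hc' := h'.mono hS hW hW' hW'W hJW
  obtain ⟨θ, hθ⟩ := exists_isThetaOn hS hW' (hJW.mono hW'W) hc.1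
  obtain ⟨θ', hθ'⟩ := exists_isThetaOn hS hW' (hJW.mono hW'W) hc'.1
  exact ha.grading_unique hJe (ha.isWedge_Psi hS (hW'W.trans hWU) hJ hJe hφ) hc.1 hc'.1 hθ hθ'
    hc.2 hc'.2 (hc.3 θ hθ) (hc'.3 θ' hθ') i hxW'

theorem exists_isCanonicalOn (hS : S.HasGrowthVector ![2, 3, 5]) (hφ : S.IsPhi φ)
    (hU : IsOpen U) (hJ : S.IsRotationOn U J) :
    ∃ V, (∀ i, IsSubbundleOn U (V i) (![2, 1, 2] i)) ∧ S.IsCanonicalOn U J (S.Psi hJ φ) V := by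
  obtain ⟨V, -, hr, hV⟩ := exists_of_locally_unique (U := U)
    (A := fun x => Fin 3 → Submodule ℝ (TangentSpace (𝓡 n) x))
    (P := fun W V => W ⊆ U ∧ (∀ i, IsSubbundleOn W (fun x => V x i) (![2, 1, 2] i)) ∧
      S.IsCanonicalOn W J (S.Psi hJ φ) fun i x => V x i)
    (fun hU' hW hWU h => ⟨hWU.trans h.1, fun i => (h.2.1 i).mono hW hWU,
      h.2.2.mono hS hU' hW hWU (hJ.mono h.1)⟩)
    (fun hW h h' x hx => funext fun i => h.2.2.unique hS hφ h.1 hW hJ h'.2.2 i hx)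
    (fun {W V} h => by
      have hr : ∀ i, IsSubbundleOn W (fun x => V x i) (![2, 1, 2] i) := fun i =>
        isSubbundleOn_of_local fun x hx => by
          obtain ⟨W', hW'W, hW', hxW', V', h', heq⟩ := h x hx
          exact ⟨W', hW'W, hW', hxW', _, h'.2.1 i, fun y hy => congrFun (heq y hy) i⟩
      refine ⟨fun x hx => ?_, hr, isCanonicalOn_of_local hr fun x hx => ?_⟩
      · obtain ⟨W', -, -, hxW', V', h', -⟩ := h x hx
        exact h'.1 hxW'
      · obtain ⟨W', hW'W, hW', hxW', V', h', heq⟩ := h x hx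
        exact ⟨W', hW'W, hW', hxW', _, h'.2.2, fun i y hy => congrFun (heq y hy) i⟩)
    (fun x hx => by
      obtain ⟨W, hWU, hW, hxW, e₀, e₁, h, hJe⟩ := hJ.exists_isAdapted hS hU hx
      obtain ⟨V, hr, hV⟩ := h.exists_isCanonicalOn hS hJe (h.isWedge_Psi hS hWU hJ hJe hφ)
      exact ⟨W, hWU, hW, hxW, fun x i => V i x, hWU, hr, hV⟩)
  exact ⟨fun i x => V x i, hr, hV⟩

/-- Two rotations agree locally up to a constant sign. -/
theorem IsRotationOn.exists_eq_smul (hS : S.HasGrowthVector ![2, 3, 5]) (hU : IsOpen U)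
    (hJ : S.IsRotationOn U J) (hJ' : S.IsRotationOn U J') {x : M} (hx : x ∈ U) :
    ∃ W ⊆ U, IsOpen W ∧ x ∈ W ∧ ∃ c : ℝ, c * c = 1 ∧ ∀ y ∈ W, J' y = c • J y := by
  obtain ⟨W, hWU, hW, hxW, e₀, e₁, h, hJe⟩ := hJ.exists_isAdapted hS hU hx
  -- J' e₀ is a unit vector orthogonal to e₀, so J' e₀ = f e₁ with f² = 1.
  let f : M → ℝ := fun y => S.g y (J' y (e₀ y)) (e₁ y)
  have hf : ContMDiffOn (𝓡 n) 𝓘(ℝ, ℝ) ∞ f W :=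
    S.smooth W hW _ _ (hJ'.smooth W hWU hW e₀ h.isSection₀) h.isSection₁
  have hJ₀ : ∀ y ∈ W, J' y (e₀ y) = f y • e₁ y := by
    intro y hy
    rw [h.eq_sum hS hy (J' y (e₀ y)), (hJ'.orthonormal y (hWU hy) _ (h.norm₀ y hy)).1, zero_smul,
      zero_add, S.symm]
  have hJ₁ : ∀ y ∈ W, J' y (e₁ y) = - f y • e₀ y := by
    intro y hy
    rw [h.eq_sum hS hy (J' y (e₁ y)), (hJ'.orthonormal y (hWU hy) _ (h.norm₁ y hy)).1, zero_smul,
      add_zero, S.symm, hJ'.skew (hWU hy)]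
  have hff : ∀ y ∈ W, f y * f y = 1 := by
    intro y hy
    have h1 := (hJ'.orthonormal y (hWU hy) _ (h.norm₀ y hy)).2
    rw [hJ₀ y hy] at h1
    simpa [h.norm₁ y hy] using h1
  have hcont : ContinuousAt f x := (hf.contMDiffAt (hW.mem_nhds hxW)).continuousAt
  -- By continuity f keeps its sign near x; having values ±1 it is then constant there.
  have hpos : ∀ᶠ y in 𝓝 x, 0 < f y * f x := by
    have h1 : ContinuousAt (fun y => f y * f x) x := hcont.mul continuousAt_const
    refine h1.eventually (lt_mem_nhds ?_)
    exact one_pos.trans_eq (hff x hxW).symm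
  obtain ⟨W', hW', hW'o, hxW'⟩ := eventually_nhds_iff.1 hpos
  refine ⟨W ∩ W', inter_subset_left.trans hWU, hW.inter hW'o, ⟨hxW, hxW'⟩, f x, hff x hxW,
    fun y hy => ?_⟩
  have hfy : f y = f x := by
    have h1 := hff y hy.1
    have h2 := hff x hxW
    have h3 := hW' y hy.2
    have h4 : (f y - f x) * (f y + f x) = 0 := by linear_combination h1 - h2
    rcases mul_eq_zero.1 h4 with h5 | h5
    · linarith
    · have : f y = - f x := by linarith
      rw [this] at h3
      nlinarith
  ext u
  rw [hJe y hy.1, LinearMap.smul_apply, h.eq_sum hS hy.1 u]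
  simp only [map_add, map_smul, hJ₀ y hy.1, hJ₁ y hy.1, rotation_e₀ h.toIsOrthonormalOn hy.1,
    rotation_e₁ h.toIsOrthonormalOn hy.1, hfy]
  congr 1
  module

/-- A canonical grading is canonical for the opposite orientation as well. -/
theorem IsCanonicalOn.of_eq_smul (hW : IsOpen W) (h : S.IsCanonicalOn W J Ω V) {c : ℝ}
    (hc : c * c = 1) (hJ : ∀ y ∈ W, J' y = c • J y) (hΩ : ∀ y ∈ W, Ω' y = c • Ω y) :
    S.IsCanonicalOn W J' Ω' V := by
  have hc0 : c ≠ 0 := by rintro rfl; simp at hc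
  refine ⟨h.1, fun x hx u hu w₁ hw₁ w₂ hw₂ => ?_, fun θ hθ x hx u hu w hw => ?_⟩
  · rw [mextDeriv_congr (β := fun y => c • Ω y)
      (by filter_upwards [hW.mem_nhds hx] with y hy using hΩ y hy), mextDeriv_const_smul,
      h.2 x hx u hu w₁ hw₁ w₂ hw₂, mul_zero]
  -- If θ is normalized for J' = cJ then cθ is normalized for J, since c² = 1; its kernel is the
  -- same.
  · have hθ' : S.IsThetaOn W J V fun y => c • θ y := by
      refine ⟨fun W' hW'W hW' X hX => ?_, fun y hy v => ?_, fun y hy u v => ?_⟩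
      · exact (contMDiffOn_const (c := c)).mul (hθ.smooth W' hW'W hW' X hX)
      · rw [← hθ.ker_eq y hy]
        change c * θ y ![v] = 0 ↔ _
        simp [hc0]
      · rw [mextDeriv_const_smul, hθ.normalized y hy, hJ y hy, LinearMap.smul_apply, map_smul,
          smul_eq_mul, ← mul_assoc, hc, one_mul]
    have h1 := h.3 _ hθ' x hx u hu w hw
    rw [mextDeriv_const_smul] at h1
    exact (mul_eq_zero.1 h1).resolve_left hc0

/-- The two rotations may differ by different signs on different parts of U. Being canonical is a
local property, so it suffices to treat each constant sign near a point. -/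
theorem IsCanonicalOn.of_isRotationOn (hS : S.HasGrowthVector ![2, 3, 5]) {U₀ : Set M}
    {r : Fin 3 → ℕ} (hV : ∀ i, IsSubbundleOn U (V i) (r i)) (hU₀ : IsOpen U₀) (hU : IsOpen U)
    (hUU : U ⊆ U₀) (hJ : S.IsRotationOn U₀ J) (hJ' : S.IsRotationOn U J')
    (h : S.IsCanonicalOn U₀ J (S.Psi hJ φ) V) : S.IsCanonicalOn U J' (S.Psi hJ' φ) V := by
  refine isCanonicalOn_of_local hV fun x hx => ?_
  obtain ⟨W, hWU, hW, hxW, c, hc, hcJ⟩ := (hJ.mono hUU).exists_eq_smul hS hU hJ' hx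
  refine ⟨W, hWU, hW, hxW, V, ?_, fun _ _ _ => rfl⟩
  refine (h.mono hS hU₀ hW (hWU.trans hUU) hJ).of_eq_smul hW hc hcJ fun y hy => ?_
  ext v
  rw [Psi_apply hJ' (hWU hy), hcJ y hy]
  change _ = c * S.Psi hJ φ y v
  rw [Psi_apply hJ (hUU (hWU hy))]
  simp

theorem exists_orientation (hS : S.HasGrowthVector ![2, 3, 5]) (x : M) : ∃ U : Set M, IsOpen U ∧
    x ∈ U ∧ ∃ J : Π y : M, S.E y →ₗ[ℝ] S.E y, S.IsRotationOn U J := by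
  obtain ⟨U, hU, hxU, e₀, e₁, h⟩ := exists_isOrthonormalOn hS x
  exact ⟨U, hU, hxU, _, h.isRotationOn hS⟩

theorem canonical_unique (hS : S.HasGrowthVector ![2, 3, 5]) (hφ : S.IsPhi φ) (hU : IsOpen U)
    (h : ∀ W ⊆ U, IsOpen W → ∀ J (hJ : S.IsRotationOn W J), S.IsCanonicalOn W J (S.Psi hJ φ) V)
    (h' : ∀ W ⊆ U, IsOpen W → ∀ J (hJ : S.IsRotationOn W J), S.IsCanonicalOn W J (S.Psi hJ φ) V')
    (i : Fin 3) {x : M} (hx : x ∈ U) : V i x = V' i x := by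
  obtain ⟨W, hW, hxW, J, hJ⟩ := exists_orientation hS x
  have hJ' := hJ.mono (inter_subset_left (t := U))
  exact (h _ inter_subset_right (hW.inter hU) J hJ').unique hS hφ subset_rfl (hW.inter hU) hJ'
    (h' _ inter_subset_right (hW.inter hU) J hJ') i ⟨hxW, hx⟩

/-- E need not be orientable over M, so the glued property quantifies over all orientations of all
open subsets. It holds near each point for the grading built from one local orientation. -/
theorem exists_canonical (hS : S.HasGrowthVector ![2, 3, 5]) (hφ : S.IsPhi φ) :
    ∃ V, S.IsGradingOn univ V ∧
      ∀ U, IsOpen U → ∀ J (hJ : S.IsRotationOn U J), S.IsCanonicalOn U J (S.Psi hJ φ) V := by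
  obtain ⟨V, -, hg, hV⟩ := exists_of_locally_unique (U := (univ : Set M))
    (A := fun x => Fin 3 → Submodule ℝ (TangentSpace (𝓡 n) x))
    (P := fun W V => (∀ i, IsSubbundleOn W (fun x => V x i) (![2, 1, 2] i)) ∧
      S.IsGradingOn W (fun i x => V x i) ∧ ∀ U ⊆ W, IsOpen U → ∀ J (hJ : S.IsRotationOn U J),
        S.IsCanonicalOn U J (S.Psi hJ φ) fun i x => V x i)
    (fun _ hW hWU h => ⟨fun i => (h.1 i).mono hW hWU, h.2.1.mono hW hWU,
      fun U hUW => h.2.2 U (hUW.trans hWU)⟩)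
    (fun hW h h' x hx => funext fun i => canonical_unique hS hφ hW h.2.2 h'.2.2 i hx)
    (fun {W V} h => by
      have hr : ∀ i, IsSubbundleOn W (fun x => V x i) (![2, 1, 2] i) := fun i =>
        isSubbundleOn_of_local fun x hx => by
          obtain ⟨W', hW'W, hW', hxW', V', h', heq⟩ := h x hx
          exact ⟨W', hW'W, hW', hxW', _, h'.1 i, fun y hy => congrFun (heq y hy) i⟩
      refine ⟨hr, isGradingOn_of_local hr fun x hx => ?_, fun U hUW hU J hJ =>
        isCanonicalOn_of_local (fun i => (hr i).mono hU hUW) fun x hx => ?_⟩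
      · obtain ⟨W', hW'W, hW', hxW', V', h', heq⟩ := h x hx
        exact ⟨W', hW'W, hW', hxW', _, h'.2.1, fun i y hy => congrFun (heq y hy) i⟩
      · obtain ⟨W', hW'W, hW', hxW', V', h', heq⟩ := h x (hUW hx)
        have hJ' := hJ.mono (inter_subset_left (t := W'))
        refine ⟨U ∩ W', inter_subset_left, hU.inter hW', ⟨hx, hxW'⟩, fun i x => V' x i, ?_,
          fun i y hy => congrFun (heq y hy.2) i⟩
        -- The two-forms Ψ for J over U and for its restriction are extended by zero outside
        -- different sets, so they are equal only over the smaller one. The sign c = 1 absorbs this.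
        refine (h'.2.2 _ inter_subset_right (hU.inter hW') J hJ').of_eq_smul (hU.inter hW')
          (c := 1) (one_mul 1) (fun y _ => (one_smul ℝ (J y)).symm) fun y hy => ?_
        ext v
        rw [one_smul, Psi_apply hJ hy.1, Psi_apply hJ' hy])
    (fun x _ => by
      obtain ⟨W, hW, hxW, J, hJ⟩ := exists_orientation hS x
      obtain ⟨V, hr, hV⟩ := exists_isCanonicalOn hS hφ hW hJ
      exact ⟨W, subset_univ W, hW, hxW, fun x i => V i x, hr, hV.1, fun U hUW hU J' hJ' =>
        hV.of_isRotationOn hS (fun i => (hr i).mono hU hUW) hW hU hUW hJ hJ'⟩)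
  exact ⟨fun i x => V x i, hg, fun U hU => hV U (subset_univ U) hU⟩

end Structure

end

end SubRiem

end

/-! ### The main theorem -/

theorem mainTheorem6 {n : ℕ} {M : Type*} [TopologicalSpace M] [T2Space M]
    [SecondCountableTopology M] [ChartedSpace (EuclideanSpace ℝ (Fin n)) M]
    [IsManifold (𝓡 n) ∞ M] (S : SubRiem.Structure n M) (hS : S.HasGrowthVector ![2, 3, 5]) :
    -- `E` is locally orientable
    (∀ x : M, ∃ U : Set M, IsOpen U ∧ x ∈ U ∧
      ∃ J : Π y : M, S.E y →ₗ[ℝ] S.E y, S.IsRotationOn U J) ∧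
    -- the one-form `φ` is well defined on all of `M`, and `θ` is well defined for each grading
    (∃! φ : Π x : M, TangentSpace (𝓡 n) x →ₗ[ℝ] S.E x, S.IsPhi φ) ∧
    (∀ U : Set M, IsOpen U → ∀ J : Π x : M, S.E x →ₗ[ℝ] S.E x, S.IsRotationOn U J →
      ∀ V : Fin 3 → Π x : M, Submodule ℝ (TangentSpace (𝓡 n) x), S.IsGradingOn U V →
        ∃ θ, S.IsThetaOn U J V θ ∧
          ∀ θ', S.IsThetaOn U J V θ' → ∀ x ∈ U, θ' x = θ x) ∧
    ∀ φ : Π x : M, TangentSpace (𝓡 n) x →ₗ[ℝ] S.E x, S.IsPhi φ →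
      -- on each oriented open set there is a unique grading with the two properties
      (∀ U : Set M, IsOpen U → ∀ (J : Π x : M, S.E x →ₗ[ℝ] S.E x) (hJ : S.IsRotationOn U J),
        ∃ V : Fin 3 → Π x : M, Submodule ℝ (TangentSpace (𝓡 n) x),
          (S.IsGradingOn U V ∧ S.CondI hJ φ V ∧ ∀ θ, S.IsThetaOn U J V θ → S.CondII U V θ) ∧
          ∀ V' : Fin 3 → Π x : M, Submodule ℝ (TangentSpace (𝓡 n) x),
            (S.IsGradingOn U V' ∧ S.CondI hJ φ V' ∧
              ∀ θ, S.IsThetaOn U J V' θ → S.CondII U V' θ) →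
            ∀ i, ∀ x ∈ U, V' i x = V i x) ∧
      -- these gradings do not depend on the orientation and form one unique grading of `TM`
      ∃! V : Fin 3 → Π x : M, Submodule ℝ (TangentSpace (𝓡 n) x),
        S.IsGradingOn Set.univ V ∧
        ∀ U : Set M, IsOpen U → ∀ (J : Π x : M, S.E x →ₗ[ℝ] S.E x) (hJ : S.IsRotationOn U J),
          S.CondI hJ φ V ∧ ∀ θ, S.IsThetaOn U J V θ → S.CondII U V θ := by
  refine ⟨SubRiem.Structure.exists_orientation hS, SubRiem.Structure.existsUnique_isPhi hS,
    fun U hU J hJ V hV => ?_, fun φ hφ => ⟨fun U hU J hJ => ?_, ?_⟩⟩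
  · obtain ⟨θ, hθ⟩ := SubRiem.Structure.exists_isThetaOn hS hU hJ hV
    exact ⟨θ, hθ, fun θ' hθ' x hx => hθ'.eq_of_isOpen hS hU hJ hV hθ hx⟩
  · obtain ⟨V, -, hV⟩ := SubRiem.Structure.exists_isCanonicalOn hS hφ hU hJ
    refine ⟨V, ⟨hV.isGradingOn, hV.closed, hV.condII⟩, fun V' hV' i x hx => ?_⟩
    have hV'' : S.IsCanonicalOn U J (S.Psi hJ φ) V' := ⟨hV'.1, hV'.2.1, hV'.2.2⟩
    exact hV''.unique hS hφ subset_rfl hU hJ hV i hx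
  · obtain ⟨V, hg, hV⟩ := SubRiem.Structure.exists_canonical hS hφ
    refine ⟨V, ⟨hg, fun U hU J hJ => ⟨(hV U hU J hJ).closed, (hV U hU J hJ).condII⟩⟩,
      fun V' hV' => funext fun i => funext fun x => ?_⟩
    exact SubRiem.Structure.canonical_unique hS hφ isOpen_univ
      (fun W _ hW J hJ => ⟨hV'.1.mono hW (Set.subset_univ W), (hV'.2 W hW J hJ).1,
        (hV'.2 W hW J hJ).2⟩) (fun W _ hW J hJ => hV W hW J hJ) i (Set.mem_univ x)
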